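/- Let $M$ be a Hausdorff manifold with $\dim M=n$. Let $(\Sigma,\omega)$ be a symplectic groupoid over $M$ with $\dim\Sigma=2n$ (a Lie groupoid with a symplectic form that is multiplicative: $\partial_\Sigma^*\omega=0$), and let $(\mathcal S,\theta)$ be a strict contact groupoid over $M$ with $\dim\mathcal S=2n+1$ (a Lie groupoid with a contact form that is multiplicative: $\partial_{\mathcal S}^*\theta=0$). Here $\partial^*=\mathrm{pr}_1^*-\mathsf m^*+\mathrm{pr}_2^*$ takes differential forms on a Lie groupoid $\mathcal G$ to differential forms on the manifold $\mathcal G_2$ of composable pairs, where $\mathrm{pr}_1,\mathrm{pr}_2$ are the projections and $\mathsf m$ is the multiplication; the manifold of arrows of a Lie groupoid is not assumed to be Hausdorff, but the target map is a submersion with Hausdorff fibers. Let $q:\mathcal S\to\Sigma$ be a surjective smooth homomorphism of groupoids over $\mathrm{id}_M$ such that $q^*\omega=-d\theta$. (This is the situation when $(\Sigma,\omega)$ and $(\mathcal S,\theta)$ both integrate a Poisson structure on $M$ and $q$ is the corresponding quotient map.) Suppose that the fibers of $q$ are lines (homeomorphic to $\mathbb R$) and that $\Sigma$ is Hausdorff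 and paracompact. Then there exist a smooth $1$-form $\theta_0\in\Omega^1(\Sigma)$ and a smooth cocycle $c\in\mathcal C^\infty(\Sigma_2)$, i.e. $c(g,h)+c(gh,k)=c(h,k)+c(g,hk)$ for all composable $g,h,k$, such that \[ \omega=-d\theta_0,\qquad \partial_\Sigma^*\theta_0=dc , \] both $c$ and $dc$ vanish at every point of the image of $M$ under $(\mathsf 1,\mathsf 1):M\to\Sigma_2$, and $\mathcal S$ is isomorphic to the central extension $\Sigma\times\mathbb R$ of $\Sigma$ determined by $c$, the groupoid over $M$ with product $(g,a)(h,b)=(gh,a+b+c(g,h))$: there is a diffeomorphism $\mathcal S\to\Sigma\times\mathbb R$ that is an isomorphism of groupoids over $\mathrm{id}_M$ and under which $q$ becomes the projection to $\Sigma$ and $\theta$ becomes $dz+q^*\theta_0$, where $z$ is the coordinate on $\mathbb R$. -/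

import Mathlib

open scoped Manifold ContDiff
open Manifold

/-! ### Differential forms on manifolds -/

section Forms

variable {E : Type*} [NormedAddCommGroup E] [NormedSpace ℝ E]
  {H : Type*} [TopologicalSpace H]
  {E' : Type*} [NormedAddCommGroup E'] [NormedSpace ℝ E']
  {H' : Type*} [TopologicalSpace H']

/-- A (not necessarily smooth) real differential `k`-form on the manifold `X`: an alternating
`k`-linear form on each tangent space. -/
abbrev FormField (I : ModelWithCorners ℝ E H) (k : ℕ) (X : Type*) [TopologicalSpace X]
    [ChartedSpace H X] : Type _ :=
  (x : X) → (TangentSpace I x) [⋀^Fin k]→L[ℝ] ℝ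

/-- The pullback `f^* α`, that is `(f^* α)_x (v₁, …, vₖ) = α_{f x} (T f v₁, …, T f vₖ)`. -/
noncomputable def FormField.pullback (I : ModelWithCorners ℝ E H) (I' : ModelWithCorners ℝ E' H')
    {k : ℕ} {X : Type*} [TopologicalSpace X] [ChartedSpace H X]
    {Y : Type*} [TopologicalSpace Y] [ChartedSpace H' Y]
    (f : X → Y) (α : FormField I' k Y) : FormField I k X :=
  fun x => (α (f x)).compContinuousLinearMap (mfderiv I I' f x)

/-- The differential `df` of a real function, as a `1`-form. -/
noncomputable def FormField.differential (I : ModelWithCorners ℝ E H)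
    {X : Type*} [TopologicalSpace X] [ChartedSpace H X] (f : X → ℝ) : FormField I 1 X :=
  fun x => ContinuousAlternatingMap.ofSubsingleton ℝ (TangentSpace I x) ℝ (0 : Fin 1)
    (mfderiv I 𝓘(ℝ, ℝ) f x)

variable {k : ℕ} {X : Type*} [TopologicalSpace X] [ChartedSpace E X]

/-- The expression of a form in the preferred chart at `x₀`: its pullback by the inverse of the
chart, a function from the model space to alternating forms on it (meaningful on the target of the
chart). -/
noncomputable def FormField.inChart (α : FormField 𝓘(ℝ, E) k X) (x₀ : X) :
    E → E [⋀^Fin k]→L[ℝ] ℝ :=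
  FormField.pullback 𝓘(ℝ, E) 𝓘(ℝ, E) (chartAt E x₀).symm α

/-- A form is smooth if its expressions in the charts of the atlas are. -/
def FormField.IsSmooth (α : FormField 𝓘(ℝ, E) k X) : Prop :=
  ∀ x₀ : X, ContDiffOn ℝ ∞ (α.inChart x₀) (chartAt E x₀).target

/-- The exterior derivative, computed at `x` in the preferred chart at `x`. -/
noncomputable def FormField.d (α : FormField 𝓘(ℝ, E) k X) : FormField 𝓘(ℝ, E) (k + 1) X :=
  fun x => ContinuousAlternatingMap.compContinuousLinearMap
    (extDeriv (α.inChart x) (chartAt E x x))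
    (mfderiv 𝓘(ℝ, E) 𝓘(ℝ, E) (chartAt E x) x)

/-- A symplectic form: a smooth, closed, nondegenerate `2`-form. -/
structure IsSymplecticForm (Ω : FormField 𝓘(ℝ, E) 2 X) : Prop where
  smooth : Ω.IsSmooth
  closed : Ω.d = 0
  nondegenerate : ∀ (x : X) (u : TangentSpace 𝓘(ℝ, E) x), u ≠ 0 →
    ∃ v : TangentSpace 𝓘(ℝ, E) x, Ω x ![u, v] ≠ 0

/-- The value of the top degree form `θ ∧ (dθ)ⁿ` on `2 n + 1` tangent vectors, by the usual formula
for the wedge product of one `1`-form and `n` forms of degree `2`. -/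
noncomputable def wedgeContact (n : ℕ) (θ : FormField 𝓘(ℝ, E) 1 X) (x : X)
    (v : Fin (2 * n + 1) → TangentSpace 𝓘(ℝ, E) x) : ℝ :=
  (1 / 2 ^ n : ℝ) * ∑ σ : Equiv.Perm (Fin (2 * n + 1)),
    ((Equiv.Perm.sign σ : ℤ) : ℝ) * θ x ![v (σ ⟨0, by omega⟩)] *
      ∏ i : Fin n, θ.d x ![v (σ ⟨2 * i + 1, by omega⟩), v (σ ⟨2 * i + 2, by omega⟩)]

/-- A contact form on a manifold of dimension `2 n + 1`: a smooth `1`-form `θ` such that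
`θ ∧ (dθ)ⁿ` vanishes nowhere. -/
structure IsContactForm (n : ℕ) (θ : FormField 𝓘(ℝ, E) 1 X) : Prop where
  smooth : θ.IsSmooth
  wedge_ne_zero : ∀ x : X, ∃ v : Fin (2 * n + 1) → TangentSpace 𝓘(ℝ, E) x,
    wedgeContact n θ x v ≠ 0

end Forms

/-! ### Groupoids -/

/-- A groupoid with set of arrows `G` and set of objects `M`; arrows go from right to left, so
`g h` is defined when `src g = tgt h`. -/
structure ArrowGroupoid (G M : Type*) where
  src : G → M
  tgt : G → M
  unit : M → G
  inv : G → G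
  mul : {p : G × G // src p.1 = tgt p.2} → G
  src_mul : ∀ p, src (mul p) = src p.1.2
  tgt_mul : ∀ p, tgt (mul p) = tgt p.1.1
  src_unit : ∀ x, src (unit x) = x
  tgt_unit : ∀ x, tgt (unit x) = x
  src_inv : ∀ g, src (inv g) = tgt g
  tgt_inv : ∀ g, tgt (inv g) = src g
  mul_assoc : ∀ (g h k : G) (gh : src g = tgt h) (hk : src h = tgt k),
    mul ⟨(mul ⟨(g, h), gh⟩, k), (src_mul ⟨(g, h), gh⟩).trans hk⟩ =
      mul ⟨(g, mul ⟨(h, k), hk⟩), gh.trans (tgt_mul ⟨(h, k), hk⟩).symm⟩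
  mul_unit : ∀ g, mul ⟨(g, unit (src g)), (tgt_unit _).symm⟩ = g
  unit_mul : ∀ g, mul ⟨(unit (tgt g), g), src_unit _⟩ = g
  inv_mul : ∀ g, mul ⟨(inv g, g), src_inv g⟩ = unit (src g)
  mul_inv : ∀ g, mul ⟨(g, inv g), (tgt_inv g).symm⟩ = unit (tgt g)

namespace ArrowGroupoid

variable {G G' M : Type*}

/-- The set of composable pairs. -/
abbrev Pairs (𝒢 : ArrowGroupoid G M) : Type _ := {p : G × G // 𝒢.src p.1 = 𝒢.tgt p.2}

/-- The first projection. -/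
def pr₁ (𝒢 : ArrowGroupoid G M) (p : 𝒢.Pairs) : G := p.1.1

/-- The second projection. -/
def pr₂ (𝒢 : ArrowGroupoid G M) (p : 𝒢.Pairs) : G := p.1.2

/-- The embedding `(1, 1)` of the objects into the composable pairs. -/
def unitPair (𝒢 : ArrowGroupoid G M) (x : M) : 𝒢.Pairs :=
  ⟨(𝒢.unit x, 𝒢.unit x), (𝒢.src_unit x).trans (𝒢.tgt_unit x).symm⟩

/-- A homomorphism of groupoids over the identity of the set of objects. -/
structure IsHom (𝒢 : ArrowGroupoid G M) (𝒢' : ArrowGroupoid G' M) (f : G → G') : Prop where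
  map_src : ∀ g, 𝒢'.src (f g) = 𝒢.src g
  map_tgt : ∀ g, 𝒢'.tgt (f g) = 𝒢.tgt g
  map_mul : ∀ p : 𝒢.Pairs, f (𝒢.mul p) = 𝒢'.mul ⟨(f (𝒢.pr₁ p), f (𝒢.pr₂ p)),
    (map_src _).trans (p.2.trans (map_tgt _).symm)⟩

/-- A (multiplicative, real valued) `2`-cocycle: for all composable `g, h, k`,
`c(g, h) + c(g h, k) = c(h, k) + c(g, h k)`. -/
def IsCocycle (𝒢 : ArrowGroupoid G M) (c : 𝒢.Pairs → ℝ) : Prop :=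
  ∀ (g h k : G) (gh : 𝒢.src g = 𝒢.tgt h) (hk : 𝒢.src h = 𝒢.tgt k),
    c ⟨(g, h), gh⟩ + c ⟨(𝒢.mul ⟨(g, h), gh⟩, k), (𝒢.src_mul ⟨(g, h), gh⟩).trans hk⟩ =
      c ⟨(h, k), hk⟩ + c ⟨(g, 𝒢.mul ⟨(h, k), hk⟩), gh.trans (𝒢.tgt_mul ⟨(h, k), hk⟩).symm⟩

theorem IsCocycle.congr_pair {𝒢 : ArrowGroupoid G M} (c : 𝒢.Pairs → ℝ) {g g' h h' : G}
    (hg : g = g') (hh : h = h') (e : 𝒢.src g = 𝒢.tgt h) (e' : 𝒢.src g' = 𝒢.tgt h') :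
    c ⟨(g, h), e⟩ = c ⟨(g', h'), e'⟩ := by
  subst hg hh; rfl

theorem IsCocycle.apply_unit_left {𝒢 : ArrowGroupoid G M} {c : 𝒢.Pairs → ℝ}
    (hc : 𝒢.IsCocycle c) (g : G) :
    c ⟨(𝒢.unit (𝒢.tgt g), g), 𝒢.src_unit _⟩ = c (𝒢.unitPair (𝒢.tgt g)) := by
  have e : 𝒢.src (𝒢.unit (𝒢.tgt g)) = 𝒢.tgt (𝒢.unit (𝒢.tgt g)) := by
    rw [𝒢.src_unit, 𝒢.tgt_unit]
  have key := hc (𝒢.unit (𝒢.tgt g)) (𝒢.unit (𝒢.tgt g)) g e (𝒢.src_unit _)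
  have h1 : 𝒢.mul ⟨(𝒢.unit (𝒢.tgt g), 𝒢.unit (𝒢.tgt g)), e⟩ = 𝒢.unit (𝒢.tgt g) := by
    have := 𝒢.mul_unit (𝒢.unit (𝒢.tgt g))
    simpa only [𝒢.src_unit] using this
  have h2 := IsCocycle.congr_pair c h1 (rfl : g = g)
    ((𝒢.src_mul _).trans (𝒢.src_unit _)) (𝒢.src_unit _)
  have h3 := IsCocycle.congr_pair c (rfl : 𝒢.unit (𝒢.tgt g) = _) (𝒢.unit_mul g)
    (e.trans (𝒢.tgt_mul ⟨(𝒢.unit (𝒢.tgt g), g), 𝒢.src_unit _⟩).symm) (𝒢.src_unit _)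
  have h4 : c (𝒢.unitPair (𝒢.tgt g)) = c ⟨(𝒢.unit (𝒢.tgt g), 𝒢.unit (𝒢.tgt g)), e⟩ := rfl
  linarith

theorem IsCocycle.apply_unit_right {𝒢 : ArrowGroupoid G M} {c : 𝒢.Pairs → ℝ}
    (hc : 𝒢.IsCocycle c) (g : G) :
    c ⟨(g, 𝒢.unit (𝒢.src g)), (𝒢.tgt_unit _).symm⟩ = c (𝒢.unitPair (𝒢.src g)) := by
  have e : 𝒢.src (𝒢.unit (𝒢.src g)) = 𝒢.tgt (𝒢.unit (𝒢.src g)) := by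
    rw [𝒢.src_unit, 𝒢.tgt_unit]
  have key := hc g (𝒢.unit (𝒢.src g)) (𝒢.unit (𝒢.src g)) (𝒢.tgt_unit _).symm e
  have h1 : 𝒢.mul ⟨(𝒢.unit (𝒢.src g), 𝒢.unit (𝒢.src g)), e⟩ = 𝒢.unit (𝒢.src g) := by
    have := 𝒢.mul_unit (𝒢.unit (𝒢.src g))
    simpa only [𝒢.src_unit] using this
  have h2 := IsCocycle.congr_pair c (𝒢.mul_unit g) (rfl : 𝒢.unit (𝒢.src g) = _)
    ((𝒢.src_mul _).trans e) (𝒢.tgt_unit _).symm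
  have h3 := IsCocycle.congr_pair c (rfl : g = g) h1
    ((𝒢.tgt_unit _).symm.trans
      (𝒢.tgt_mul ⟨(𝒢.unit (𝒢.src g), 𝒢.unit (𝒢.src g)), e⟩).symm) (𝒢.tgt_unit _).symm
  have h4 : c (𝒢.unitPair (𝒢.src g)) = c ⟨(𝒢.unit (𝒢.src g), 𝒢.unit (𝒢.src g)), e⟩ := rfl
  linarith

theorem IsCocycle.apply_inv {𝒢 : ArrowGroupoid G M} {c : 𝒢.Pairs → ℝ}
    (hc : 𝒢.IsCocycle c) (g : G) :
    c ⟨(g, 𝒢.inv g), (𝒢.tgt_inv g).symm⟩ + c (𝒢.unitPair (𝒢.tgt g)) =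
      c ⟨(𝒢.inv g, g), 𝒢.src_inv g⟩ + c (𝒢.unitPair (𝒢.src g)) := by
  have key := hc g (𝒢.inv g) g (𝒢.tgt_inv g).symm (𝒢.src_inv g)
  have h1 := IsCocycle.congr_pair c (𝒢.mul_inv g) (rfl : g = g)
    ((𝒢.src_mul _).trans (𝒢.src_inv g)) (𝒢.src_unit _)
  have h2 := IsCocycle.congr_pair c (rfl : g = g) (𝒢.inv_mul g)
    ((𝒢.tgt_inv g).symm.trans (𝒢.tgt_mul ⟨(𝒢.inv g, g), 𝒢.src_inv g⟩).symm) (𝒢.tgt_unit _).symm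
  have h3 := hc.apply_unit_left g
  have h4 := hc.apply_unit_right g
  linarith

/-- The central extension `G × ℝ` of a groupoid by `ℝ` determined by a cocycle `c`; the product is
`(g, a) (h, b) = (g h, a + b + c(g, h))`. -/
noncomputable def centralExtension (𝒢 : ArrowGroupoid G M) (c : 𝒢.Pairs → ℝ)
    (hc : 𝒢.IsCocycle c) : ArrowGroupoid (G × ℝ) M where
  src γ := 𝒢.src γ.1
  tgt γ := 𝒢.tgt γ.1
  unit x := (𝒢.unit x, -c (𝒢.unitPair x))
  inv γ := (𝒢.inv γ.1,
    -γ.2 - c ⟨(γ.1, 𝒢.inv γ.1), (𝒢.tgt_inv γ.1).symm⟩ - c (𝒢.unitPair (𝒢.tgt γ.1)))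
  mul p := (𝒢.mul ⟨(p.1.1.1, p.1.2.1), p.2⟩,
    p.1.1.2 + p.1.2.2 + c ⟨(p.1.1.1, p.1.2.1), p.2⟩)
  src_mul p := 𝒢.src_mul _
  tgt_mul p := 𝒢.tgt_mul _
  src_unit x := 𝒢.src_unit x
  tgt_unit x := 𝒢.tgt_unit x
  src_inv γ := 𝒢.src_inv γ.1
  tgt_inv γ := 𝒢.tgt_inv γ.1
  mul_assoc g h k gh hk := by
    refine Prod.ext (𝒢.mul_assoc _ _ _ gh hk) ?_
    have := hc g.1 h.1 k.1 gh hk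
    dsimp only
    linarith
  mul_unit g := by
    refine Prod.ext (𝒢.mul_unit _) ?_
    have := hc.apply_unit_right g.1
    dsimp only
    linarith
  unit_mul g := by
    refine Prod.ext (𝒢.unit_mul _) ?_
    have := hc.apply_unit_left g.1
    dsimp only
    linarith
  inv_mul g := by
    refine Prod.ext (𝒢.inv_mul _) ?_
    have := hc.apply_inv g.1
    dsimp only
    linarith
  mul_inv g := by
    refine Prod.ext (𝒢.mul_inv _) ?_
    dsimp only
    linarith

/-- A Lie groupoid with arrows `G` (a possibly non-Hausdorff manifold of dimension `a`), objects
`M` (of dimension `b`), and with the manifold structure (of dimension `e`) on the set of composable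
pairs that makes it an embedded submanifold of `G × G`. -/
structure IsLie (a b e : ℕ) [TopologicalSpace G] [ChartedSpace (EuclideanSpace ℝ (Fin a)) G]
    [TopologicalSpace M] [ChartedSpace (EuclideanSpace ℝ (Fin b)) M] (𝒢 : ArrowGroupoid G M)
    [ChartedSpace (EuclideanSpace ℝ (Fin e)) 𝒢.Pairs] : Prop where
  arrows_manifold : IsManifold (𝓡 a) ∞ G
  objects_manifold : IsManifold (𝓡 b) ∞ M
  objects_t2 : T2Space M
  pairs_manifold : IsManifold (𝓡 e) ∞ 𝒢.Pairs
  pairs_embedding : IsSmoothEmbedding (𝓡 e) ((𝓡 a).prod (𝓡 a)) ∞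
    (Subtype.val : 𝒢.Pairs → G × G)
  smooth_src : ContMDiff (𝓡 a) (𝓡 b) ∞ 𝒢.src
  smooth_tgt : ContMDiff (𝓡 a) (𝓡 b) ∞ 𝒢.tgt
  smooth_unit : ContMDiff (𝓡 b) (𝓡 a) ∞ 𝒢.unit
  smooth_inv : ContMDiff (𝓡 a) (𝓡 a) ∞ 𝒢.inv
  smooth_mul : ContMDiff (𝓡 e) (𝓡 a) ∞ 𝒢.mul
  submersion_tgt : IsSubmersion (𝓡 a) (𝓡 b) ∞ 𝒢.tgt
  t2_fiber_tgt : ∀ x : M, T2Space (𝒢.tgt ⁻¹' {x})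

/-- The multiplicative coboundary `∂^* = pr₁^* - m^* + pr₂^*` on differential forms. -/
noncomputable def coboundary {a : ℕ} (e : ℕ) {k : ℕ} [TopologicalSpace G]
    [ChartedSpace (EuclideanSpace ℝ (Fin a)) G] (𝒢 : ArrowGroupoid G M)
    [ChartedSpace (EuclideanSpace ℝ (Fin e)) 𝒢.Pairs] (α : FormField (𝓡 a) k G) :
    FormField (𝓡 e) k 𝒢.Pairs :=
  FormField.pullback (𝓡 e) (𝓡 a) 𝒢.pr₁ α - FormField.pullback (𝓡 e) (𝓡 a) 𝒢.mul α +
    FormField.pullback (𝓡 e) (𝓡 a) 𝒢.pr₂ α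

end ArrowGroupoid

/-- A symplectic groupoid: a Lie groupoid with a multiplicative symplectic form. -/
structure IsSymplecticGroupoid (a b e : ℕ) {G M : Type*} [TopologicalSpace G]
    [ChartedSpace (EuclideanSpace ℝ (Fin a)) G] [TopologicalSpace M]
    [ChartedSpace (EuclideanSpace ℝ (Fin b)) M] (𝒢 : ArrowGroupoid G M)
    [ChartedSpace (EuclideanSpace ℝ (Fin e)) 𝒢.Pairs] (Ω : FormField (𝓡 a) 2 G) : Prop where
  lie : 𝒢.IsLie a b e
  symplectic : IsSymplecticForm Ω
  multiplicative : 𝒢.coboundary e Ω = 0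

/-- A strict contact groupoid of dimension `2 n + 1`: a Lie groupoid with a multiplicative contact
form. -/
structure IsStrictContactGroupoid (n b e : ℕ) {G M : Type*} [TopologicalSpace G]
    [ChartedSpace (EuclideanSpace ℝ (Fin (2 * n + 1))) G] [TopologicalSpace M]
    [ChartedSpace (EuclideanSpace ℝ (Fin b)) M] (𝒢 : ArrowGroupoid G M)
    [ChartedSpace (EuclideanSpace ℝ (Fin e)) 𝒢.Pairs]
    (θ : FormField (𝓡 (2 * n + 1)) 1 G) : Prop where
  lie : 𝒢.IsLie (2 * n + 1) b e
  contact : IsContactForm n θ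
  multiplicative : 𝒢.coboundary e θ = 0

/-! The map `q` turns out to be a principal `ℝ`-bundle for the Reeb flow of `θ`, and such a bundle
over a paracompact Hausdorff base has a global section; everything asserted is read off from a
section that is normalized along the units.

A vector killed by `Tq` is killed by `dθ = -q^*ω`, so by the contact condition it is zero unless `θ`
sees it. Hence the kernel of `Tq` has dimension at most one, `q` is a submersion
(`surjective_tangentMap`), and locally `θ = dz + q^*α` for a fibre coordinate `z`
(`exists_flowBox`). Curves in a fibre with `θ(γ') = 1` therefore exist locally and are unique.

Completeness of this flow comes from multiplicativity. Over a unit the fibre of `q` is a group, and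
since `θ` is additive on products, the Reeb curve through the unit is a local homomorphism from `ℝ`.
It extends to a homomorphism, which is onto because the line is connected and injective because the
line is not compact (`exists_one_parameter_group`). These subgroups vary smoothly with the unit and
are central: left and right translates of them through an arrow are Reeb curves with the same
starting point (`exists_central_family`). Multiplication by them is a free action `A` of `ℝ`,
transitive on the fibres of `q`, with `A_a(s) A_b(s') = A_{a+b}(s s')` (`exists_reebAction`).

Local fibre coordinates that increase with unit speed form an affine family, so a partition of unity
on `Σ` glues them to a global height `z`; subtracting its value at the unit of the target makes it
vanish on units. Its zero set is the image of a section `σ` (`exists_trivialization`).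

Now put `θ₀ = σ^*θ` and `c(g, h) = z(σ(g) σ(h))`. Then `σ(g) σ(h) = A_{c(g,h)} σ(gh)`: associativity
gives the cocycle identity, and pulling `θ` back along this equation gives `∂^*θ₀ = dc`. The
equation `s = A_{z(s)} σ(q(s))` gives the isomorphism and `θ = dz + q^*θ₀`. Since `σ` preserves
units, `c` vanishes as soon as one argument is a unit; the tangent space of `Σ₂` at a pair of units
is spanned by the directions of such pairs, so `dc` vanishes there as well
(`IsLie.tangentMapCLM_unitPair_eq_zero`). -/

open Set Filter Topology

/-! ### Inverse functions and local sections on manifolds. -/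

section InverseFunction

variable {E : Type*} [NormedAddCommGroup E] [NormedSpace ℝ E]
  {F : Type*} [NormedAddCommGroup F] [NormedSpace ℝ F]

/-- The inverse function theorem, with an inverse that is smooth on a neighbourhood. -/
theorem exists_partialDiffeomorph_of_fderiv_equiv [CompleteSpace E] {f : E → F} {U : Set E}
    (hU : IsOpen U) (hf : ContDiffOn ℝ ∞ f U) {x : E} (hx : x ∈ U) (f' : E ≃L[ℝ] F)
    (hf' : (f' : E →L[ℝ] F) = fderiv ℝ f x) :
    ∃ Φ : PartialDiffeomorph 𝓘(ℝ, E) 𝓘(ℝ, F) E F ∞, x ∈ Φ.source ∧ Φ.source ⊆ U ∧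
      (Φ.toFun = f) := by
  have hfx : ContDiffAt ℝ ∞ f x := hf.contDiffAt (hU.mem_nhds hx)
  have hd : HasFDerivAt f (f' : E →L[ℝ] F) x := by
    rw [hf']; exact (hfx.differentiableAt (by simp)).hasFDerivAt
  let e := hfx.toOpenPartialHomeomorph f hd (by simp)
  have hec : ∀ y, e y = f y := fun y => rfl
  have hcont : ContinuousOn (fderiv ℝ f) U := hf.continuousOn_fderiv_of_isOpen hU (by simp)
  -- Invertibility of the derivative is an open condition; restricting to it makes the inverse
  -- smooth on the whole target and not only at the image of `x`.
  let V : Set E := U ∩ fderiv ℝ f ⁻¹' (range ((↑) : (E ≃L[ℝ] F) → E →L[ℝ] F))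
  have hV : IsOpen V := hcont.isOpen_inter_preimage hU (ContinuousLinearEquiv.isOpen)
  have hxV : x ∈ V := ⟨hx, f', hf'⟩
  let e' := e.restrOpen V hV
  have hsrc : e'.source = e.source ∩ V := e.restrOpen_source V hV
  refine ⟨⟨e'.toPartialEquiv, e'.open_source, e'.open_target, ?_, ?_⟩, ?_, ?_, ?_⟩
  · refine ContDiffOn.contMDiffOn ?_
    refine hf.mono ?_
    rw [hsrc]; exact fun y hy => hy.2.1
  · refine ContDiffOn.contMDiffOn ?_
    intro y hy
    have hy' : e'.symm y ∈ e.source ∩ V := hsrc ▸ e'.map_target hy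
    obtain ⟨g, hg⟩ := hy'.2.2
    have h1 : ContDiffAt ℝ ∞ f (e'.symm y) := hf.contDiffAt (hU.mem_nhds hy'.2.1)
    have h2 : HasFDerivAt e' (g : E →L[ℝ] F) (e'.symm y) := by
      rw [hg]; exact (h1.differentiableAt (by simp)).hasFDerivAt
    exact (e'.contDiffAt_symm hy h2 h1).contDiffWithinAt
  · change x ∈ e'.source
    rw [hsrc]
    exact ⟨hfx.mem_toOpenPartialHomeomorph_source hd (by simp), hxV⟩
  · change e'.source ⊆ U
    rw [hsrc]; exact fun y hy => hy.2.1
  · rfl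

variable {H : Type*} [TopologicalSpace H] {I : ModelWithCorners ℝ E H} [I.Boundaryless]
  {H' : Type*} [TopologicalSpace H'] {J : ModelWithCorners ℝ F H'} [J.Boundaryless]
  {X : Type*} [TopologicalSpace X] [ChartedSpace H X] [IsManifold I ∞ X]
  {Y : Type*} [TopologicalSpace Y] [ChartedSpace H' Y] [IsManifold J ∞ Y]

variable (I) in
/-- The extended chart of a boundaryless manifold as a partial diffeomorphism. -/
noncomputable def extChartDiffeo (x : X) : PartialDiffeomorph I 𝓘(ℝ, E) X E ∞ where
  toPartialEquiv := extChartAt I x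
  open_source := isOpen_extChartAt_source x
  open_target := isOpen_extChartAt_target x
  contMDiffOn_toFun := by
    have := contMDiffOn_extChartAt (I := I) (n := ∞) (x := x)
    rwa [← extChartAt_source I x] at this
  contMDiffOn_invFun := contMDiffOn_extChartAt_symm x

/-- The inverse function theorem on manifolds. -/
theorem isLocalDiffeomorphAt_of_mfderiv_bijective [CompleteSpace E] [CompleteSpace F]
    {f : X → Y} {U : Set X}
    (hU : IsOpen U) (hf : ContMDiffOn I J ∞ f U) {x : X} (hx : x ∈ U)
    (hb : Function.Bijective (mfderiv I J f x)) :
    ∃ Φ : PartialDiffeomorph I J X Y ∞, x ∈ Φ.source ∧ Φ.source ⊆ U ∧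
      EqOn f Φ Φ.source := by
  let φ := extChartAt I x
  let ψ := extChartAt J (f x)
  let W : Set E := φ.target ∩ φ.symm ⁻¹' (U ∩ f ⁻¹' ψ.source)
  have hW : IsOpen W := by
    refine (continuousOn_extChartAt_symm x).isOpen_inter_preimage (isOpen_extChartAt_target x) ?_
    exact hf.continuousOn.isOpen_inter_preimage hU (isOpen_extChartAt_source _)
  let g : E → F := ψ ∘ f ∘ φ.symm
  have hg : ContDiffOn ℝ ∞ g W := by
    rw [← contMDiffOn_iff_contDiffOn]
    refine ContMDiffOn.comp (t := (chartAt H' (f x)).source) contMDiffOn_extChartAt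
      (ContMDiffOn.comp (t := U) hf ((contMDiffOn_extChartAt_symm x).mono inter_subset_left)
        fun y hy => hy.2.1) fun y hy => ?_
    rw [← extChartAt_source J]
    exact hy.2.2
  have hx0 : φ.symm (φ x) = x := extChartAt_to_inv x
  have hxW : φ x ∈ W := by
    refine ⟨mem_extChartAt_target x, ?_⟩
    change φ.symm (φ x) ∈ U ∩ f ⁻¹' ψ.source
    rw [hx0]
    exact ⟨hx, mem_extChartAt_source (I := J) (f x)⟩
  have hfx : MDifferentiableAt I J f x :=
    (hf.contMDiffAt (hU.mem_nhds hx)).mdifferentiableAt (by simp)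
  have hfd : mfderiv I J f x = fderiv ℝ g (φ x) := by
    rw [hfx.mfderiv]
    simp [g, writtenInExtChartAt, φ, ψ, fderivWithin_univ, I.range_eq_univ, Function.comp_def]
    rfl
  let L : E →L[ℝ] F := mfderiv I J f x
  let L' : E ≃L[ℝ] F := ContinuousLinearEquiv.ofBijective L
    (LinearMap.ker_eq_bot.2 hb.1) (LinearMap.range_eq_top.2 hb.2)
  obtain ⟨Φ, h1, h2, h3⟩ := exists_partialDiffeomorph_of_fderiv_equiv hW hg hxW L'
    (by ext v; exact congrArg (fun T : E →L[ℝ] F => T v) hfd)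
  let Θ := ((extChartDiffeo I x).trans Φ).trans (extChartDiffeo J (f x)).symm
  have hsrc : ∀ y, y ∈ Θ.source ↔ y ∈ φ.source ∧ φ y ∈ Φ.source ∧ Φ.toFun (φ y) ∈ ψ.target := by
    intro y
    change (y ∈ (φ.source ∩ φ ⁻¹' Φ.source) ∩ _) ↔ _
    simp only [mem_inter_iff, mem_preimage, and_assoc]
    rfl
  refine ⟨Θ, ?_, ?_, ?_⟩
  · rw [hsrc]
    refine ⟨mem_extChartAt_source x, h1, ?_⟩
    rw [h3]
    refine ψ.map_source ?_
    change f (φ.symm (φ x)) ∈ _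
    rw [hx0]; exact mem_extChartAt_source _
  · intro y hy
    rw [hsrc] at hy
    have := (h2 hy.2.1).2.1
    rwa [φ.left_inv hy.1] at this
  · intro y hy
    rw [hsrc] at hy
    change _ = ψ.symm (Φ.toFun (φ y))
    have h4 := (h2 hy.2.1).2.2
    rw [mem_preimage, φ.left_inv hy.1] at h4
    rw [h3]
    change _ = ψ.symm (ψ (f (φ.symm (φ y))))
    rw [φ.left_inv hy.1, ψ.left_inv h4]

/-- A smooth map with a surjective differential at a point has a smooth local section there. -/
theorem exists_local_section [FiniteDimensional ℝ E] [FiniteDimensional ℝ F] {f : X → Y}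
    (hf : ContMDiff I J ∞ f) (x : X) (hb : Function.Surjective (mfderiv I J f x)) :
    ∃ (V : Set Y) (σ : Y → X), IsOpen V ∧ f x ∈ V ∧ ContMDiffOn J I ∞ σ V ∧
      (∀ y ∈ V, f (σ y) = y) ∧ σ (f x) = x := by
  have : CompleteSpace E := FiniteDimensional.complete ℝ E
  have : CompleteSpace F := FiniteDimensional.complete ℝ F
  let φ := extChartAt I x
  let D : E →L[ℝ] F := mfderiv I J f x
  obtain ⟨R, hR⟩ := (D : E →ₗ[ℝ] F).exists_rightInverse_of_surjective
    (LinearMap.range_eq_top.2 hb)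
  let R' : F →L[ℝ] E := LinearMap.toContinuousLinearMap R
  have hRR : ∀ v, D (R' v) = v := fun v => congrArg (fun T : F →ₗ[ℝ] F => T v) hR
  -- An affine slice through `x` complementary to the kernel of the differential. On it `f` has
  -- identity differential at the origin, so it can be inverted there, and the inverse followed by
  -- the slice is the section.
  let h : F → E := fun y => φ x + R' y
  have hh : ContDiff ℝ ∞ h := contDiff_const.add R'.contDiff
  have hdh : HasFDerivAt h R' 0 := R'.hasFDerivAt.const_add _
  let W : Set F := h ⁻¹' φ.target
  have hW : IsOpen W := (isOpen_extChartAt_target x).preimage hh.continuous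
  have h0 : h 0 = φ x := by simp [h]
  have h0W : (0 : F) ∈ W := by
    change h 0 ∈ φ.target
    rw [h0]; exact mem_extChartAt_target x
  let g : F → X := φ.symm ∘ h
  have hg : ContMDiffOn 𝓘(ℝ, F) I ∞ g W :=
    (contMDiffOn_extChartAt_symm x).comp hh.contMDiff.contMDiffOn fun y hy => hy
  have hg0 : g 0 = x := by
    change φ.symm (h 0) = x
    rw [h0]; exact extChartAt_to_inv x
  have hfg : ContMDiffOn 𝓘(ℝ, F) J ∞ (f ∘ g) W := hf.comp_contMDiffOn hg
  have hder : mfderiv 𝓘(ℝ, F) J (f ∘ g) 0 = ContinuousLinearMap.id ℝ F := by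
    have e1 : MDifferentiableAt 𝓘(ℝ, F) I g 0 :=
      (hg.contMDiffAt (hW.mem_nhds h0W)).mdifferentiableAt (by simp)
    rw [mfderiv_comp_of_eq (hf.mdifferentiableAt (by simp)) e1 hg0]
    have e2 : mfderiv 𝓘(ℝ, F) I g 0 = R' := by
      have e3 : MDifferentiableAt 𝓘(ℝ, E) I φ.symm (h 0) := by
        rw [h0]
        exact ((contMDiffOn_extChartAt_symm (n := ∞) x).contMDiffAt
          ((isOpen_extChartAt_target x).mem_nhds (mem_extChartAt_target x))).mdifferentiableAt
          (by simp)
      have e4 : MDifferentiableAt 𝓘(ℝ, F) 𝓘(ℝ, E) h 0 := hdh.differentiableAt.mdifferentiableAt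
      rw [mfderiv_comp _ e3 e4, mfderiv_eq_fderiv, hdh.fderiv, h0]
      have e5 : mfderiv 𝓘(ℝ, E) I φ.symm (φ x) = ContinuousLinearMap.id ℝ E := by
        have := mfderivWithin_range_extChartAt_symm (I := I) (x := x)
        rwa [I.range_eq_univ, mfderivWithin_univ] at this
      rw [e5]
      rfl
    rw [e2]
    ext v
    have e6 : ∀ x', x' = x → ∀ w : E, (mfderiv I J f x' w : F) = D w := by
      rintro _ rfl w; rfl
    exact (e6 _ hg0 (R' v)).trans (hRR v)
  obtain ⟨Φ, h1, h2, h3⟩ := isLocalDiffeomorphAt_of_mfderiv_bijective hW hfg h0W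
    (by rw [hder]; exact Function.bijective_id)
  have hΦ0 : Φ.toFun 0 = f x := by
    rw [← h3 h1]; simp [hg0]
  refine ⟨Φ.target, g ∘ Φ.invFun, Φ.open_target, hΦ0 ▸ Φ.map_source h1, ?_, ?_, ?_⟩
  · exact hg.comp Φ.contMDiffOn_invFun fun y hy => h2 (Φ.map_target hy)
  · intro y hy
    have := h3 (Φ.map_target hy)
    exact this.trans (Φ.right_inv hy)
  · change g (Φ.invFun (f x)) = x
    rw [← hΦ0]
    have : Φ.invFun (Φ.toFun 0) = 0 := Φ.left_inv h1
    rw [this, hg0]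

end InverseFunction

/-! ### Pullbacks of forms, with differentials as maps between the model spaces. -/

section FormCalculus

variable {E : Type*} [NormedAddCommGroup E] [NormedSpace ℝ E]
  {H : Type*} [TopologicalSpace H]
  {E' : Type*} [NormedAddCommGroup E'] [NormedSpace ℝ E']
  {H' : Type*} [TopologicalSpace H']
  {E'' : Type*} [NormedAddCommGroup E''] [NormedSpace ℝ E'']
  {H'' : Type*} [TopologicalSpace H'']
  {I : ModelWithCorners ℝ E H} {I' : ModelWithCorners ℝ E' H'} {I'' : ModelWithCorners ℝ E'' H''}
  {X : Type*} [TopologicalSpace X] [ChartedSpace H X]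
  {Y : Type*} [TopologicalSpace Y] [ChartedSpace H' Y]
  {Z : Type*} [TopologicalSpace Z] [ChartedSpace H'' Z] {k : ℕ}

theorem FormField.pullback_congr (α : FormField I' k Y) {f g : X → Y} {x : X}
    (h : f =ᶠ[𝓝 x] g) : FormField.pullback I I' f α x = FormField.pullback I I' g α x := by
  let P : Y → (E →L[ℝ] E') → E [⋀^Fin k]→L[ℝ] ℝ := fun y L =>
    (show E' [⋀^Fin k]→L[ℝ] ℝ from α y).compContinuousLinearMap L
  have h2 : (mfderiv I I' f x : E →L[ℝ] E') = mfderiv I I' g x := h.mfderiv_eq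
  exact congrArg₂ P h.self_of_nhds h2

theorem FormField.pullback_id (α : FormField I k X) (x : X) :
    FormField.pullback I I id α x = α x := by
  unfold FormField.pullback
  rw [mfderiv_id]
  ext v
  rfl

theorem FormField.pullback_comp (α : FormField I'' k Z) {f : X → Y} {g : Y → Z} {x : X}
    (hg : MDifferentiableAt I' I'' g (f x)) (hf : MDifferentiableAt I I' f x) :
    FormField.pullback I I'' (g ∘ f) α x =
      FormField.pullback I I' f (FormField.pullback I' I'' g α) x := by
  unfold FormField.pullback
  rw [mfderiv_comp x hg hf]
  rfl

theorem FormField.pullback_congr_form {α β : FormField I' k Y} (f : X → Y) {x : X}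
    (h : α (f x) = β (f x)) : FormField.pullback I I' f α x = FormField.pullback I I' f β x := by
  unfold FormField.pullback
  rw [h]

/-- The differential of a map between manifolds, as a map between the model spaces. -/
noncomputable def tangentMapCLM (I : ModelWithCorners ℝ E H) (I' : ModelWithCorners ℝ E' H')
    (f : X → Y) (x : X) : E →L[ℝ] E' :=
  mfderiv I I' f x

/-- Between fixed model spaces, differentials at points that are equal only by a proved equation
have the same type, so the chain rule can be applied by rewriting. -/
theorem tangentMapCLM_congr {f g : X → Y} {x : X} (h : f =ᶠ[𝓝 x] g) :
    tangentMapCLM I I' f x = tangentMapCLM I I' g x :=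
  h.mfderiv_eq

theorem tangentMapCLM_comp {f : X → Y} {g : Y → Z} {x : X}
    (hg : MDifferentiableAt I' I'' g (f x)) (hf : MDifferentiableAt I I' f x) :
    tangentMapCLM I I'' (g ∘ f) x =
      (tangentMapCLM I' I'' g (f x)).comp (tangentMapCLM I I' f x) :=
  mfderiv_comp x hg hf

theorem tangentMapCLM_id (x : X) : tangentMapCLM I I (id : X → X) x = ContinuousLinearMap.id ℝ E :=
  mfderiv_id

theorem tangentMapCLM_const (y : Y) (x : X) : tangentMapCLM I I' (fun _ : X => y) x = 0 :=
  mfderiv_const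

/-- A `1`-form as a linear functional on the model space at each point. -/
noncomputable def FormField.toCLM (α : FormField I 1 X) (x : X) : E →L[ℝ] ℝ :=
  (ContinuousAlternatingMap.ofSubsingleton ℝ E ℝ (0 : Fin 1)).symm (α x)

theorem FormField.toCLM_apply (α : FormField I 1 X) (x : X) (v : E) :
    α.toCLM x v = (α x : E [⋀^Fin 1]→L[ℝ] ℝ) (fun _ => v) := rfl

theorem FormField.ext_toCLM {α β : FormField I 1 X} {x : X} (h : α.toCLM x = β.toCLM x) :
    α x = β x :=
  (ContinuousAlternatingMap.ofSubsingleton ℝ E ℝ (0 : Fin 1)).symm.injective h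

theorem FormField.toCLM_pullback (α : FormField I' 1 Y) (f : X → Y) (x : X) :
    (FormField.pullback I I' f α).toCLM x = (α.toCLM (f x)).comp (tangentMapCLM I I' f x) := rfl

theorem FormField.toCLM_differential (f : X → ℝ) (x : X) :
    (FormField.differential I f).toCLM x = tangentMapCLM I 𝓘(ℝ, ℝ) f x :=
  (ContinuousAlternatingMap.ofSubsingleton ℝ E ℝ (0 : Fin 1)).symm_apply_apply _

theorem FormField.toCLM_add (α β : FormField I 1 X) (x : X) :
    (α + β).toCLM x = α.toCLM x + β.toCLM x := rfl

variable (I) in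
/-- The pullback of a `1`-form by a map, as a linear functional on the model space. -/
noncomputable def FormField.along (α : FormField I' 1 Y) (f : X → Y) (x : X) : E →L[ℝ] ℝ :=
  (α.toCLM (f x)).comp (tangentMapCLM I I' f x)

theorem FormField.along_congr (α : FormField I' 1 Y) {f g : X → Y} {x : X} (h : f =ᶠ[𝓝 x] g) :
    α.along I f x = α.along I g x := by
  unfold FormField.along
  rw [tangentMapCLM_congr h, h.self_of_nhds]

theorem FormField.along_comp (α : FormField I'' 1 Z) {f : X → Y} {g : Y → Z} {x : X}
    (hg : MDifferentiableAt I' I'' g (f x)) (hf : MDifferentiableAt I I' f x) :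
    α.along I (g ∘ f) x = (α.along I' g (f x)).comp (tangentMapCLM I I' f x) := by
  unfold FormField.along
  rw [tangentMapCLM_comp hg hf]
  rfl

end FormCalculus

/-! ### Exterior derivative, smoothness of pullbacks and the Poincaré lemma. -/

section FormsOnBoundaryless

variable {E : Type*} [NormedAddCommGroup E] [NormedSpace ℝ E]
  {E' : Type*} [NormedAddCommGroup E'] [NormedSpace ℝ E']
  {X : Type*} [TopologicalSpace X] [ChartedSpace E X] [IsManifold 𝓘(ℝ, E) ∞ X]
  {Y : Type*} [TopologicalSpace Y] [ChartedSpace E' Y] [IsManifold 𝓘(ℝ, E') ∞ Y] {k : ℕ}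

theorem mdifferentiableAt_chartAt {x₀ x : X} (hx : x ∈ (chartAt E x₀).source) :
    MDifferentiableAt 𝓘(ℝ, E) 𝓘(ℝ, E) (chartAt E x₀) x :=
  mdifferentiableAt_atlas (I := 𝓘(ℝ, E)) (chart_mem_atlas E x₀) hx

theorem mdifferentiableAt_chartAt_symm {x₀ : X} {y : E} (hy : y ∈ (chartAt E x₀).target) :
    MDifferentiableAt 𝓘(ℝ, E) 𝓘(ℝ, E) (chartAt E x₀).symm y :=
  mdifferentiableAt_atlas_symm (I := 𝓘(ℝ, E)) (chart_mem_atlas E x₀) hy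

theorem contMDiffAt_chartAt_symm {x₀ : X} {y : E} (hy : y ∈ (chartAt E x₀).target) :
    ContMDiffAt 𝓘(ℝ, E) 𝓘(ℝ, E) ∞ (chartAt E x₀).symm y :=
  contMDiffAt_symm_of_mem_maximalAtlas (IsManifold.chart_mem_maximalAtlas x₀) hy

theorem contMDiffAt_chartAt' {x₀ : X} {x : X} (hx : x ∈ (chartAt E x₀).source) :
    ContMDiffAt 𝓘(ℝ, E) 𝓘(ℝ, E) ∞ (chartAt E x₀) x :=
  contMDiffAt_of_mem_maximalAtlas (IsManifold.chart_mem_maximalAtlas x₀) hx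

/-- A form is recovered from its expression in a chart. -/
theorem FormField.eq_pullback_inChart (α : FormField 𝓘(ℝ, E) k X) {x₀ x : X}
    (hx : x ∈ (chartAt E x₀).source) :
    α x = FormField.pullback 𝓘(ℝ, E) 𝓘(ℝ, E) (chartAt E x₀)
      (show FormField 𝓘(ℝ, E) k E from α.inChart x₀) x := by
  have h1 := (FormField.pullback_comp (I := 𝓘(ℝ, E)) (I' := 𝓘(ℝ, E)) α
    (mdifferentiableAt_chartAt_symm ((chartAt E x₀).map_source hx))
    (mdifferentiableAt_chartAt hx))
  refine Eq.trans ?_ h1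
  rw [← FormField.pullback_id α x]
  refine (FormField.pullback_congr α ?_).symm
  filter_upwards [(chartAt E x₀).open_source.mem_nhds hx] with y hy
  exact (chartAt E x₀).left_inv hy

/-- Smoothness of finite order at a point spreads to a neighbourhood, so order one is used in place
of infinite order. -/
theorem eventually_mdifferentiableAt {f : X → Y} {x : X}
    (hf : ContMDiffAt 𝓘(ℝ, E) 𝓘(ℝ, E') ∞ f x) :
    ∀ᶠ x' in 𝓝 x, MDifferentiableAt 𝓘(ℝ, E) 𝓘(ℝ, E') f x' := by
  have : IsManifold 𝓘(ℝ, E) 1 X := IsManifold.of_le (n := ∞) (by simp)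
  have : IsManifold 𝓘(ℝ, E') 1 Y := IsManifold.of_le (n := ∞) (by simp)
  have h1 : ContMDiffAt 𝓘(ℝ, E) 𝓘(ℝ, E') 1 f x := hf.of_le (by simp)
  filter_upwards [(contMDiffAt_iff_contMDiffAt_nhds (by simp)).1 h1] with x' hx'
  exact hx'.mdifferentiableAt (by simp)

/-- The expression in charts of the pullback of a form. -/
theorem FormField.inChart_pullback_eventuallyEq (α : FormField 𝓘(ℝ, E') k Y) {f : X → Y}
    {x₀ x : X} (hx : x ∈ (chartAt E x₀).source) (hf : ContMDiffAt 𝓘(ℝ, E) 𝓘(ℝ, E') ∞ f x) :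
    (FormField.pullback 𝓘(ℝ, E) 𝓘(ℝ, E') f α).inChart x₀ =ᶠ[𝓝 (chartAt E x₀ x)]
      fun y => (α.inChart (f x)
          ((chartAt E' (f x) ∘ f ∘ (chartAt E x₀).symm) y)).compContinuousLinearMap
        (fderiv ℝ (chartAt E' (f x) ∘ f ∘ (chartAt E x₀).symm) y) := by
  set φ := chartAt E x₀
  set χ := chartAt E' (f x)
  have hy0 : φ x ∈ φ.target := φ.map_source hx
  have hcont : ContinuousAt φ.symm (φ x) := φ.continuousAt_symm hy0
  have hinv : φ.symm (φ x) = x := φ.left_inv hx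
  have ev1 : ∀ᶠ y in 𝓝 (φ x), MDifferentiableAt 𝓘(ℝ, E) 𝓘(ℝ, E') f (φ.symm y) := by
    refine hcont.eventually ?_
    rw [hinv]; exact eventually_mdifferentiableAt hf
  have ev2 : ∀ᶠ y in 𝓝 (φ x), f (φ.symm y) ∈ χ.source := by
    refine hcont.eventually (p := fun z => f z ∈ χ.source) ?_
    rw [hinv]
    exact hf.continuousAt.eventually (χ.open_source.mem_nhds (mem_chart_source E' (f x)))
  filter_upwards [φ.open_target.mem_nhds hy0, ev1, ev2] with y hy h1 h2
  have hs := mdifferentiableAt_chartAt_symm (E := E) (x₀ := x₀) hy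
  have hfs : MDifferentiableAt 𝓘(ℝ, E) 𝓘(ℝ, E') (f ∘ φ.symm) y := h1.comp y hs
  have e1 := FormField.pullback_comp α h1 hs
  have e2 := FormField.pullback_congr_form (I := 𝓘(ℝ, E)) (I' := 𝓘(ℝ, E')) (f ∘ φ.symm)
    (α.eq_pullback_inChart h2)
  have e3 := FormField.pullback_comp (I := 𝓘(ℝ, E)) (f := f ∘ φ.symm) (x := y)
    (show FormField 𝓘(ℝ, E') k E' from α.inChart (f x)) (mdifferentiableAt_chartAt h2) hfs
  refine e1.symm.trans (e2.trans (e3.symm.trans ?_))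
  unfold FormField.pullback
  rw [mfderiv_eq_fderiv]
  rfl

theorem FormField.IsSmooth.contDiffAt {α : FormField 𝓘(ℝ, E') k Y} (hα : α.IsSmooth) (y : Y) :
    ContDiffAt ℝ ∞ (α.inChart y) (chartAt E' y y) :=
  (hα y).contDiffAt ((chartAt E' y).open_target.mem_nhds (mem_chart_target E' y))

theorem contDiffAt_writtenInCharts {f : X → Y}
    {x₀ x : X} (hx : x ∈ (chartAt E x₀).source) (hf : ContMDiffAt 𝓘(ℝ, E) 𝓘(ℝ, E') ∞ f x) :
    ContDiffAt ℝ ∞ (chartAt E' (f x) ∘ f ∘ (chartAt E x₀).symm) (chartAt E x₀ x) := by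
  rw [← contMDiffAt_iff_contDiffAt]
  have hinv := (chartAt E x₀).left_inv hx
  refine ContMDiffAt.comp_of_eq (contMDiffAt_chartAt' (mem_chart_source E' (f x)))
    (ContMDiffAt.comp_of_eq hf
    (contMDiffAt_chartAt_symm ((chartAt E x₀).map_source hx)) hinv) ?_
  rw [Function.comp_apply, hinv]

/-- The exterior derivative commutes with pullbacks. -/
theorem FormField.d_pullback {α : FormField 𝓘(ℝ, E') k Y} (hα : α.IsSmooth) {f : X → Y}
    {x : X} (hf : ContMDiffAt 𝓘(ℝ, E) 𝓘(ℝ, E') ∞ f x) :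
    (FormField.pullback 𝓘(ℝ, E) 𝓘(ℝ, E') f α).d x =
      FormField.pullback 𝓘(ℝ, E) 𝓘(ℝ, E') f α.d x := by
  have hx := mem_chart_source E x
  have hF := contDiffAt_writtenInCharts hx hf
  set F := chartAt E' (f x) ∘ f ∘ (chartAt E x).symm with hFdef
  have hFx : F (chartAt E x x) = chartAt E' (f x) (f x) := by
    simp [hFdef]
  have h1 := (α.inChart_pullback_eventuallyEq hx hf).extDeriv_eq
  have h2 : extDeriv (fun y => (α.inChart (f x) (F y)).compContinuousLinearMap (fderiv ℝ F y))
      (chartAt E x x) = (extDeriv (α.inChart (f x)) (F (chartAt E x x))).compContinuousLinearMap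
        (fderiv ℝ F (chartAt E x x)) :=
    extDeriv_pullback (r := ∞)
    (by rw [hFx]; exact (hα.contDiffAt (f x)).differentiableAt (by simp)) hF
    (by
      rw [minSmoothness_of_isRCLikeNormedField]
      exact WithTop.coe_le_coe.2 (le_top : (2 : ℕ∞) ≤ ⊤))
  -- The chain rule for `F ∘ chart = chart ∘ f` near `x` exchanges the chart of the source for the
  -- chart of the target.
  have h3 : (tangentMapCLM 𝓘(ℝ, E) 𝓘(ℝ, E') F (chartAt E x x)).comp
      (tangentMapCLM 𝓘(ℝ, E) 𝓘(ℝ, E) (chartAt E x) x) =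
      (tangentMapCLM 𝓘(ℝ, E') 𝓘(ℝ, E') (chartAt E' (f x)) (f x)).comp
      (tangentMapCLM 𝓘(ℝ, E) 𝓘(ℝ, E') f x) := by
    rw [← tangentMapCLM_comp (hF.differentiableAt (by simp)).mdifferentiableAt
      (mdifferentiableAt_chartAt hx),
      ← tangentMapCLM_comp (mdifferentiableAt_chartAt (mem_chart_source E' (f x)))
      (hf.mdifferentiableAt (by simp))]
    refine tangentMapCLM_congr ?_
    filter_upwards [(chartAt E x).open_source.mem_nhds hx] with z hz
    simp [hFdef, (chartAt E x).left_inv hz]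
  have h4 : tangentMapCLM 𝓘(ℝ, E) 𝓘(ℝ, E') F (chartAt E x x) = fderiv ℝ F (chartAt E x x) :=
    mfderiv_eq_fderiv
  rw [h4] at h3
  have h5 := h1.trans h2
  rw [hFx] at h5
  ext v
  have h6 := congrArg (fun η : E [⋀^Fin (k + 1)]→L[ℝ] ℝ =>
    η (fun i => tangentMapCLM 𝓘(ℝ, E) 𝓘(ℝ, E) (chartAt E x) x (v i))) h5
  refine h6.trans ?_
  change extDeriv (α.inChart (f x)) (chartAt E' (f x) (f x))
    (fun i => (((fderiv ℝ F (chartAt E x x)).comp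
      (tangentMapCLM 𝓘(ℝ, E) 𝓘(ℝ, E) (chartAt E x) x)) (v i))) = _
  rw [h3]
  rfl

/-- On a vector space the exterior derivative of a form is the usual one. -/
theorem FormField.d_eq_extDeriv (α : FormField 𝓘(ℝ, E) k E) (x : E) :
    α.d x = extDeriv (show E → E [⋀^Fin k]→L[ℝ] ℝ from α) x := by
  have h1 : α.inChart x = α := by
    funext y
    change FormField.pullback 𝓘(ℝ, E) 𝓘(ℝ, E) id α y = α y
    exact α.pullback_id y
  unfold FormField.d
  rw [h1]
  ext v
  have : ∀ w : E, (mfderiv 𝓘(ℝ, E) 𝓘(ℝ, E) (chartAt E x) x w : E) = w := by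
    intro w
    change (mfderiv 𝓘(ℝ, E) 𝓘(ℝ, E) id x w : E) = w
    rw [mfderiv_id]; rfl
  change extDeriv (show E → E [⋀^Fin k]→L[ℝ] ℝ from α) x
    (fun i => mfderiv 𝓘(ℝ, E) 𝓘(ℝ, E) (chartAt E x) x (v i)) = _
  exact congrArg _ (funext fun i => this (v i))

/-- The linear isometry between alternating `1`-forms and functionals. -/
noncomputable abbrev alternatingOneLIE (E : Type*) [NormedAddCommGroup E] [NormedSpace ℝ E] :
    (E →L[ℝ] ℝ) ≃ₗᵢ[ℝ] E [⋀^Fin 1]→L[ℝ] ℝ :=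
  ContinuousAlternatingMap.ofSubsingletonLIE (0 : Fin 1)

/-- In degree one, alternating forms are functionals and pullback becomes composition of continuous
linear maps, which depends smoothly on both factors. -/
theorem contDiffAt_pullback_one {η : E' → E' [⋀^Fin 1]→L[ℝ] ℝ} {F : E → E'} {y : E}
    (hη : ContDiffAt ℝ ∞ η (F y)) (hF : ContDiffAt ℝ ∞ F y) :
    ContDiffAt ℝ ∞ (fun y => (η (F y)).compContinuousLinearMap (fderiv ℝ F y)) y := by
  have h1 : ContDiffAt ℝ ∞
      (fun y => ((alternatingOneLIE E').symm (η (F y))).comp (fderiv ℝ F y)) y :=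
    ContDiffAt.clm_comp
      ((alternatingOneLIE E').symm.contDiff.contDiffAt.comp y (hη.comp y hF))
      (hF.fderiv_right (by simp))
  refine ((alternatingOneLIE E).contDiff.contDiffAt.comp y h1).congr_of_eventuallyEq
    (Eventually.of_forall fun y => ?_)
  ext v
  exact congrArg (η (F y)) (funext fun i => by fin_cases i; rfl)

theorem FormField.contDiffAt_inChart_pullback {α : FormField 𝓘(ℝ, E') 1 Y} (hα : α.IsSmooth)
    {f : X → Y} {x₀ x : X} (hx : x ∈ (chartAt E x₀).source)
    (hf : ContMDiffAt 𝓘(ℝ, E) 𝓘(ℝ, E') ∞ f x) :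
    ContDiffAt ℝ ∞ ((FormField.pullback 𝓘(ℝ, E) 𝓘(ℝ, E') f α).inChart x₀) (chartAt E x₀ x) := by
  refine ContDiffAt.congr_of_eventuallyEq ?_ (α.inChart_pullback_eventuallyEq hx hf)
  refine contDiffAt_pullback_one ?_ (contDiffAt_writtenInCharts hx hf)
  have : (chartAt E' (f x) ∘ f ∘ (chartAt E x₀).symm) (chartAt E x₀ x) =
      chartAt E' (f x) (f x) := by
    simp [(chartAt E x₀).left_inv hx]
  rw [this]
  exact hα.contDiffAt (f x)

theorem FormField.IsSmooth.pullback {α : FormField 𝓘(ℝ, E') 1 Y} (hα : α.IsSmooth) {f : X → Y}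
    (hf : ContMDiff 𝓘(ℝ, E) 𝓘(ℝ, E') ∞ f) :
    (FormField.pullback 𝓘(ℝ, E) 𝓘(ℝ, E') f α).IsSmooth := by
  intro x₀ y hy
  have := FormField.contDiffAt_inChart_pullback hα ((chartAt E x₀).map_target hy) (hf _)
  rw [(chartAt E x₀).right_inv hy] at this
  exact this.contDiffWithinAt

/-- The Poincaré lemma for smooth `1`-forms. -/
theorem exists_primitive_of_extDeriv_eq_zero {β : E → E [⋀^Fin 1]→L[ℝ] ℝ} {y₀ : E}
    (hβ : ∀ᶠ y in 𝓝 y₀, ContDiffAt ℝ ∞ β y) (hd : ∀ᶠ y in 𝓝 y₀, extDeriv β y = 0) :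
    ∃ (V : Set E) (z : E → ℝ), IsOpen V ∧ y₀ ∈ V ∧ ContDiffOn ℝ ∞ z V ∧
      ∀ y ∈ V, ∀ v : E, fderiv ℝ z y v = β y (fun _ => v) := by
  obtain ⟨r, hr, hball⟩ := Metric.eventually_nhds_iff_ball.1 (hβ.and hd)
  let b : E → E →L[ℝ] ℝ := fun y => (alternatingOneLIE E).symm (β y)
  have hbs : ∀ y ∈ Metric.ball y₀ r, ContDiffAt ℝ ∞ b y := fun y hy =>
    (alternatingOneLIE E).symm.contDiff.contDiffAt.comp y (hball y hy).1
  -- The exterior derivative evaluated on `v, w` is the antisymmetric part of the derivative of `b`;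
  -- its vanishing is the symmetry that yields a primitive on a convex set.
  have hsymm : ∀ a ∈ Metric.ball y₀ r, ∀ v w, fderiv ℝ b a v w = fderiv ℝ b a w v := by
    intro a ha v w
    have hdβ : DifferentiableAt ℝ β a := (hball a ha).1.differentiableAt (by simp)
    have hdb : DifferentiableAt ℝ b a := (hbs a ha).differentiableAt (by simp)
    have h0 := congrArg (fun η : E [⋀^Fin 2]→L[ℝ] ℝ => η ![v, w]) (hball a ha).2
    have h1 := extDeriv_apply hdβ ![v, w]
    rw [Fin.sum_univ_two] at h1
    have h2 : ∀ u u' : E, fderiv ℝ (fun y => b y u) a u' = fderiv ℝ b a u' u := by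
      intro u u'
      rw [fderiv_clm_apply hdb (differentiableAt_const u)]
      simp
    have e0 : (fun y => β y (Fin.removeNth 0 ![v, w])) = fun y => b y w := by
      funext y
      change _ = β y (fun _ => w)
      congr 1
      funext i; fin_cases i; rfl
    have e1 : (fun y => β y (Fin.removeNth 1 ![v, w])) = fun y => b y v := by
      funext y
      change _ = β y (fun _ => v)
      congr 1
      funext i; fin_cases i; rfl
    have h3 : fderiv ℝ b a v w - fderiv ℝ b a w v = 0 := by
      rw [← h2, ← h2, ← e0, ← e1]
      have h4 := h1.symm.trans h0
      simp only [Fin.val_zero, pow_zero, one_smul, Fin.val_one, pow_one, neg_smul] at h4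
      rw [sub_eq_add_neg]
      exact h4
    linarith
  obtain ⟨z, hz⟩ := (convex_ball y₀ r).exists_forall_hasFDerivAt_of_fderiv_symmetric
    Metric.isOpen_ball (fun a ha => ((hbs a ha).differentiableAt (by simp)).differentiableWithinAt)
    hsymm
  refine ⟨Metric.ball y₀ r, z, Metric.isOpen_ball, Metric.mem_ball_self hr, ?_, ?_⟩
  · rw [contDiffOn_infty_iff_fderiv_of_isOpen Metric.isOpen_ball]
    refine ⟨fun a ha => (hz a ha).differentiableAt.differentiableWithinAt, ?_⟩
    intro a ha
    refine ContDiffWithinAt.congr (hbs a ha).contDiffWithinAt (fun y hy => (hz y hy).fderiv)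
      (hz a ha).fderiv
  · intro y hy v
    rw [(hz y hy).fderiv]
    rfl

end FormsOnBoundaryless

/-! ### Linear algebra of the contact condition. -/

section ContactAlgebra

variable {E : Type*} [NormedAddCommGroup E] [NormedSpace ℝ E]

/-- The product `θ(v₀) ∏ dθ(v₂ᵢ₊₁, v₂ᵢ₊₂)` whose antisymmetrization is the wedge product. -/
noncomputable def contactProduct (n : ℕ) (a : E [⋀^Fin 1]→L[ℝ] ℝ) (b : E [⋀^Fin 2]→L[ℝ] ℝ)
    (v : Fin (2 * n + 1) → E) : ℝ :=
  a ![v ⟨0, by omega⟩] *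
    ∏ i : Fin n, b ![v ⟨2 * i + 1, by omega⟩, v ⟨2 * i + 2, by omega⟩]

theorem exists_linear_left (b : E [⋀^Fin 2]→L[ℝ] ℝ) (w : E) :
    ∃ ℓ : E →ₗ[ℝ] ℝ, ∀ x, b ![x, w] = ℓ x :=
  ⟨b.toMultilinearMap.toLinearMap ![0, w] 0, fun x => by
    change _ = b (Function.update ![0, w] 0 x)
    congr 1
    funext i; fin_cases i <;> simp⟩

theorem exists_linear_right (b : E [⋀^Fin 2]→L[ℝ] ℝ) (w : E) :
    ∃ ℓ : E →ₗ[ℝ] ℝ, ∀ x, b ![w, x] = ℓ x :=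
  ⟨b.toMultilinearMap.toLinearMap ![w, 0] 1, fun x => by
    change _ = b (Function.update ![w, 0] 1 x)
    congr 1
    funext i; fin_cases i <;> simp⟩

theorem fin_two_mul_add_one_cases {n : ℕ} (i : Fin (2 * n + 1)) :
    i = ⟨0, by omega⟩ ∨ (∃ j : Fin n, i = ⟨2 * j + 1, by omega⟩) ∨
      ∃ j : Fin n, i = ⟨2 * j + 2, by omega⟩ := by
  obtain ⟨i, hi⟩ := i
  rcases Nat.eq_zero_or_pos i with h | h
  · exact Or.inl (by simp [h])
  · rcases Nat.even_or_odd' (i - 1) with ⟨j, hj | hj⟩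
    · exact Or.inr (Or.inl ⟨⟨j, by omega⟩, Fin.ext (by simp; omega)⟩)
    · exact Or.inr (Or.inr ⟨⟨j, by omega⟩, Fin.ext (by simp; omega)⟩)

/-- Each slot occurs in exactly one factor of the product, which is linear in it, while the
remaining factors are a constant. This is what multilinearity of the product needs. -/
theorem contactProduct_update (n : ℕ) (a : E [⋀^Fin 1]→L[ℝ] ℝ) (b : E [⋀^Fin 2]→L[ℝ] ℝ)
    [DecidableEq (Fin (2 * n + 1))] (v : Fin (2 * n + 1) → E) (i : Fin (2 * n + 1)) :
    ∃ ℓ : E →ₗ[ℝ] ℝ, ∀ x, contactProduct n a b (Function.update v i x) = ℓ x := by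
  rcases fin_two_mul_add_one_cases i with rfl | ⟨j, rfl⟩ | ⟨j, rfl⟩
  · obtain ⟨ℓ, hℓ⟩ : ∃ ℓ : E →ₗ[ℝ] ℝ, ∀ x, a ![x] = ℓ x :=
      ⟨a.toMultilinearMap.toLinearMap ![0] 0, fun x => by
        change _ = a (Function.update ![0] 0 x)
        congr 1
        funext i; fin_cases i; simp⟩
    refine ⟨(∏ i : Fin n, b ![v ⟨2 * i + 1, by omega⟩, v ⟨2 * i + 2, by omega⟩]) • ℓ, fun x => ?_⟩
    simp [contactProduct, hℓ, mul_comm]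
  · obtain ⟨ℓ, hℓ⟩ := exists_linear_left b (v ⟨2 * j + 2, by omega⟩)
    refine ⟨(a ![v ⟨0, by omega⟩] * ∏ i ∈ Finset.univ.erase j,
      b ![v ⟨2 * i + 1, by omega⟩, v ⟨2 * i + 2, by omega⟩]) • ℓ, fun x => ?_⟩
    rw [contactProduct, ← Finset.mul_prod_erase _ _ (Finset.mem_univ j),
      Finset.prod_congr rfl (g := fun i : Fin n =>
        b ![v ⟨2 * i + 1, by omega⟩, v ⟨2 * i + 2, by omega⟩])]
    · simp only [Function.update_apply, Fin.mk.injEq, LinearMap.smul_apply, smul_eq_mul, ← hℓ]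
      rw [if_neg (by omega), if_pos trivial, if_neg (by omega)]
      ring
    · intro k hk
      have : k.1 ≠ j.1 := fun h => (Finset.mem_erase.1 hk).1 (Fin.ext h)
      simp only [Function.update_apply, Fin.mk.injEq]
      rw [if_neg (by omega), if_neg (by omega)]
  · obtain ⟨ℓ, hℓ⟩ := exists_linear_right b (v ⟨2 * j + 1, by omega⟩)
    refine ⟨(a ![v ⟨0, by omega⟩] * ∏ i ∈ Finset.univ.erase j,
      b ![v ⟨2 * i + 1, by omega⟩, v ⟨2 * i + 2, by omega⟩]) • ℓ, fun x => ?_⟩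
    rw [contactProduct, ← Finset.mul_prod_erase _ _ (Finset.mem_univ j),
      Finset.prod_congr rfl (g := fun i : Fin n =>
        b ![v ⟨2 * i + 1, by omega⟩, v ⟨2 * i + 2, by omega⟩])]
    · simp only [Function.update_apply, Fin.mk.injEq, LinearMap.smul_apply, smul_eq_mul, ← hℓ]
      rw [if_neg (by omega), if_neg (by omega), if_pos trivial]
      ring
    · intro k hk
      have : k.1 ≠ j.1 := fun h => (Finset.mem_erase.1 hk).1 (Fin.ext h)
      simp only [Function.update_apply, Fin.mk.injEq]
      rw [if_neg (by omega), if_neg (by omega)]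

/-- Whichever slot `u` occupies, the factor containing that slot vanishes. -/
theorem contactProduct_eq_zero {n : ℕ} {a : E [⋀^Fin 1]→L[ℝ] ℝ} {b : E [⋀^Fin 2]→L[ℝ] ℝ} {u : E}
    (ha : a ![u] = 0) (hb : ∀ w, b ![u, w] = 0) (hb' : ∀ w, b ![w, u] = 0)
    {v : Fin (2 * n + 1) → E} {i : Fin (2 * n + 1)} (hi : v i = u) :
    contactProduct n a b v = 0 := by
  rcases fin_two_mul_add_one_cases i with rfl | ⟨j, rfl⟩ | ⟨j, rfl⟩
  · rw [contactProduct, hi, ha, zero_mul]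
  · rw [contactProduct, Finset.prod_eq_zero (Finset.mem_univ j), mul_zero]
    rw [hi, hb]
  · rw [contactProduct, Finset.prod_eq_zero (Finset.mem_univ j), mul_zero]
    rw [hi, hb']

/-- The product as a multilinear map. -/
noncomputable def contactMultilinear (n : ℕ) (a : E [⋀^Fin 1]→L[ℝ] ℝ) (b : E [⋀^Fin 2]→L[ℝ] ℝ) :
    MultilinearMap ℝ (fun _ : Fin (2 * n + 1) => E) ℝ where
  toFun := contactProduct n a b
  map_update_add' v i x y := by
    obtain ⟨ℓ, hℓ⟩ := contactProduct_update n a b v i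
    simp only [hℓ, map_add]
  map_update_smul' v i c x := by
    obtain ⟨ℓ, hℓ⟩ := contactProduct_update n a b v i
    simp only [hℓ, map_smul]

/-- If the contact condition holds, no nonzero vector is annihilated by both forms. -/
theorem eq_zero_of_contactProduct [FiniteDimensional ℝ E] {n : ℕ}
    (hE : Module.finrank ℝ E = 2 * n + 1)
    {a : E [⋀^Fin 1]→L[ℝ] ℝ} {b : E [⋀^Fin 2]→L[ℝ] ℝ}
    (hab : ∃ v, (MultilinearMap.alternatization (contactMultilinear n a b)) v ≠ 0) {u : E}
    (ha : a ![u] = 0) (hb : ∀ w, b ![u, w] = 0) : u = 0 := by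
  obtain ⟨v, hv⟩ := hab
  set A := MultilinearMap.alternatization (contactMultilinear n a b)
  have hb' : ∀ w, b ![w, u] = 0 := by
    intro w
    have := b.map_swap ![w, u] (i := 0) (j := 1) (by decide)
    have e : (![w, u] : Fin 2 → E) ∘ (Equiv.swap 0 1) = ![u, w] := by
      funext i; fin_cases i <;> simp
    rw [e] at this
    have h3 : b ![u, w] = - b ![w, u] := this
    rw [hb] at h3
    linarith
  have hli : LinearIndependent ℝ v := by
    by_contra h
    exact hv (A.map_linearDependent v h)
  -- An alternating form that is nonzero on `v` forces independence, and the dimension count makes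
  -- `v` a basis.
  let e := basisOfLinearIndependentOfCardEqFinrank hli (by rw [hE, Fintype.card_fin])
  have he : ∀ i, e i = v i := fun i => by simp [e]
  have hA : ∀ i, A (Function.update v i u) = 0 := by
    intro i
    rw [MultilinearMap.alternatization_apply]
    refine Finset.sum_eq_zero fun σ _ => ?_
    have : (MultilinearMap.domDomCongr σ (contactMultilinear n a b))
        (Function.update v i u) = 0 := by
      rw [MultilinearMap.domDomCongr_apply]
      change contactProduct n a b (fun k => Function.update v i u (σ k)) = 0
      refine contactProduct_eq_zero (i := σ.symm i) ha hb hb' ?_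
      simp
    rw [this, smul_zero]
  have hcoord : ∀ i, e.coord i u = 0 := by
    intro i
    -- Replacing the `i`-th basis vector by `u` multiplies `A v` by the `i`-th coordinate of `u`; by
    -- `hA` the result is zero, so every coordinate of `u` vanishes.
    have h1 : A.toMultilinearMap.toLinearMap v i = A v • e.coord i := by
      refine e.ext fun j => ?_
      rw [LinearMap.smul_apply, e.coord_apply, e.repr_self, he]
      change A (Function.update v i (v j)) = _
      by_cases hij : j = i
      · subst hij; simp
      · rw [A.map_update_self v (Ne.symm hij)]
        simp [hij]
    have h2 := congrArg (fun ℓ : E →ₗ[ℝ] ℝ => ℓ u) h1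
    have h3 : A v * e.coord i u = 0 := h2.symm.trans (hA i)
    exact (mul_eq_zero.1 h3).resolve_left hv
  refine e.ext_elem fun i => ?_
  rw [map_zero]
  exact hcoord i

end ContactAlgebra

/-- Up to the factor `1 / 2 ^ n`, the value of `θ ∧ (dθ)ⁿ` is the antisymmetrization of the contact
product, so the linear statement applies in each tangent space. -/
theorem IsContactForm.eq_zero_of_annihilated {n : ℕ} {X : Type*} [TopologicalSpace X]
    [ChartedSpace (EuclideanSpace ℝ (Fin (2 * n + 1))) X] {θ : FormField (𝓡 (2 * n + 1)) 1 X}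
    (hθ : IsContactForm n θ) {x : X} {u : EuclideanSpace ℝ (Fin (2 * n + 1))}
    (h1 : θ.toCLM x u = 0)
    (h2 : ∀ w : EuclideanSpace ℝ (Fin (2 * n + 1)),
      (show EuclideanSpace ℝ (Fin (2 * n + 1)) [⋀^Fin 2]→L[ℝ] ℝ from θ.d x) ![u, w] = 0) :
    u = 0 := by
  obtain ⟨v, hv⟩ := hθ.wedge_ne_zero x
  let a : EuclideanSpace ℝ (Fin (2 * n + 1)) [⋀^Fin 1]→L[ℝ] ℝ := θ x
  let b : EuclideanSpace ℝ (Fin (2 * n + 1)) [⋀^Fin 2]→L[ℝ] ℝ := θ.d x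
  let v' : Fin (2 * n + 1) → EuclideanSpace ℝ (Fin (2 * n + 1)) := v
  refine eq_zero_of_contactProduct (a := a) (b := b) (n := n) (by simp) ⟨v', fun h => hv ?_⟩ ?_ h2
  · rw [MultilinearMap.alternatization_apply] at h
    unfold wedgeContact
    refine mul_eq_zero_of_right _ (Eq.trans ?_ h)
    refine Finset.sum_congr rfl fun σ _ => ?_
    rw [mul_assoc, MultilinearMap.domDomCongr_apply, Units.smul_def, zsmul_eq_mul]
    rfl
  · rw [FormField.toCLM_apply] at h1
    rw [← h1]
    congr 1
    funext i; fin_cases i; rfl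

/-! ### One-parameter subgroups from local homomorphisms. -/

section LocalHom

/-- A local homomorphism from the real line to a group extends to a homomorphism. -/
theorem exists_hom_of_local_hom {K : Type*} [Group K] {γ : ℝ → K} {ε : ℝ} (hε : 0 < ε)
    (h : ∀ a b, |a| < ε → |b| < ε → |a + b| < ε → γ (a + b) = γ a * γ b) :
    ∃ κ : ℝ → K, (∀ a b, κ (a + b) = κ a * κ b) ∧ ∀ a, |a| < ε → κ a = γ a := by
  have h0 : γ 0 = 1 := by
    have := h 0 0 (by simpa) (by simpa) (by simpa)
    rw [add_zero] at this
    exact mul_eq_left.1 this.symm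
  have hnat : ∀ (N : ℕ) (a : ℝ), N * |a| < ε → γ (N * a) = γ a ^ N := by
    intro N
    induction N with
    | zero => intro a _; simp [h0]
    | succ N ih =>
      intro a ha
      push_cast at ha ⊢
      have hNa : (N : ℝ) * |a| < ε := by nlinarith [abs_nonneg a]
      have h1 : |a| < ε := by
        nlinarith [abs_nonneg a, mul_nonneg (Nat.cast_nonneg (α := ℝ) N) (abs_nonneg a)]
      have h2 : |(N : ℝ) * a| < ε := by rwa [abs_mul, Nat.abs_cast]
      have h3 : |(N : ℝ) * a + a| < ε := by
        calc |(N : ℝ) * a + a| ≤ |(N : ℝ) * a| + |a| := abs_add_le _ _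
          _ = (N + 1) * |a| := by rw [abs_mul, Nat.abs_cast]; ring
          _ < ε := ha
      rw [add_mul, one_mul, h _ _ h2 h1 h3, ih a hNa, pow_succ]
  -- Both orders of the product equal `γ (a + b)`. Commutation is needed to split the power of a
  -- product when the extension is shown to be additive.
  have hcomm : ∀ a b, |a| + |b| < ε → Commute (γ a) (γ b) := by
    intro a b hab
    have ha : |a| < ε := by linarith [abs_nonneg b]
    have hb : |b| < ε := by linarith [abs_nonneg a]
    have hs : |a + b| < ε := (abs_add_le a b).trans_lt hab
    have hs' : |b + a| < ε := by rwa [add_comm]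
    change γ a * γ b = γ b * γ a
    rw [← h a b ha hb hs, ← h b a hb ha hs', add_comm]
  -- The extension is `γ (a / N) ^ N` for any `N` that brings `a / N` into the interval. Two choices
  -- `N` and `P` both agree with the choice `N * P`.
  have key : ∀ (N P : ℕ) (a : ℝ), 0 < N → 0 < P → |a| < N * ε → |a| < P * ε →
      γ (a / N) ^ N = γ (a / P) ^ P := by
    have half : ∀ (N P : ℕ) (a : ℝ), 0 < N → 0 < P → |a| < N * ε →
        γ (a / N) ^ N = γ (a / (N * P)) ^ (N * P) := by
      intro N P a hN hP ha
      have hN' : (0 : ℝ) < N := Nat.cast_pos.2 hN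
      have hP' : (0 : ℝ) < P := Nat.cast_pos.2 hP
      have h1 := hnat P (a / (N * P)) (by
        rw [abs_div, abs_of_pos (mul_pos hN' hP')]
        have : (P : ℝ) * (|a| / (N * P)) = |a| / N := by field_simp
        rw [this, div_lt_iff₀ hN', mul_comm]; exact ha)
      have h2 : (P : ℝ) * (a / (N * P)) = a / N := by field_simp
      rw [h2] at h1
      rw [h1, ← pow_mul, mul_comm P N]
    intro N P a hN hP ha ha'
    rw [half N P a hN hP ha, half P N a hP hN ha', mul_comm (P : ℝ) N, mul_comm P N]
  choose N hN using fun a : ℝ => exists_nat_gt (|a| / ε)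
  have hNpos : ∀ a, 0 < N a := fun a => by
    have : (0 : ℝ) < N a := lt_of_le_of_lt (by positivity) (hN a)
    exact_mod_cast this
  have hN' : ∀ a, |a| < N a * ε := fun a => (div_lt_iff₀ hε).1 (hN a)
  refine ⟨fun a => γ (a / N a) ^ N a, fun a b => ?_, fun a ha => ?_⟩
  · obtain ⟨P, hP⟩ := exists_nat_gt ((|a| + |b|) / ε)
    have hP' : |a| + |b| < P * ε := (div_lt_iff₀ hε).1 hP
    have hPpos' : (0 : ℝ) < P := lt_of_le_of_lt (by positivity) hP
    have hPpos : 0 < P := by exact_mod_cast hPpos'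
    have ha : |a| < P * ε := by linarith [abs_nonneg b]
    have hb : |b| < P * ε := by linarith [abs_nonneg a]
    have hab : |a + b| < P * ε := (abs_add_le a b).trans_lt hP'
    dsimp only
    rw [key _ P a (hNpos a) hPpos (hN' a) ha, key _ P b (hNpos b) hPpos (hN' b) hb,
      key _ P _ (hNpos _) hPpos (hN' _) hab]
    have hd : ∀ c : ℝ, |c / P| = |c| / P := fun c => by rw [abs_div, Nat.abs_cast]
    have h1 : ∀ c : ℝ, |c| < P * ε → |c / P| < ε := fun c hc => by
      rw [hd, div_lt_iff₀ hPpos', mul_comm]; exact hc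
    have h2 : Commute (γ (a / P)) (γ (b / P)) := hcomm _ _ (by
      rw [hd, hd, ← add_div, div_lt_iff₀ hPpos', mul_comm]; exact hP')
    rw [add_div, h _ _ (h1 a ha) (h1 b hb) (by rw [← add_div]; exact h1 _ hab), h2.mul_pow]
  · have := key (N a) 1 a (hNpos a) one_pos (hN' a) (by simpa using ha)
    simpa using this

/-- A one-parameter subgroup which is open and continuous at the identity is a bijection onto a
connected noncompact group. -/
theorem bijective_of_hom {K : Type*} [Group K] [TopologicalSpace K] [ContinuousMul K]
    [ConnectedSpace K] [NoncompactSpace K] {κ : ℝ → K} (hκ : ∀ a b, κ (a + b) = κ a * κ b)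
    (hc : ContinuousAt κ 0) (hr : range κ ∈ 𝓝 (1 : K)) : Function.Bijective κ := by
  have h0 : κ 0 = 1 := by
    have := hκ 0 0
    rw [add_zero] at this
    exact mul_eq_left.1 this.symm
  let f : Multiplicative ℝ →* K :=
    { toFun := fun a => κ a.toAdd
      map_one' := h0
      map_mul' := fun a b => hκ a.toAdd b.toAdd }
  have hcont : Continuous κ := by
    rw [continuous_iff_continuousAt]
    intro a
    have h1 : κ = fun t => κ a * κ (t - a) := by
      funext t
      rw [← hκ]; congr 1; ring
    rw [h1]
    have h2 : ContinuousAt (fun t => κ (t - a)) a :=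
      ContinuousAt.comp_of_eq hc (by fun_prop) (sub_self a)
    exact continuousAt_const.mul h2
  have hrange : (f.range : Set K) = range κ := by
    ext y
    simp only [MonoidHom.coe_range, mem_range]
    exact ⟨fun ⟨a, ha⟩ => ⟨a.toAdd, ha⟩, fun ⟨a, ha⟩ => ⟨Multiplicative.ofAdd a, ha⟩⟩
  -- A subgroup that is a neighbourhood of the identity is open, hence closed, hence everything
  -- because the group is connected.
  have hopen : IsOpen (f.range : Set K) := f.range.isOpen_of_mem_nhds (g := 1) (by rwa [hrange])
  have hclosed : IsClosed (f.range : Set K) := f.range.isClosed_of_isOpen hopen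
  have huniv : range κ = univ := by
    rw [← hrange]
    exact IsClopen.eq_univ ⟨hclosed, hopen⟩ ⟨1, f.range.one_mem⟩
  have hsurj : Function.Surjective κ := range_eq_univ.1 huniv
  refine ⟨fun a b hab => ?_, hsurj⟩
  by_contra hne
  have hT : κ (a - b) = 1 := by
    have := hκ (a - b) b
    rw [sub_add_cancel, hab] at this
    exact mul_eq_right.1 this.symm
  obtain ⟨T, hTpos, hT1⟩ : ∃ T : ℝ, 0 < T ∧ κ T = 1 := by
    rcases lt_or_gt_of_ne (sub_ne_zero.2 hne) with h | h
    · refine ⟨-(a - b), by linarith, ?_⟩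
      have := hκ (a - b) (-(a - b))
      rw [add_neg_cancel, h0, hT, one_mul] at this
      exact this.symm
    · exact ⟨a - b, h, hT⟩
  -- A nontrivial kernel makes `κ` periodic, and then the group is the image of a compact interval,
  -- against noncompactness.
  have hper : Function.Periodic κ T := fun x => by rw [hκ, hT1, mul_one]
  have himg : κ '' Icc 0 (0 + T) = univ := by
    rw [hper.image_Icc hTpos, huniv]
  exact noncompact_univ K (himg ▸ isCompact_Icc.image hcont)

end LocalHom

/-! ### Groupoid algebra and smooth products. -/

namespace ArrowGroupoid

section Algebra

variable {G G' M : Type*} (𝒢 : ArrowGroupoid G M)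

open Classical in
/-- The multiplication extended by a junk value to all pairs of arrows. -/
noncomputable def tmul (g h : G) : G :=
  if e : 𝒢.src g = 𝒢.tgt h then 𝒢.mul ⟨(g, h), e⟩ else g

variable {𝒢}

/-- With a total product, composability is a side condition of each rule and not part of the
argument, so factors can be rewritten and families of products differentiated. -/
theorem tmul_eq {g h : G} (e : 𝒢.src g = 𝒢.tgt h) : 𝒢.tmul g h = 𝒢.mul ⟨(g, h), e⟩ :=
  dif_pos e

theorem src_tmul {g h : G} (e : 𝒢.src g = 𝒢.tgt h) : 𝒢.src (𝒢.tmul g h) = 𝒢.src h := by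
  rw [tmul_eq e, 𝒢.src_mul]

theorem tgt_tmul {g h : G} (e : 𝒢.src g = 𝒢.tgt h) : 𝒢.tgt (𝒢.tmul g h) = 𝒢.tgt g := by
  rw [tmul_eq e, 𝒢.tgt_mul]

theorem tmul_assoc {g h k : G} (e : 𝒢.src g = 𝒢.tgt h) (e' : 𝒢.src h = 𝒢.tgt k) :
    𝒢.tmul (𝒢.tmul g h) k = 𝒢.tmul g (𝒢.tmul h k) := by
  rw [tmul_eq e, tmul_eq e', tmul_eq ((𝒢.src_mul _).trans e'),
    tmul_eq (e.trans (𝒢.tgt_mul ⟨(h, k), e'⟩).symm)]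
  exact 𝒢.mul_assoc g h k e e'

theorem unit_tmul {g : G} {x : M} (h : 𝒢.tgt g = x) : 𝒢.tmul (𝒢.unit x) g = g := by
  subst h
  rw [tmul_eq (𝒢.src_unit _), 𝒢.unit_mul]

theorem tmul_unit {g : G} {x : M} (h : 𝒢.src g = x) : 𝒢.tmul g (𝒢.unit x) = g := by
  subst h
  rw [tmul_eq (𝒢.tgt_unit _).symm, 𝒢.mul_unit]

theorem inv_tmul (g : G) : 𝒢.tmul (𝒢.inv g) g = 𝒢.unit (𝒢.src g) := by
  rw [tmul_eq (𝒢.src_inv _), 𝒢.inv_mul]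

theorem tmul_inv (g : G) : 𝒢.tmul g (𝒢.inv g) = 𝒢.unit (𝒢.tgt g) := by
  rw [tmul_eq (𝒢.tgt_inv _).symm, 𝒢.mul_inv]

theorem tmul_right_cancel {g g' h : G} (e : 𝒢.src g = 𝒢.tgt h) (e' : 𝒢.src g' = 𝒢.tgt h)
    (H : 𝒢.tmul g h = 𝒢.tmul g' h) : g = g' := by
  have h1 := congrArg (fun k => 𝒢.tmul k (𝒢.inv h)) H
  rwa [tmul_assoc e (𝒢.tgt_inv _).symm, tmul_assoc e' (𝒢.tgt_inv _).symm, tmul_inv,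
    tmul_unit e, tmul_unit e'] at h1

theorem tmul_left_cancel {g h h' : G} (e : 𝒢.src g = 𝒢.tgt h) (e' : 𝒢.src g = 𝒢.tgt h')
    (H : 𝒢.tmul g h = 𝒢.tmul g h') : h = h' := by
  have h1 := congrArg (fun k => 𝒢.tmul (𝒢.inv g) k) H
  rwa [← tmul_assoc (𝒢.src_inv _) e, ← tmul_assoc (𝒢.src_inv _) e', inv_tmul,
    unit_tmul e.symm, unit_tmul e'.symm] at h1

/-- A groupoid element which is idempotent is a unit. -/
theorem eq_unit_of_tmul_self {g : G} {x : M} (hs : 𝒢.src g = x) (ht : 𝒢.tgt g = x)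
    (h : 𝒢.tmul g g = g) : g = 𝒢.unit x := by
  refine tmul_left_cancel (𝒢 := 𝒢) (g := g) (hs.trans ht.symm) ?_ ?_
  · rw [hs, 𝒢.tgt_unit]
  · rw [h, tmul_unit hs]

variable {𝒢' : ArrowGroupoid G' M} {f : G → G'}

theorem IsHom.map_tmul (hf : 𝒢.IsHom 𝒢' f) {g h : G} (e : 𝒢.src g = 𝒢.tgt h) :
    f (𝒢.tmul g h) = 𝒢'.tmul (f g) (f h) := by
  rw [tmul_eq e, hf.map_mul, tmul_eq ((hf.map_src _).trans (e.trans (hf.map_tgt _).symm))]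
  rfl

theorem IsHom.map_unit (hf : 𝒢.IsHom 𝒢' f) (x : M) : f (𝒢.unit x) = 𝒢'.unit x := by
  refine eq_unit_of_tmul_self ?_ ?_ ?_
  · rw [hf.map_src, 𝒢.src_unit]
  · rw [hf.map_tgt, 𝒢.tgt_unit]
  · rw [← hf.map_tmul (by rw [𝒢.src_unit, 𝒢.tgt_unit]), tmul_unit (𝒢.src_unit x)]

theorem IsHom.tmul_map_inv (hf : 𝒢.IsHom 𝒢' f) (g : G) :
    𝒢'.tmul (f g) (f (𝒢.inv g)) = 𝒢'.unit (𝒢.tgt g) := by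
  rw [← hf.map_tmul (𝒢.tgt_inv _).symm, tmul_inv, hf.map_unit]

end Algebra

section Smooth

theorem toCLM_coboundary {G M : Type*} {a e : ℕ} [TopologicalSpace G]
    [ChartedSpace (EuclideanSpace ℝ (Fin a)) G] {𝒢 : ArrowGroupoid G M}
    [ChartedSpace (EuclideanSpace ℝ (Fin e)) 𝒢.Pairs] (α : FormField (𝓡 a) 1 G) (p : 𝒢.Pairs) :
    (𝒢.coboundary e α).toCLM p =
      α.along (𝓡 e) 𝒢.pr₁ p - α.along (𝓡 e) 𝒢.mul p + α.along (𝓡 e) 𝒢.pr₂ p := rfl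

variable {G M : Type*} {a b e : ℕ} [TopologicalSpace G] [ChartedSpace (EuclideanSpace ℝ (Fin a)) G]
    [TopologicalSpace M] [ChartedSpace (EuclideanSpace ℝ (Fin b)) M] {𝒢 : ArrowGroupoid G M}
    [ChartedSpace (EuclideanSpace ℝ (Fin e)) 𝒢.Pairs]
    {E : Type*} [NormedAddCommGroup E] [NormedSpace ℝ E] {H : Type*} [TopologicalSpace H]
    {I : ModelWithCorners ℝ E H} {X : Type*} [TopologicalSpace X] [ChartedSpace H X]

/-- A pair of smooth maps into the arrows, composable near a point, is smooth as a map into the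
composable pairs. -/
theorem IsLie.exists_lift (h𝒢 : 𝒢.IsLie a b e) {f g : X → G} {x : X}
    (hf : ContMDiffAt I (𝓡 a) ∞ f x) (hg : ContMDiffAt I (𝓡 a) ∞ g x)
    (hfg : ∀ᶠ y in 𝓝 x, 𝒢.src (f y) = 𝒢.tgt (g y)) :
    ∃ p : X → 𝒢.Pairs, ContMDiffAt I (𝓡 e) ∞ p x ∧
      ∀ᶠ y in 𝓝 x, (p y).1 = (f y, g y) ∧ 𝒢.mul (p y) = 𝒢.tmul (f y) (g y) := by
  have := h𝒢.pairs_manifold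
  have := h𝒢.arrows_manifold
  classical
  -- The pair of units is a default value for arrows that do not compose; near `x` it is never
  -- taken.
  let p : X → 𝒢.Pairs := fun y =>
    if h : 𝒢.src (f y) = 𝒢.tgt (g y) then ⟨(f y, g y), h⟩ else 𝒢.unitPair (𝒢.tgt (g y))
  have hp : ∀ y, 𝒢.src (f y) = 𝒢.tgt (g y) →
      (p y).1 = (f y, g y) ∧ 𝒢.mul (p y) = 𝒢.tmul (f y) (g y) := by
    intro y hy
    have : p y = ⟨(f y, g y), hy⟩ := dif_pos hy
    rw [this, tmul_eq hy]
    exact ⟨rfl, rfl⟩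
  have hev : Subtype.val ∘ p =ᶠ[𝓝 x] fun y => (f y, g y) := by
    filter_upwards [hfg] with y hy
    exact (hp y hy).1
  have hsm : ContMDiffAt I ((𝓡 a).prod (𝓡 a)) ∞ (Subtype.val ∘ p) x :=
    (hf.prodMk hg).congr_of_eventuallyEq hev
  refine ⟨p, ?_, ?_⟩
  -- The composable pairs are embedded in `G × G`, so continuity and smoothness of the lift can be
  -- tested after the inclusion.
  · rw [ContMDiffAt.iff_comp_isImmersionAt (h𝒢.pairs_embedding.isImmersion.isImmersionAt (p x))]
    exact ⟨h𝒢.pairs_embedding.isEmbedding.isInducing.continuousAt_iff.2 hsm.continuousAt, hsm⟩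
  · filter_upwards [hfg] with y hy
    exact hp y hy

theorem IsLie.contMDiffAt_tmul (h𝒢 : 𝒢.IsLie a b e) {f g : X → G} {x : X}
    (hf : ContMDiffAt I (𝓡 a) ∞ f x) (hg : ContMDiffAt I (𝓡 a) ∞ g x)
    (hfg : ∀ᶠ y in 𝓝 x, 𝒢.src (f y) = 𝒢.tgt (g y)) :
    ContMDiffAt I (𝓡 a) ∞ (fun y => 𝒢.tmul (f y) (g y)) x := by
  obtain ⟨p, hp, hpe⟩ := h𝒢.exists_lift hf hg hfg
  refine (h𝒢.smooth_mul.contMDiffAt.comp x hp).congr_of_eventuallyEq ?_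
  filter_upwards [hpe] with y hy
  exact hy.2.symm

theorem IsLie.contMDiff_pr₁ (h𝒢 : 𝒢.IsLie a b e) : ContMDiff (𝓡 e) (𝓡 a) ∞ 𝒢.pr₁ := by
  have := h𝒢.pairs_manifold
  have := h𝒢.arrows_manifold
  exact contMDiff_fst.comp h𝒢.pairs_embedding.contMDiff

theorem IsLie.contMDiff_pr₂ (h𝒢 : 𝒢.IsLie a b e) : ContMDiff (𝓡 e) (𝓡 a) ∞ 𝒢.pr₂ := by
  have := h𝒢.pairs_manifold
  have := h𝒢.arrows_manifold
  exact contMDiff_snd.comp h𝒢.pairs_embedding.contMDiff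

/-- A multiplicative form is additive on products. -/
theorem IsLie.along_tmul (h𝒢 : 𝒢.IsLie a b e) {θ : FormField (𝓡 a) 1 G}
    (hθ : 𝒢.coboundary e θ = 0) {f g : X → G} {x : X}
    (hf : ContMDiffAt I (𝓡 a) ∞ f x) (hg : ContMDiffAt I (𝓡 a) ∞ g x)
    (hfg : ∀ᶠ y in 𝓝 x, 𝒢.src (f y) = 𝒢.tgt (g y)) :
    θ.along I (fun y => 𝒢.tmul (f y) (g y)) x = θ.along I f x + θ.along I g x := by
  obtain ⟨p, hp, hpe⟩ := h𝒢.exists_lift hf hg hfg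
  have hpd : MDifferentiableAt I (𝓡 e) p x := hp.mdifferentiableAt (by simp)
  have h1 : θ.along I f x = (θ.along (𝓡 e) 𝒢.pr₁ (p x)).comp (tangentMapCLM I (𝓡 e) p x) := by
    rw [← FormField.along_comp θ (h𝒢.contMDiff_pr₁.mdifferentiableAt (by simp)) hpd]
    refine θ.along_congr ?_
    filter_upwards [hpe] with y hy
    exact (congrArg Prod.fst hy.1).symm
  have h2 : θ.along I g x = (θ.along (𝓡 e) 𝒢.pr₂ (p x)).comp (tangentMapCLM I (𝓡 e) p x) := by
    rw [← FormField.along_comp θ (h𝒢.contMDiff_pr₂.mdifferentiableAt (by simp)) hpd]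
    refine θ.along_congr ?_
    filter_upwards [hpe] with y hy
    exact (congrArg Prod.snd hy.1).symm
  have h3 : θ.along I (fun y => 𝒢.tmul (f y) (g y)) x =
      (θ.along (𝓡 e) 𝒢.mul (p x)).comp (tangentMapCLM I (𝓡 e) p x) := by
    rw [← FormField.along_comp θ (h𝒢.smooth_mul.mdifferentiableAt (by simp)) hpd]
    refine θ.along_congr ?_
    filter_upwards [hpe] with y hy
    exact hy.2.symm
  have h4 := toCLM_coboundary (e := e) θ (p x)
  rw [hθ] at h4
  have h5 : (0 : EuclideanSpace ℝ (Fin e) →L[ℝ] ℝ) = θ.along (𝓡 e) 𝒢.pr₁ (p x) -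
    θ.along (𝓡 e) 𝒢.mul (p x) + θ.along (𝓡 e) 𝒢.pr₂ (p x) := h4
  have h6 : θ.along (𝓡 e) 𝒢.mul (p x) = θ.along (𝓡 e) 𝒢.pr₁ (p x) + θ.along (𝓡 e) 𝒢.pr₂ (p x) := by
    rw [eq_comm, ← sub_eq_zero, h5]; abel
  rw [h1, h2, h3, h6, ContinuousLinearMap.add_comp]

/-- Units are idempotent, so additivity of a multiplicative form on products makes the pullback to
the units equal to twice itself. -/
theorem IsLie.along_unit (h𝒢 : 𝒢.IsLie a b e) {θ : FormField (𝓡 a) 1 G}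
    (hθ : 𝒢.coboundary e θ = 0) (x : M) : θ.along (𝓡 b) 𝒢.unit x = 0 := by
  have hu := h𝒢.smooth_unit.contMDiffAt (x := x)
  have h1 := h𝒢.along_tmul hθ hu hu (Eventually.of_forall fun y => by
    rw [𝒢.src_unit, 𝒢.tgt_unit])
  have h2 : (fun y => 𝒢.tmul (𝒢.unit y) (𝒢.unit y)) = 𝒢.unit := by
    funext y
    exact tmul_unit (𝒢.src_unit y)
  rw [h2] at h1
  exact left_eq_add.1 h1

end Smooth

end ArrowGroupoid

theorem FormField.contDiffAt_pullback_model {E : Type*} [NormedAddCommGroup E] [NormedSpace ℝ E]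
    {E' : Type*} [NormedAddCommGroup E'] [NormedSpace ℝ E']
    {Y : Type*} [TopologicalSpace Y] [ChartedSpace E' Y] [IsManifold 𝓘(ℝ, E') ∞ Y]
    {α : FormField 𝓘(ℝ, E') 1 Y} (hα : α.IsSmooth) {f : E → Y} {y : E}
    (hf : ContMDiffAt 𝓘(ℝ, E) 𝓘(ℝ, E') ∞ f y) :
    ContDiffAt ℝ ∞ (show E → E [⋀^Fin 1]→L[ℝ] ℝ from
      FormField.pullback 𝓘(ℝ, E) 𝓘(ℝ, E') f α) y := by
  have h := FormField.contDiffAt_inChart_pullback hα (mem_chart_source E y) hf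
  have h1 : (FormField.pullback 𝓘(ℝ, E) 𝓘(ℝ, E') f α).inChart y =
      FormField.pullback 𝓘(ℝ, E) 𝓘(ℝ, E') f α := by
    funext x
    exact FormField.pullback_id (I := 𝓘(ℝ, E)) (FormField.pullback 𝓘(ℝ, E) 𝓘(ℝ, E') f α) x
  rw [h1] at h
  exact h

theorem FormField.extDeriv_pullback_model {E : Type*} [NormedAddCommGroup E] [NormedSpace ℝ E]
    {E' : Type*} [NormedAddCommGroup E'] [NormedSpace ℝ E']
    {Y : Type*} [TopologicalSpace Y] [ChartedSpace E' Y] [IsManifold 𝓘(ℝ, E') ∞ Y]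
    {α : FormField 𝓘(ℝ, E') 1 Y} (hα : α.IsSmooth) {f : E → Y} {y : E}
    (hf : ContMDiffAt 𝓘(ℝ, E) 𝓘(ℝ, E') ∞ f y) :
    extDeriv (show E → E [⋀^Fin 1]→L[ℝ] ℝ from FormField.pullback 𝓘(ℝ, E) 𝓘(ℝ, E') f α) y =
      FormField.pullback 𝓘(ℝ, E) 𝓘(ℝ, E') f α.d y :=
  (FormField.d_eq_extDeriv _ y).symm.trans (FormField.d_pullback hα hf)

/-- The hypotheses on the quotient map from a strict contact groupoid to a symplectic groupoid. -/
structure IsPrequantization (n : ℕ) {M Sig S : Type*}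
    [TopologicalSpace M] [ChartedSpace (EuclideanSpace ℝ (Fin n)) M]
    [TopologicalSpace Sig] [ChartedSpace (EuclideanSpace ℝ (Fin (2 * n))) Sig]
    [TopologicalSpace S] [ChartedSpace (EuclideanSpace ℝ (Fin (2 * n + 1))) S]
    (𝒢 : ArrowGroupoid Sig M) [ChartedSpace (EuclideanSpace ℝ (Fin (3 * n))) 𝒢.Pairs]
    (Ω : FormField (𝓡 (2 * n)) 2 Sig)
    (𝒮 : ArrowGroupoid S M) [ChartedSpace (EuclideanSpace ℝ (Fin (3 * n + 2))) 𝒮.Pairs]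
    (θ : FormField (𝓡 (2 * n + 1)) 1 S) (q : S → Sig) : Prop where
  symplectic : IsSymplecticGroupoid (2 * n) n (3 * n) 𝒢 Ω
  contact : IsStrictContactGroupoid n n (3 * n + 2) 𝒮 θ
  smooth : ContMDiff (𝓡 (2 * n + 1)) (𝓡 (2 * n)) ∞ q
  hom : 𝒮.IsHom 𝒢 q
  surjective : Function.Surjective q
  form : FormField.pullback (𝓡 (2 * n + 1)) (𝓡 (2 * n)) q Ω = -θ.d
  line : ∀ γ : Sig, Nonempty ((q ⁻¹' {γ} : Set S) ≃ₜ ℝ)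

/-! ### The quotient map is a submersion with flow boxes. -/

namespace IsPrequantization

variable {n : ℕ} {M Sig S : Type*}
    [TopologicalSpace M] [ChartedSpace (EuclideanSpace ℝ (Fin n)) M]
    [TopologicalSpace Sig] [ChartedSpace (EuclideanSpace ℝ (Fin (2 * n))) Sig]
    [TopologicalSpace S] [ChartedSpace (EuclideanSpace ℝ (Fin (2 * n + 1))) S]
    {𝒢 : ArrowGroupoid Sig M} [ChartedSpace (EuclideanSpace ℝ (Fin (3 * n))) 𝒢.Pairs]
    {Ω : FormField (𝓡 (2 * n)) 2 Sig}
    {𝒮 : ArrowGroupoid S M} [ChartedSpace (EuclideanSpace ℝ (Fin (3 * n + 2))) 𝒮.Pairs]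
    {θ : FormField (𝓡 (2 * n + 1)) 1 S} {q : S → Sig}
    (hP : IsPrequantization n 𝒢 Ω 𝒮 θ q)

include hP

/-- A vertical vector contracts to zero with `q^*Ω = -dθ`, so only `θ` can detect it, and the
contact condition applies. -/
theorem eq_zero_of_vertical (s : S) {u : EuclideanSpace ℝ (Fin (2 * n + 1))}
    (h1 : tangentMapCLM (𝓡 (2 * n + 1)) (𝓡 (2 * n)) q s u = 0) (h2 : θ.toCLM s u = 0) :
    u = 0 := by
  refine hP.contact.contact.eq_zero_of_annihilated h2 fun w => ?_
  have h3 : θ.d = -FormField.pullback (𝓡 (2 * n + 1)) (𝓡 (2 * n)) q Ω := by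
    rw [hP.form, neg_neg]
  rw [h3]
  let Ω' : EuclideanSpace ℝ (Fin (2 * n)) [⋀^Fin 2]→L[ℝ] ℝ := Ω (q s)
  change -(Ω' (fun i => tangentMapCLM (𝓡 (2 * n + 1)) (𝓡 (2 * n)) q s (![u, w] i))) = 0
  rw [Ω'.map_coord_zero (i := 0) (by simpa using h1), neg_zero]

/-- On the kernel of `Tq` the functional `θ` is injective, so the kernel has dimension at most one
and the rank is at least `2 n`. -/
theorem surjective_tangentMap (s : S) :
    Function.Surjective (tangentMapCLM (𝓡 (2 * n + 1)) (𝓡 (2 * n)) q s) := by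
  set T : EuclideanSpace ℝ (Fin (2 * n + 1)) →ₗ[ℝ] EuclideanSpace ℝ (Fin (2 * n)) :=
    (tangentMapCLM (𝓡 (2 * n + 1)) (𝓡 (2 * n)) q s).toLinearMap with hT
  have h1 := T.finrank_range_add_finrank_ker
  have hinj : Function.Injective
      ((θ.toCLM s : EuclideanSpace ℝ (Fin (2 * n + 1)) →ₗ[ℝ] ℝ).domRestrict (LinearMap.ker T)) := by
    rw [injective_iff_map_eq_zero]
    rintro ⟨u, hu⟩ h
    exact Subtype.ext (hP.eq_zero_of_vertical s hu h)
  have h2 := LinearMap.finrank_le_finrank_of_injective hinj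
  rw [Module.finrank_self] at h2
  rw [finrank_euclideanSpace_fin] at h1
  have h3 : Module.finrank ℝ (LinearMap.range T) =
      Module.finrank ℝ (EuclideanSpace ℝ (Fin (2 * n))) := by
    refine le_antisymm (Submodule.finrank_le _) ?_
    rw [finrank_euclideanSpace_fin]; omega
  have h4 := Submodule.eq_top_of_finrank_eq h3
  exact LinearMap.range_eq_top.1 h4

theorem isManifold_source : IsManifold (𝓡 (2 * n + 1)) ∞ S := hP.contact.lie.arrows_manifold

theorem isManifold_target : IsManifold (𝓡 (2 * n)) ∞ Sig := hP.symplectic.lie.arrows_manifold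

theorem exists_section (s : S) :
    ∃ (V : Set Sig) (σ : Sig → S), IsOpen V ∧ q s ∈ V ∧
      ContMDiffOn (𝓡 (2 * n)) (𝓡 (2 * n + 1)) ∞ σ V ∧ (∀ y ∈ V, q (σ y) = y) ∧ σ (q s) = s := by
  have := hP.isManifold_source
  have := hP.isManifold_target
  exact exists_local_section hP.smooth s (hP.surjective_tangentMap s)

/-- Pulling the derivative of `θ` back by a map only depends on the projection of the map. -/
theorem pullback_d_eq {E : Type*} [NormedAddCommGroup E] [NormedSpace ℝ E] {f g : E → S} {y : E}
    (hf : MDifferentiableAt 𝓘(ℝ, E) (𝓡 (2 * n + 1)) f y)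
    (hg : MDifferentiableAt 𝓘(ℝ, E) (𝓡 (2 * n + 1)) g y) (h : q ∘ f =ᶠ[𝓝 y] q ∘ g) :
    FormField.pullback 𝓘(ℝ, E) (𝓡 (2 * n + 1)) f θ.d y =
      FormField.pullback 𝓘(ℝ, E) (𝓡 (2 * n + 1)) g θ.d y := by
  have h3 : θ.d = -FormField.pullback (𝓡 (2 * n + 1)) (𝓡 (2 * n)) q Ω := by
    rw [hP.form, neg_neg]
  have hq : ∀ s, MDifferentiableAt (𝓡 (2 * n + 1)) (𝓡 (2 * n)) q s := fun s =>
    hP.smooth.mdifferentiableAt (by simp)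
  have h4 : FormField.pullback 𝓘(ℝ, E) (𝓡 (2 * n + 1)) f
        (FormField.pullback (𝓡 (2 * n + 1)) (𝓡 (2 * n)) q Ω) y =
      FormField.pullback 𝓘(ℝ, E) (𝓡 (2 * n + 1)) g
        (FormField.pullback (𝓡 (2 * n + 1)) (𝓡 (2 * n)) q Ω) y := by
    rw [← FormField.pullback_comp Ω (hq _) hf, ← FormField.pullback_comp Ω (hq _) hg]
    exact FormField.pullback_congr Ω h
  rw [h3]
  exact congrArg (fun ξ : E [⋀^Fin 2]→L[ℝ] ℝ => -ξ) h4

/-- Around each point the contact groupoid is the product of an open subset of the symplectic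
groupoid and of an interval, and `θ` is `dz` plus a form from the base. -/
theorem exists_flowBox (s₀ : S) :
    ∃ (Ψ : PartialDiffeomorph (𝓡 (2 * n + 1)) ((𝓡 (2 * n)).prod 𝓘(ℝ, ℝ)) S (Sig × ℝ) ∞)
      (α : FormField (𝓡 (2 * n)) 1 Sig), s₀ ∈ Ψ.source ∧ (∀ s ∈ Ψ.source, (Ψ s).1 = q s) ∧
      ∀ s ∈ Ψ.source, θ.toCLM s =
        tangentMapCLM (𝓡 (2 * n + 1)) 𝓘(ℝ, ℝ) (fun s => (Ψ s).2) s +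
          α.along (𝓡 (2 * n + 1)) q s := by
  have := hP.isManifold_source
  have := hP.isManifold_target
  have hθ := hP.contact.contact.smooth
  obtain ⟨V, σ, hV, hs₀V, hσ, hqσ, hσ₀⟩ := hP.exists_section s₀
  let φ := chartAt (EuclideanSpace ℝ (Fin (2 * n + 1))) s₀
  -- The maps `σ ∘ q` and the identity have the same projection to `Sig`, so the pullbacks of `θ` by
  -- them have the same exterior derivative. Their difference is closed, and its primitive `z₀` is
  -- the fibre coordinate.
  let f : EuclideanSpace ℝ (Fin (2 * n + 1)) → S := σ ∘ q ∘ φ.symm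
  let D : Set (EuclideanSpace ℝ (Fin (2 * n + 1))) := φ.target ∩ φ.symm ⁻¹' (q ⁻¹' V)
  have hD : IsOpen D :=
    φ.symm.isOpen_inter_preimage (hV.preimage hP.smooth.continuous)
  have hφsymm : ∀ y ∈ D, ContMDiffAt (𝓡 (2 * n + 1)) (𝓡 (2 * n + 1)) ∞ φ.symm y :=
    fun y hy => contMDiffAt_chartAt_symm hy.1
  have hσq : ∀ s, q s ∈ V → ContMDiffAt (𝓡 (2 * n + 1)) (𝓡 (2 * n + 1)) ∞ (σ ∘ q) s :=
    fun s hs => (hσ.contMDiffAt (hV.mem_nhds hs)).comp s hP.smooth.contMDiffAt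
  have hf : ∀ y ∈ D, ContMDiffAt (𝓡 (2 * n + 1)) (𝓡 (2 * n + 1)) ∞ f y :=
    fun y hy => (hσq _ hy.2).comp y (hφsymm y hy)
  have hqf : ∀ y ∈ D, q ∘ φ.symm =ᶠ[𝓝 y] q ∘ f := by
    intro y hy
    filter_upwards [hD.mem_nhds hy] with y' hy'
    exact (hqσ _ hy'.2).symm
  let β₁ : EuclideanSpace ℝ (Fin (2 * n + 1)) →
    EuclideanSpace ℝ (Fin (2 * n + 1)) [⋀^Fin 1]→L[ℝ] ℝ :=
      FormField.pullback (𝓡 (2 * n + 1)) (𝓡 (2 * n + 1)) φ.symm θ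
  let β₂ : EuclideanSpace ℝ (Fin (2 * n + 1)) →
    EuclideanSpace ℝ (Fin (2 * n + 1)) [⋀^Fin 1]→L[ℝ] ℝ :=
      FormField.pullback (𝓡 (2 * n + 1)) (𝓡 (2 * n + 1)) f θ
  have hβ₁ : ∀ y ∈ D, ContDiffAt ℝ ∞ β₁ y := fun y hy =>
    FormField.contDiffAt_pullback_model hθ (hφsymm y hy)
  have hβ₂ : ∀ y ∈ D, ContDiffAt ℝ ∞ β₂ y := fun y hy =>
    FormField.contDiffAt_pullback_model hθ (hf y hy)
  have hclosed : ∀ y ∈ D, extDeriv (β₁ + (-1 : ℝ) • β₂) y = 0 := by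
    intro y hy
    rw [extDeriv_add ((hβ₁ y hy).differentiableAt (by simp))
      (((hβ₂ y hy).differentiableAt (by simp)).const_smul _), extDeriv_smul]
    have h1 : extDeriv β₁ y = extDeriv β₂ y := by
      refine (FormField.extDeriv_pullback_model hθ (hφsymm y hy)).trans
        (Eq.trans ?_ (FormField.extDeriv_pullback_model hθ (hf y hy)).symm)
      exact hP.pullback_d_eq ((hφsymm y hy).mdifferentiableAt (by simp))
        ((hf y hy).mdifferentiableAt (by simp)) (hqf y hy)
    rw [h1, neg_one_smul, add_neg_cancel]
  have hφ₀ : φ.symm (φ s₀) = s₀ := φ.left_inv (mem_chart_source _ s₀)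
  have hy₀ : φ s₀ ∈ D := by
    refine ⟨mem_chart_target _ s₀, ?_⟩
    change q (φ.symm (φ s₀)) ∈ V
    rw [hφ₀]; exact hs₀V
  obtain ⟨V', z₀, hV', hyV', hz₀, hdz₀⟩ := exists_primitive_of_extDeriv_eq_zero
    (β := β₁ + (-1 : ℝ) • β₂) (y₀ := φ s₀)
    (by
      filter_upwards [hD.mem_nhds hy₀] with y hy
      exact (hβ₁ y hy).add (contDiffAt_const.smul (hβ₂ y hy)))
    (by
      filter_upwards [hD.mem_nhds hy₀] with y hy
      exact hclosed y hy)
  let W : Set S := φ.source ∩ φ ⁻¹' (V' ∩ D)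
  have hW : IsOpen W := φ.isOpen_inter_preimage (hV'.inter hD)
  have hs₀W : s₀ ∈ W := ⟨mem_chart_source _ s₀, hyV', hy₀⟩
  have hqW : ∀ s ∈ W, q s ∈ V := by
    intro s hs
    have : q (φ.symm (φ s)) ∈ V := hs.2.2.2
    rwa [φ.left_inv hs.1] at this
  let α : FormField (𝓡 (2 * n)) 1 Sig := FormField.pullback (𝓡 (2 * n)) (𝓡 (2 * n + 1)) σ θ
  have hzd : ∀ y ∈ V', MDifferentiableAt (𝓡 (2 * n + 1)) 𝓘(ℝ, ℝ) z₀ y := fun y hy =>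
    ((hz₀.contDiffAt (hV'.mem_nhds hy)).differentiableAt (by simp)).mdifferentiableAt
  have hform : ∀ s ∈ W, θ.toCLM s =
        tangentMapCLM (𝓡 (2 * n + 1)) 𝓘(ℝ, ℝ) (z₀ ∘ φ) s +
          α.along (𝓡 (2 * n + 1)) q s := by
    intro s hs
    have hφd := (mdifferentiableAt_chartAt (E := EuclideanSpace ℝ (Fin (2 * n + 1))) hs.1)
    rw [tangentMapCLM_comp (hzd _ hs.2.1) hφd]
    have h1 : tangentMapCLM (𝓡 (2 * n + 1)) 𝓘(ℝ, ℝ) z₀ (φ s) =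
        θ.along (𝓡 (2 * n + 1)) φ.symm (φ s) - θ.along (𝓡 (2 * n + 1)) f (φ s) := by
      ext v
      have h2 : tangentMapCLM (𝓡 (2 * n + 1)) 𝓘(ℝ, ℝ) z₀ (φ s) v = fderiv ℝ z₀ (φ s) v :=
        congrArg (fun L : EuclideanSpace ℝ (Fin (2 * n + 1)) →L[ℝ] ℝ => L v) mfderiv_eq_fderiv
      rw [h2, hdz₀ _ hs.2.1 v]
      change β₁ (φ s) (fun _ => v) + (-1 : ℝ) * β₂ (φ s) (fun _ => v) = _
      rw [neg_one_mul, ← sub_eq_add_neg]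
      rfl
    have h3 : (θ.along (𝓡 (2 * n + 1)) φ.symm (φ s)).comp
        (tangentMapCLM (𝓡 (2 * n + 1)) (𝓡 (2 * n + 1)) φ s) = θ.toCLM s := by
      rw [← FormField.along_comp θ ((hφsymm _ hs.2.2).mdifferentiableAt (by simp)) hφd]
      have : φ.symm ∘ φ =ᶠ[𝓝 s] id := by
        filter_upwards [φ.open_source.mem_nhds hs.1] with s' hs'
        exact φ.left_inv hs'
      rw [FormField.along_congr θ this]
      unfold FormField.along
      rw [tangentMapCLM_id]
      rfl
    have h4 : (θ.along (𝓡 (2 * n + 1)) f (φ s)).comp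
        (tangentMapCLM (𝓡 (2 * n + 1)) (𝓡 (2 * n + 1)) φ s) = α.along (𝓡 (2 * n + 1)) q s := by
      rw [← FormField.along_comp θ ((hf _ hs.2.2).mdifferentiableAt (by simp)) hφd]
      have : f ∘ φ =ᶠ[𝓝 s] σ ∘ q := by
        filter_upwards [φ.open_source.mem_nhds hs.1] with s' hs'
        exact congrArg (σ ∘ q) (φ.left_inv hs')
      rw [FormField.along_congr θ this, FormField.along_comp θ
        ((hσ.contMDiffAt (hV.mem_nhds (hqW s hs))).mdifferentiableAt (by simp))
        (hP.smooth.mdifferentiableAt (by simp))]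
      rfl
    rw [h1, ContinuousLinearMap.sub_comp, h3, h4, sub_add_cancel]
  let F : S → Sig × ℝ := fun s => (q s, (z₀ ∘ φ) s)
  have hz : ContMDiffOn (𝓡 (2 * n + 1)) 𝓘(ℝ, ℝ) ∞ (z₀ ∘ φ) W := by
    intro s hs
    exact (((hz₀.contDiffAt (hV'.mem_nhds hs.2.1)).contMDiffAt).comp s
      (contMDiffAt_chartAt' hs.1)).contMDiffWithinAt
  have hF : ContMDiffOn (𝓡 (2 * n + 1)) ((𝓡 (2 * n)).prod 𝓘(ℝ, ℝ)) ∞ F W :=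
    hP.smooth.contMDiffOn.prodMk hz
  have hbij : Function.Bijective (mfderiv (𝓡 (2 * n + 1)) ((𝓡 (2 * n)).prod 𝓘(ℝ, ℝ)) F s₀) := by
    let T : EuclideanSpace ℝ (Fin (2 * n + 1)) →ₗ[ℝ] EuclideanSpace ℝ (Fin (2 * n)) × ℝ :=
      ((tangentMapCLM (𝓡 (2 * n + 1)) (𝓡 (2 * n)) q s₀).prod
        (tangentMapCLM (𝓡 (2 * n + 1)) 𝓘(ℝ, ℝ) (z₀ ∘ φ) s₀)).toLinearMap
    -- If `Tq` and `dz` both kill `u`, then so does `θ = dz + q^*α`, and a vertical vector killed by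
    -- `θ` is zero. Bijectivity follows by equality of dimensions.
    have hT : Function.Injective T := by
      rw [injective_iff_map_eq_zero]
      intro u hu
      have hu1 : tangentMapCLM (𝓡 (2 * n + 1)) (𝓡 (2 * n)) q s₀ u = 0 := congrArg Prod.fst hu
      have hu2 : tangentMapCLM (𝓡 (2 * n + 1)) 𝓘(ℝ, ℝ) (z₀ ∘ φ) s₀ u = 0 := congrArg Prod.snd hu
      refine hP.eq_zero_of_vertical s₀ hu1 ?_
      rw [hform s₀ hs₀W, add_apply, hu2, zero_add]
      change α.toCLM (q s₀) (tangentMapCLM (𝓡 (2 * n + 1)) (𝓡 (2 * n)) q s₀ u) = 0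
      rw [hu1, map_zero]
    have hT' : Function.Bijective T :=
      ⟨hT, (LinearMap.injective_iff_surjective_of_finrank_eq_finrank (by simp)).1 hT⟩
    have e1 := (hP.smooth.mdifferentiableAt (x := s₀) (by simp)).mfderiv_prod
      ((hz.contMDiffAt (hW.mem_nhds hs₀W)).mdifferentiableAt (by simp))
    change Function.Bijective
      (mfderiv (𝓡 (2 * n + 1)) ((𝓡 (2 * n)).prod 𝓘(ℝ, ℝ)) (fun s => (q s, (z₀ ∘ φ) s)) s₀)
    rw [e1]
    exact hT'
  obtain ⟨Ψ, h1, h2, h3⟩ := isLocalDiffeomorphAt_of_mfderiv_bijective hW hF hs₀W hbij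
  refine ⟨Ψ, α, h1, fun s hs => ?_, fun s hs => ?_⟩
  · rw [← h3 hs]
  · rw [hform s (h2 hs)]
    congr 1
    refine tangentMapCLM_congr ?_
    filter_upwards [Ψ.open_source.mem_nhds hs] with s' hs'
    rw [← h3 hs']

end IsPrequantization

section RealFunctions

variable {E : Type*} [NormedAddCommGroup E] [NormedSpace ℝ E] {H : Type*} [TopologicalSpace H]
  {I : ModelWithCorners ℝ E H} {X : Type*} [TopologicalSpace X] [ChartedSpace H X]

theorem tangentMapCLM_add {f g : X → ℝ} {x : X} (hf : MDifferentiableAt I 𝓘(ℝ, ℝ) f x)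
    (hg : MDifferentiableAt I 𝓘(ℝ, ℝ) g x) :
    tangentMapCLM I 𝓘(ℝ, ℝ) (fun y => f y + g y) x =
      tangentMapCLM I 𝓘(ℝ, ℝ) f x + tangentMapCLM I 𝓘(ℝ, ℝ) g x :=
  mfderiv_add hf hg

theorem tangentMapCLM_real {f : ℝ → ℝ} {f' t : ℝ} (hf : HasDerivAt f f' t) :
    tangentMapCLM 𝓘(ℝ, ℝ) 𝓘(ℝ, ℝ) f t 1 = f' := by
  have h : tangentMapCLM 𝓘(ℝ, ℝ) 𝓘(ℝ, ℝ) f t = fderiv ℝ f t := mfderiv_eq_fderiv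
  rw [h, fderiv_apply_one_eq_deriv, hf.deriv]

theorem FormField.along_const {E' : Type*} [NormedAddCommGroup E'] [NormedSpace ℝ E']
    {H' : Type*} [TopologicalSpace H'] {I' : ModelWithCorners ℝ E' H'}
    {Y : Type*} [TopologicalSpace Y] [ChartedSpace H' Y] (α : FormField I' 1 Y) (y : Y) (x : X) :
    α.along I (fun _ : X => y) x = 0 := by
  unfold FormField.along
  rw [tangentMapCLM_const, ContinuousLinearMap.comp_zero]

end RealFunctions

/-! ### Reeb curves: translation, uniqueness and local existence. -/

namespace IsPrequantization

section ReebCurve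

variable {n : ℕ} {Sig S : Type*} [TopologicalSpace S]
    [ChartedSpace (EuclideanSpace ℝ (Fin (2 * n + 1))) S]
    {θ : FormField (𝓡 (2 * n + 1)) 1 S} {q : S → Sig}

/-- Curves in a fibre of `q` along which `θ` is the differential of the parameter. -/
def IsReebCurve (θ : FormField (𝓡 (2 * n + 1)) 1 S) (q : S → Sig) (J : Set ℝ) (γ : ℝ → S)
    (g : Sig) : Prop :=
  ∀ t ∈ J, ContMDiffAt 𝓘(ℝ, ℝ) (𝓡 (2 * n + 1)) ∞ γ t ∧ q (γ t) = g ∧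
    θ.along 𝓘(ℝ, ℝ) γ t 1 = 1

theorem IsReebCurve.mono {J J' : Set ℝ} {γ : ℝ → S} {g : Sig} (h : IsReebCurve θ q J γ g)
    (hJ : J' ⊆ J) : IsReebCurve θ q J' γ g := fun t ht => h t (hJ ht)

theorem IsReebCurve.congr {J : Set ℝ} {γ γ' : ℝ → S} {g : Sig} (h : IsReebCurve θ q J γ g)
    (hJ : IsOpen J) (he : EqOn γ γ' J) : IsReebCurve θ q J γ' g := by
  intro t ht
  have h1 : γ' =ᶠ[𝓝 t] γ := by
    filter_upwards [hJ.mem_nhds ht] with t' ht'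
    exact (he ht').symm
  obtain ⟨h2, h3, h4⟩ := h t ht
  exact ⟨h2.congr_of_eventuallyEq h1, by rw [h1.self_of_nhds, h3], by rw [θ.along_congr h1, h4]⟩

theorem IsReebCurve.shift {J : Set ℝ} {γ : ℝ → S} {g : Sig} (h : IsReebCurve θ q J γ g) (b : ℝ) :
    IsReebCurve θ q ((fun t => t + b) ⁻¹' J) (fun t => γ (t + b)) g := by
  intro t ht
  obtain ⟨h2, h3, h4⟩ := h (t + b) ht
  have h5 : ContMDiff 𝓘(ℝ, ℝ) 𝓘(ℝ, ℝ) ∞ (fun t : ℝ => t + b) :=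
    (contDiff_id.add contDiff_const).contMDiff
  refine ⟨h2.comp t h5.contMDiffAt, h3, ?_⟩
  have h6 := θ.along_comp (x := t) (f := fun t : ℝ => t + b)
    (h2.mdifferentiableAt (by simp)) (h5.mdifferentiableAt (x := t) (by simp))
  change θ.along 𝓘(ℝ, ℝ) (γ ∘ fun t => t + b) t 1 = 1
  have h7 : tangentMapCLM 𝓘(ℝ, ℝ) 𝓘(ℝ, ℝ) (fun t : ℝ => t + b) t 1 = 1 :=
    tangentMapCLM_real ((hasDerivAt_id t).add_const b)
  rw [h6, ContinuousLinearMap.comp_apply, h7, h4]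

end ReebCurve

variable {n : ℕ} {M Sig S : Type*}
    [TopologicalSpace M] [ChartedSpace (EuclideanSpace ℝ (Fin n)) M]
    [TopologicalSpace Sig] [ChartedSpace (EuclideanSpace ℝ (Fin (2 * n))) Sig]
    [TopologicalSpace S] [ChartedSpace (EuclideanSpace ℝ (Fin (2 * n + 1))) S]
    {𝒢 : ArrowGroupoid Sig M} [ChartedSpace (EuclideanSpace ℝ (Fin (3 * n))) 𝒢.Pairs]
    {Ω : FormField (𝓡 (2 * n)) 2 Sig}
    {𝒮 : ArrowGroupoid S M} [ChartedSpace (EuclideanSpace ℝ (Fin (3 * n + 2))) 𝒮.Pairs]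
    {θ : FormField (𝓡 (2 * n + 1)) 1 S} {q : S → Sig}

section FlowBox

variable {E : Type*} [NormedAddCommGroup E] [NormedSpace ℝ E] {H : Type*} [TopologicalSpace H]
    {I : ModelWithCorners ℝ E H} {X : Type*} [TopologicalSpace X] [ChartedSpace H X]

theorem along_flowBox (hP : IsPrequantization n 𝒢 Ω 𝒮 θ q)
    {Ψ : PartialDiffeomorph (𝓡 (2 * n + 1)) ((𝓡 (2 * n)).prod 𝓘(ℝ, ℝ)) S (Sig × ℝ) ∞}
    {α : FormField (𝓡 (2 * n)) 1 Sig}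
    (hΨ : ∀ s ∈ Ψ.source, θ.toCLM s =
        tangentMapCLM (𝓡 (2 * n + 1)) 𝓘(ℝ, ℝ) (fun s => (Ψ s).2) s +
          α.along (𝓡 (2 * n + 1)) q s)
    {F : X → S} {x : X} (hF : MDifferentiableAt I (𝓡 (2 * n + 1)) F x) (hx : F x ∈ Ψ.source) :
    θ.along I F x = tangentMapCLM I 𝓘(ℝ, ℝ) (fun y => (Ψ (F y)).2) x + α.along I (q ∘ F) x := by
  have h1 : MDifferentiableAt (𝓡 (2 * n + 1)) 𝓘(ℝ, ℝ) (fun s => (Ψ s).2) (F x) :=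
    mdifferentiableAt_snd.comp (F x) (Ψ.mdifferentiableAt (by simp) hx)
  rw [FormField.along_comp α (hP.smooth.mdifferentiableAt (by simp)) hF]
  have h2 := tangentMapCLM_comp h1 hF
  change tangentMapCLM I 𝓘(ℝ, ℝ) (fun y => (Ψ (F y)).2) x = _ at h2
  rw [h2, ← ContinuousLinearMap.add_comp, ← hΨ _ hx]
  rfl

end FlowBox

/-- By additivity of `θ` on products, the constant factor contributes nothing to the speed, so
translation preserves Reeb curves. -/
theorem IsReebCurve.tmul_right (hP : IsPrequantization n 𝒢 Ω 𝒮 θ q) {J : Set ℝ} {γ : ℝ → S}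
    {g : Sig} (h : IsReebCurve θ q J γ g) (hJ : IsOpen J) {s : S} (hs : 𝒢.src g = 𝒮.tgt s) :
    IsReebCurve θ q J (fun t => 𝒮.tmul (γ t) s) (𝒢.tmul g (q s)) := by
  intro t ht
  have hc : ∀ t ∈ J, 𝒮.src (γ t) = 𝒮.tgt s := fun t ht => by
    rw [← hP.hom.map_src, (h t ht).2.1, hs]
  have hev : ∀ᶠ t' in 𝓝 t, 𝒮.src (γ t') = 𝒮.tgt s := by
    filter_upwards [hJ.mem_nhds ht] with t' ht' using hc t' ht'
  obtain ⟨h2, h3, h4⟩ := h t ht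
  refine ⟨hP.contact.lie.contMDiffAt_tmul h2 contMDiffAt_const hev, ?_, ?_⟩
  · rw [hP.hom.map_tmul (hc t ht), h3]
  · rw [hP.contact.lie.along_tmul hP.contact.multiplicative h2 contMDiffAt_const hev,
      FormField.along_const, add_zero, h4]

theorem IsReebCurve.tmul_left (hP : IsPrequantization n 𝒢 Ω 𝒮 θ q) {J : Set ℝ} {γ : ℝ → S}
    {g : Sig} (h : IsReebCurve θ q J γ g) (hJ : IsOpen J) {s : S} (hs : 𝒮.src s = 𝒢.tgt g) :
    IsReebCurve θ q J (fun t => 𝒮.tmul s (γ t)) (𝒢.tmul (q s) g) := by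
  intro t ht
  have hc : ∀ t ∈ J, 𝒮.src s = 𝒮.tgt (γ t) := fun t ht => by
    rw [← hP.hom.map_tgt, (h t ht).2.1, hs]
  have hev : ∀ᶠ t' in 𝓝 t, 𝒮.src s = 𝒮.tgt (γ t') := by
    filter_upwards [hJ.mem_nhds ht] with t' ht' using hc t' ht'
  obtain ⟨h2, h3, h4⟩ := h t ht
  refine ⟨hP.contact.lie.contMDiffAt_tmul contMDiffAt_const h2 hev, ?_, ?_⟩
  · rw [hP.hom.map_tmul (hc t ht), h3]
  · rw [hP.contact.lie.along_tmul hP.contact.multiplicative contMDiffAt_const h2 hev,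
      FormField.along_const, zero_add, h4]

/-- A Reeb curve has constant speed in a flow box. -/
theorem IsReebCurve.eventually_flowBox (hP : IsPrequantization n 𝒢 Ω 𝒮 θ q)
    {Ψ : PartialDiffeomorph (𝓡 (2 * n + 1)) ((𝓡 (2 * n)).prod 𝓘(ℝ, ℝ)) S (Sig × ℝ) ∞}
    {α : FormField (𝓡 (2 * n)) 1 Sig} (hΨq : ∀ s ∈ Ψ.source, (Ψ s).1 = q s)
    (hΨ : ∀ s ∈ Ψ.source, θ.toCLM s =
        tangentMapCLM (𝓡 (2 * n + 1)) 𝓘(ℝ, ℝ) (fun s => (Ψ s).2) s +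
          α.along (𝓡 (2 * n + 1)) q s)
    {J : Set ℝ} {γ : ℝ → S} {g : Sig} (h : IsReebCurve θ q J γ g) (hJ : IsOpen J) {t₀ : ℝ}
    (ht₀ : t₀ ∈ J) (hs : γ t₀ ∈ Ψ.source) :
    ∀ᶠ t in 𝓝 t₀, γ t ∈ Ψ.source ∧ Ψ (γ t) = (g, (Ψ (γ t₀)).2 + (t - t₀)) := by
  have h1 : ∀ᶠ t in 𝓝 t₀, t ∈ J ∧ γ t ∈ Ψ.source :=
    (hJ.eventually_mem ht₀).and ((h t₀ ht₀).1.continuousAt.eventually (Ψ.open_source.mem_nhds hs))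
  obtain ⟨r, hr, hball⟩ := Metric.eventually_nhds_iff_ball.1 h1
  -- The projection of the curve to `Sig` is constant, so along it `θ = dz + q^*α` reduces to `dz`,
  -- and the speed is one.
  have hder : ∀ t ∈ Metric.ball t₀ r, HasDerivAt (fun t => (Ψ (γ t)).2) 1 t := by
    intro t ht
    obtain ⟨htJ, hts⟩ := hball t ht
    obtain ⟨h2, h3, h4⟩ := h t htJ
    have h5 := hP.along_flowBox hΨ (h2.mdifferentiableAt (by simp)) hts
    have h6 : q ∘ γ =ᶠ[𝓝 t] fun _ => g := by
      filter_upwards [hJ.mem_nhds htJ] with t' ht'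
      exact (h t' ht').2.1
    rw [α.along_congr h6, α.along_const, add_zero] at h5
    have h7 : MDifferentiableAt 𝓘(ℝ, ℝ) 𝓘(ℝ, ℝ) (fun t => (Ψ (γ t)).2) t :=
      mdifferentiableAt_snd.comp t
        ((Ψ.mdifferentiableAt (by simp) hts).comp t (h2.mdifferentiableAt (by simp)))
    have h8 := h7.differentiableAt.hasDerivAt
    rwa [← tangentMapCLM_real h8, ← h5, h4] at h8
  have hconst : ∀ t ∈ Metric.ball t₀ r, (Ψ (γ t)).2 - t = (Ψ (γ t₀)).2 - t₀ := by
    intro t ht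
    refine Metric.isOpen_ball.is_const_of_deriv_eq_zero (f := fun t => (Ψ (γ t)).2 - t)
      (convex_ball t₀ r).isPreconnected (fun t ht => ?_) (fun t ht => ?_) ht
      (Metric.mem_ball_self hr)
    · exact ((hder t ht).sub (hasDerivAt_id t)).differentiableAt.differentiableWithinAt
    · exact ((hder t ht).sub (hasDerivAt_id t)).deriv.trans (sub_self 1)
  filter_upwards [Metric.ball_mem_nhds t₀ hr] with t ht
  refine ⟨(hball t ht).2, Prod.ext ?_ ?_⟩
  · rw [hΨq _ (hball t ht).2]
    exact (h t (hball t ht).1).2.1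
  · have := hconst t ht
    dsimp only
    linarith

/-- Reeb curves in the same fibre are determined by their value at one point. -/
theorem IsReebCurve.eqOn (hP : IsPrequantization n 𝒢 Ω 𝒮 θ q) {J : Set ℝ} {γ γ' : ℝ → S} {g : Sig}
    (h : IsReebCurve θ q J γ g) (h' : IsReebCurve θ q J γ' g) (hJ : IsOpen J)
    (hJc : IsPreconnected J) {t₀ : ℝ} (ht₀ : t₀ ∈ J) (he : γ t₀ = γ' t₀) : EqOn γ γ' J := by
  obtain ⟨φ⟩ := hP.line g
  -- The manifold `S` may fail to be Hausdorff. Both curves stay in one fibre, which is Hausdorff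
  -- because it is a line, and this makes the coincidence set closed.
  have : T2Space (q ⁻¹' {g} : Set S) := φ.symm.t2Space
  have : PreconnectedSpace J := Subtype.preconnectedSpace hJc
  let f : J → (q ⁻¹' {g} : Set S) := fun t => ⟨γ t, (h t t.2).2.1⟩
  let f' : J → (q ⁻¹' {g} : Set S) := fun t => ⟨γ' t, (h' t t.2).2.1⟩
  have hf : Continuous f := Continuous.subtype_mk (continuous_iff_continuousAt.2 fun t : J =>
    ((h t t.2).1.continuousAt.comp continuousAt_subtype_val : ContinuousAt (γ ∘ Subtype.val) t)) _
  have hf' : Continuous f' := Continuous.subtype_mk (continuous_iff_continuousAt.2 fun t : J =>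
    ((h' t t.2).1.continuousAt.comp continuousAt_subtype_val : ContinuousAt (γ' ∘ Subtype.val) t)) _
  have hclosed : IsClosed {t : J | f t = f' t} := isClosed_eq hf hf'
  -- In a flow box around a common value, both curves have the same base point and unit speed, hence
  -- they agree nearby.
  have hopen : IsOpen {t : J | f t = f' t} := by
    rw [isOpen_iff_mem_nhds]
    intro t ht
    have htt : γ t = γ' t := congrArg Subtype.val ht
    obtain ⟨Ψ, α, hs, hΨq, hΨ⟩ := hP.exists_flowBox (γ t)
    have e1 := h.eventually_flowBox hP hΨq hΨ hJ t.2 hs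
    have e2 := h'.eventually_flowBox hP hΨq hΨ hJ t.2 (htt ▸ hs)
    have e3 : ∀ᶠ u in 𝓝 (t : ℝ), γ u = γ' u := by
      filter_upwards [e1, e2] with u hu hu'
      refine Ψ.toPartialEquiv.injOn hu.1 hu'.1 ?_
      exact hu.2.trans (by rw [htt]; exact hu'.2.symm)
    filter_upwards [continuousAt_subtype_val.eventually e3] with u hu
    exact Subtype.ext hu
  have huniv := IsClopen.eq_univ ⟨hclosed, hopen⟩ ⟨⟨t₀, ht₀⟩, Subtype.ext he⟩
  intro t ht
  have : (⟨t, ht⟩ : J) ∈ {t : J | f t = f' t} := huniv ▸ mem_univ _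
  exact congrArg Subtype.val this

variable (hP : IsPrequantization n 𝒢 Ω 𝒮 θ q)

include hP

/-- Existence of Reeb curves through the units, with smooth dependence on the unit. -/
theorem exists_local_reeb (x₀ : M) :
    ∃ (ε : ℝ) (V : Set M) (k : ℝ × M → S), 0 < ε ∧ IsOpen V ∧ x₀ ∈ V ∧
      (∀ p : ℝ × M, |p.1| < ε → p.2 ∈ V →
        ContMDiffAt (𝓘(ℝ, ℝ).prod (𝓡 n)) (𝓡 (2 * n + 1)) ∞ k p ∧
        θ.along (𝓘(ℝ, ℝ).prod (𝓡 n)) k p =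
          tangentMapCLM (𝓘(ℝ, ℝ).prod (𝓡 n)) 𝓘(ℝ, ℝ) Prod.fst p ∧
        q (k p) = 𝒢.unit p.2) ∧
      (∀ x ∈ V, k (0, x) = 𝒮.unit x) ∧
      ∀ x ∈ V, ∀ᶠ s in 𝓝 (𝒮.unit x), q s = 𝒢.unit x → ∃ t, |t| < ε ∧ k (t, x) = s := by
  obtain ⟨Ψ, α, hs, hΨq, hΨ⟩ := hP.exists_flowBox (𝒮.unit x₀)
  have hu := hP.contact.lie.smooth_unit
  have hu' := hP.symplectic.lie.smooth_unit
  have hqu : ∀ x, q (𝒮.unit x) = 𝒢.unit x := hP.hom.map_unit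
  let V₀ : Set M := 𝒮.unit ⁻¹' Ψ.source
  have hV₀ : IsOpen V₀ := Ψ.open_source.preimage hu.continuous
  -- In flow box coordinates: start at the unit and increase the fibre coordinate by the time.
  let w : ℝ × M → Sig × ℝ := fun p => (𝒢.unit p.2, (Ψ (𝒮.unit p.2)).2 + p.1)
  have hzu : ∀ x ∈ V₀, ContMDiffAt (𝓡 n) 𝓘(ℝ, ℝ) ∞ (fun x => (Ψ (𝒮.unit x)).2) x := fun x hx =>
    contMDiffAt_snd.comp x
      (((Ψ.contMDiffOn.contMDiffAt (Ψ.open_source.mem_nhds hx))).comp x hu.contMDiffAt)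
  have hzu2 : ∀ p : ℝ × M, p.2 ∈ V₀ → ContMDiffAt (𝓘(ℝ, ℝ).prod (𝓡 n)) 𝓘(ℝ, ℝ) ∞
      (fun p : ℝ × M => (Ψ (𝒮.unit p.2)).2) p := fun p hp => (hzu p.2 hp).comp p contMDiffAt_snd
  have hw : ∀ p : ℝ × M, p.2 ∈ V₀ →
      ContMDiffAt (𝓘(ℝ, ℝ).prod (𝓡 n)) ((𝓡 (2 * n)).prod 𝓘(ℝ, ℝ)) ∞ w p := fun p hp =>
    (hu'.contMDiffAt.comp p contMDiffAt_snd).prodMk ((hzu2 p hp).add contMDiffAt_fst)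
  have hw0 : ∀ x ∈ V₀, w (0, x) = Ψ (𝒮.unit x) := by
    intro x hx
    refine Prod.ext ?_ ?_
    · rw [hΨq _ hx, hqu]
    · simp [w]
  have hnhds : ∀ᶠ p in 𝓝 ((0 : ℝ), x₀), p.2 ∈ V₀ ∧ w p ∈ Ψ.target := by
    refine ((continuousAt_snd (p := ((0 : ℝ), x₀))).eventually (hV₀.mem_nhds hs)).and
      ((hw (0, x₀) hs).continuousAt.eventually (Ψ.open_target.mem_nhds ?_))
    rw [hw0 x₀ hs]
    exact Ψ.map_source hs
  obtain ⟨A, hA, B, hB, hAB⟩ := mem_nhds_prod_iff.1 hnhds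
  obtain ⟨ε, hε, hεA⟩ := Metric.mem_nhds_iff.1 hA
  obtain ⟨V, hVB, hV, hxV⟩ := mem_nhds_iff.1 hB
  have hmem : ∀ p : ℝ × M, |p.1| < ε → p.2 ∈ V → p.2 ∈ V₀ ∧ w p ∈ Ψ.target := by
    intro p hp1 hp2
    exact hAB (show p ∈ A ×ˢ B from ⟨hεA (by simpa using hp1), hVB hp2⟩)
  have hVV₀ : ∀ x ∈ V, x ∈ V₀ := fun x hx => (hmem (0, x) (by simpa using hε) hx).1
  let k : ℝ × M → S := fun p => Ψ.invFun (w p)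
  have hΨk : ∀ p : ℝ × M, |p.1| < ε → p.2 ∈ V → Ψ (k p) = w p ∧ k p ∈ Ψ.source := fun p h1 h2 =>
    ⟨Ψ.right_inv (hmem p h1 h2).2, Ψ.map_target (hmem p h1 h2).2⟩
  have hqk : ∀ p : ℝ × M, |p.1| < ε → p.2 ∈ V → q (k p) = 𝒢.unit p.2 := by
    intro p h1 h2
    rw [← hΨq _ (hΨk p h1 h2).2, (hΨk p h1 h2).1]
  have hopen : IsOpen {p : ℝ × M | |p.1| < ε ∧ p.2 ∈ V} :=
    (isOpen_lt continuous_fst.abs continuous_const).inter (hV.preimage continuous_snd)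
  refine ⟨ε, V, k, hε, hV, hxV, fun p h1 h2 => ?_, fun x hx => ?_, fun x hx => ?_⟩
  · have hkp : ContMDiffAt (𝓘(ℝ, ℝ).prod (𝓡 n)) (𝓡 (2 * n + 1)) ∞ k p :=
      (Ψ.contMDiffOn_invFun.contMDiffAt (Ψ.open_target.mem_nhds (hmem p h1 h2).2)).comp p
        (hw p (hVV₀ _ h2))
    refine ⟨hkp, ?_, hqk p h1 h2⟩
    have e1 := hP.along_flowBox hΨ (hkp.mdifferentiableAt (by simp)) (hΨk p h1 h2).2
    have e2 : (fun y => (Ψ (k y)).2) =ᶠ[𝓝 p] fun y => (Ψ (𝒮.unit y.2)).2 + y.1 := by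
      filter_upwards [hopen.mem_nhds ⟨h1, h2⟩] with y hy
      rw [(hΨk y hy.1 hy.2).1]
    have e3 : q ∘ k =ᶠ[𝓝 p] (q ∘ 𝒮.unit) ∘ Prod.snd := by
      filter_upwards [hopen.mem_nhds ⟨h1, h2⟩] with y hy
      exact (hqk y hy.1 hy.2).trans (hqu _).symm
    have hqud : MDifferentiableAt (𝓡 n) (𝓡 (2 * n)) (q ∘ 𝒮.unit) p.2 :=
      (hP.smooth.comp hu).mdifferentiableAt (by simp)
    -- Since `θ` vanishes along the units, the differential of the fibre coordinate of the units
    -- cancels the pullback of `α`, and `dt` alone remains.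
    have e4 := hP.along_flowBox hΨ (hu.mdifferentiableAt (x := p.2) (by simp)) (hVV₀ _ h2)
    rw [hP.contact.lie.along_unit hP.contact.multiplicative] at e4
    have e5 : tangentMapCLM (𝓘(ℝ, ℝ).prod (𝓡 n)) 𝓘(ℝ, ℝ)
        (fun p : ℝ × M => (Ψ (𝒮.unit p.2)).2) p =
        (tangentMapCLM (𝓡 n) 𝓘(ℝ, ℝ) (fun x => (Ψ (𝒮.unit x)).2) p.2).comp
          (tangentMapCLM (𝓘(ℝ, ℝ).prod (𝓡 n)) (𝓡 n) Prod.snd p) :=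
      tangentMapCLM_comp ((hzu _ (hVV₀ _ h2)).mdifferentiableAt (by simp)) mdifferentiableAt_snd
    rw [e1, tangentMapCLM_congr e2, α.along_congr e3, α.along_comp hqud mdifferentiableAt_snd,
      tangentMapCLM_add ((hzu2 p (hVV₀ _ h2)).mdifferentiableAt (by simp)) mdifferentiableAt_fst,
      e5, add_right_comm, ← ContinuousLinearMap.add_comp, ← e4, ContinuousLinearMap.zero_comp,
      zero_add]
  · change Ψ.invFun (w (0, x)) = _
    rw [hw0 x (hVV₀ x hx)]
    exact Ψ.left_inv (hVV₀ x hx)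
  · have h1 : ContinuousAt (fun s => (Ψ s).2) (𝒮.unit x) :=
      continuousAt_snd.comp
        (Ψ.contMDiffOn.contMDiffAt (Ψ.open_source.mem_nhds (hVV₀ x hx))).continuousAt
    have h2 : ∀ᶠ s in 𝓝 (𝒮.unit x), |(Ψ s).2 - (Ψ (𝒮.unit x)).2| < ε := by
      have := Metric.tendsto_nhds.1 h1 ε hε
      simpa [Real.dist_eq] using this
    filter_upwards [h2, Ψ.open_source.mem_nhds (hVV₀ x hx)] with s hs1 hs2 hqs
    refine ⟨(Ψ s).2 - (Ψ (𝒮.unit x)).2, hs1, ?_⟩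
    have h3 : w ((Ψ s).2 - (Ψ (𝒮.unit x)).2, x) = Ψ s := by
      refine Prod.ext ?_ ?_
      · rw [hΨq s hs2, hqs]
      · simp [w]
    change Ψ.invFun (w _) = s
    rw [h3]
    exact Ψ.left_inv hs2

end IsPrequantization

/-! ### One-parameter groups in the fibres over units, and their centrality. -/

namespace IsPrequantization

variable {n : ℕ} {M Sig S : Type*}
    [TopologicalSpace M] [ChartedSpace (EuclideanSpace ℝ (Fin n)) M]
    [TopologicalSpace Sig] [ChartedSpace (EuclideanSpace ℝ (Fin (2 * n))) Sig]
    [TopologicalSpace S] [ChartedSpace (EuclideanSpace ℝ (Fin (2 * n + 1))) S]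
    {𝒢 : ArrowGroupoid Sig M} [ChartedSpace (EuclideanSpace ℝ (Fin (3 * n))) 𝒢.Pairs]
    {Ω : FormField (𝓡 (2 * n)) 2 Sig}
    {𝒮 : ArrowGroupoid S M} [ChartedSpace (EuclideanSpace ℝ (Fin (3 * n + 2))) 𝒮.Pairs]
    {θ : FormField (𝓡 (2 * n + 1)) 1 S} {q : S → Sig}
    (hP : IsPrequantization n 𝒢 Ω 𝒮 θ q)

include hP

theorem src_of_unit {s : S} {x : M} (h : q s = 𝒢.unit x) : 𝒮.src s = x := by
  rw [← hP.hom.map_src, h, 𝒢.src_unit]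

theorem tgt_of_unit {s : S} {x : M} (h : q s = 𝒢.unit x) : 𝒮.tgt s = x := by
  rw [← hP.hom.map_tgt, h, 𝒢.tgt_unit]

theorem comp_of_unit {s s' : S} {x : M} (h : q s = 𝒢.unit x) (h' : q s' = 𝒢.unit x) :
    𝒮.src s = 𝒮.tgt s' := by
  rw [hP.src_of_unit h, hP.tgt_of_unit h']

theorem tmul_of_unit {s s' : S} {x : M} (h : q s = 𝒢.unit x) (h' : q s' = 𝒢.unit x) :
    q (𝒮.tmul s s') = 𝒢.unit x := by
  rw [hP.hom.map_tmul (hP.comp_of_unit h h'), h, h', ArrowGroupoid.tmul_unit (𝒢.src_unit x)]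

theorem inv_of_unit {s : S} {x : M} (h : q s = 𝒢.unit x) : q (𝒮.inv s) = 𝒢.unit x := by
  have h1 := hP.hom.tmul_map_inv s
  rw [h, hP.tgt_of_unit h] at h1
  rwa [ArrowGroupoid.unit_tmul] at h1
  rw [hP.hom.map_tgt, 𝒮.tgt_inv, hP.src_of_unit h]

/-- The fibre of `q` over a unit is a group. -/
noncomputable abbrev fiberGroup (x : M) : Group (q ⁻¹' {𝒢.unit x} : Set S) :=
  { mul := fun s s' => ⟨𝒮.tmul s s', hP.tmul_of_unit s.2 s'.2⟩
    one := ⟨𝒮.unit x, hP.hom.map_unit x⟩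
    inv := fun s => ⟨𝒮.inv s, hP.inv_of_unit s.2⟩
    mul_assoc := fun a b c => Subtype.ext
      (ArrowGroupoid.tmul_assoc (hP.comp_of_unit a.2 b.2) (hP.comp_of_unit b.2 c.2))
    one_mul := fun a => Subtype.ext (ArrowGroupoid.unit_tmul (hP.tgt_of_unit a.2))
    mul_one := fun a => Subtype.ext (ArrowGroupoid.tmul_unit (hP.src_of_unit a.2))
    inv_mul_cancel := fun a => Subtype.ext
      ((ArrowGroupoid.inv_tmul (a : S)).trans (by rw [hP.src_of_unit a.2]; rfl)) }

/-- The fibre of `q` over a unit is a line parametrized by a one-parameter group whose orbits are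
Reeb curves. -/
theorem exists_one_parameter_group (x : M) :
    ∃ κ : ℝ → S, IsReebCurve θ q univ κ (𝒢.unit x) ∧ κ 0 = 𝒮.unit x ∧
      (∀ a b, κ (a + b) = 𝒮.tmul (κ a) (κ b)) ∧ Function.Injective κ ∧
      ∀ s, q s = 𝒢.unit x → ∃ t, κ t = s := by
  obtain ⟨ε, V, k, hε, -, hxV, hk, hk0, hkn⟩ := hP.exists_local_reeb x
  let B : Set ℝ := {t | |t| < ε}
  have hB : IsOpen B := isOpen_lt continuous_abs continuous_const
  have hBball : B = Metric.ball 0 ε := by ext t; simp [B]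
  let γ : ℝ → S := fun t => k (t, x)
  have hγ : IsReebCurve θ q B γ (𝒢.unit x) := by
    intro t ht
    obtain ⟨h1, h2, h3⟩ := hk (t, x) ht hxV
    have h4 : ContMDiffAt 𝓘(ℝ, ℝ) (𝓘(ℝ, ℝ).prod (𝓡 n)) ∞ (fun t : ℝ => (t, x)) t :=
      contMDiffAt_id.prodMk contMDiffAt_const
    refine ⟨h1.comp t h4, h3, ?_⟩
    have h5 := θ.along_comp (f := fun t : ℝ => (t, x)) (x := t) (h1.mdifferentiableAt (by simp))
      (h4.mdifferentiableAt (by simp))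
    change θ.along 𝓘(ℝ, ℝ) (k ∘ fun t => (t, x)) t 1 = 1
    rw [h5, h2, ← tangentMapCLM_comp mdifferentiableAt_fst (h4.mdifferentiableAt (by simp))]
    exact tangentMapCLM_real (hasDerivAt_id t)
  have hγ0 : γ 0 = 𝒮.unit x := hk0 x hxV
  -- As functions of the time, `γ (t + b)` and `γ t * γ b` are Reeb curves in the same fibre with
  -- the same value at `0`. They are compared on `J`, an intersection of two intervals containing
  -- both `0` and `a`.
  have hlocal : ∀ a b, |a| < ε → |b| < ε → |a + b| < ε → γ (a + b) = 𝒮.tmul (γ a) (γ b) := by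
    intro a b ha hb hab
    let J : Set ℝ := B ∩ (fun t => t + b) ⁻¹' B
    have hJ : IsOpen J := hB.inter (hB.preimage (continuous_add_const b))
    have hJc : IsPreconnected J := by
      refine Convex.isPreconnected (Convex.inter ?_ ?_)
      · rw [hBball]; exact convex_ball 0 ε
      · rw [hBball]
        have : (fun t => t + b) ⁻¹' Metric.ball 0 ε = Metric.ball (-b) ε := by
          ext t; simp [Real.dist_eq]
        rw [this]; exact convex_ball _ ε
    have h1 : IsReebCurve θ q J (fun t => γ (t + b)) (𝒢.unit x) :=
      (hγ.shift b).mono inter_subset_right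
    have hqb := (hγ b hb).2.1
    have h2 : IsReebCurve θ q J (fun t => 𝒮.tmul (γ t) (γ b)) (𝒢.unit x) := by
      have := (hγ.mono (inter_subset_left : J ⊆ B)).tmul_right hP hJ (s := γ b)
        (by rw [𝒢.src_unit, hP.tgt_of_unit hqb])
      rwa [hqb, ArrowGroupoid.tmul_unit (𝒢.src_unit x)] at this
    have h0J : (0 : ℝ) ∈ J := by
      refine ⟨by simpa [B] using hε, ?_⟩
      change |0 + b| < ε
      rwa [zero_add]
    refine h1.eqOn hP h2 hJ hJc h0J ?_ ⟨ha, hab⟩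
    rw [zero_add, hγ0, ArrowGroupoid.unit_tmul (hP.tgt_of_unit hqb)]
  let _ := hP.fiberGroup x
  let K : Set S := q ⁻¹' {𝒢.unit x}
  have hmul : ContinuousMul K := by
    refine ⟨?_⟩
    let p : K × K → 𝒮.Pairs := fun s => ⟨(s.1, s.2), hP.comp_of_unit s.1.2 s.2.2⟩
    have hp : Continuous p := by
      refine Continuous.subtype_mk ?_ _
      exact (continuous_subtype_val.comp continuous_fst).prodMk
        (continuous_subtype_val.comp continuous_snd)
    have h1 : Continuous fun s => 𝒮.mul (p s) := hP.contact.lie.smooth_mul.continuous.comp hp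
    refine Continuous.subtype_mk (h1.congr fun s => ?_) _
    exact (ArrowGroupoid.tmul_eq _).symm
  obtain ⟨φ⟩ := hP.line (𝒢.unit x)
  have : ConnectedSpace K := φ.symm.surjective.connectedSpace φ.symm.continuous
  have : NoncompactSpace K := by
    refine not_compactSpace_iff.1 fun h => ?_
    exact not_compactSpace_iff.2 (inferInstance : NoncompactSpace ℝ) φ.compactSpace
  -- The value `1` outside the interval is a default; the extension uses small times only.
  let γK : ℝ → K := fun t =>
    if h : |t| < ε then ⟨γ t, (hγ t h).2.1⟩ else 1
  have hγK : ∀ t, |t| < ε → (γK t : S) = γ t := by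
    intro t ht
    simp only [γK]
    rw [dif_pos ht]
  obtain ⟨κ, hκ, hκγ⟩ := exists_hom_of_local_hom (γ := γK) hε (by
    intro a b ha hb hab
    refine Subtype.ext ?_
    rw [hγK _ hab, hlocal a b ha hb hab]
    change _ = 𝒮.tmul (γK a) (γK b)
    rw [hγK _ ha, hγK _ hb])
  have hκγ' : ∀ t, |t| < ε → (κ t : S) = γ t := fun t ht => by rw [hκγ t ht, hγK t ht]
  have hmulS : ∀ a b, (κ (a + b) : S) = 𝒮.tmul (κ a) (κ b) := fun a b =>
    congrArg Subtype.val (hκ a b)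
  have h0ε : |(0 : ℝ)| < ε := by simpa using hε
  have hcont : ContinuousAt κ 0 := by
    rw [Topology.IsInducing.subtypeVal.continuousAt_iff]
    refine (hγ 0 h0ε).1.continuousAt.congr ?_
    filter_upwards [hB.mem_nhds h0ε] with t ht using (hκγ' t ht).symm
  -- All points of the fibre close to the unit already lie on the local Reeb curve.
  have hrange : range κ ∈ 𝓝 (1 : K) := by
    have h1 : ∀ᶠ s : K in 𝓝 1, q s = 𝒢.unit x → ∃ t, |t| < ε ∧ k (t, x) = s :=
      (continuousAt_subtype_val (x := (1 : K))).eventually (hkn x hxV)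
    filter_upwards [h1] with s hs
    obtain ⟨t, ht, hts⟩ := hs s.2
    exact ⟨t, Subtype.ext ((hκγ' t ht).trans hts)⟩
  have hbij := bijective_of_hom hκ hcont hrange
  refine ⟨fun t => κ t, ?_, (hκγ' 0 h0ε).trans hγ0, hmulS,
    Subtype.val_injective.comp hbij.1, fun s hs => ?_⟩
  · intro t₀ _
    -- Near `t₀` the group law gives `κ t = γ (t - t₀) * κ t₀`, a right translate of the local Reeb
    -- curve.
    have hsh := (hγ.shift (-t₀)).tmul_right hP (hB.preimage (continuous_add_const (-t₀)))
      (s := κ t₀) (by rw [𝒢.src_unit, hP.tgt_of_unit (κ t₀).2])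
    have hq0 : q (κ t₀) = 𝒢.unit x := (κ t₀).2
    rw [hq0, ArrowGroupoid.tmul_unit (𝒢.src_unit x)] at hsh
    refine hsh.congr (hB.preimage (continuous_add_const (-t₀))) (fun t ht => ?_) t₀ ?_
    · dsimp only
      rw [← hκγ' _ ht, ← hmulS]
      congr 2; ring
    · change |t₀ + -t₀| < ε
      simpa using hε
  · obtain ⟨t, ht⟩ := hbij.2 ⟨s, hs⟩
    exact ⟨t, congrArg Subtype.val ht⟩

/-- The one-parameter groups in the fibres of `q` over the units form a smooth central family. -/
theorem exists_central_family :
    ∃ κ : ℝ → M → S,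
      (∀ p : ℝ × M, ContMDiffAt (𝓘(ℝ, ℝ).prod (𝓡 n)) (𝓡 (2 * n + 1)) ∞
        (fun p : ℝ × M => κ p.1 p.2) p ∧
        θ.along (𝓘(ℝ, ℝ).prod (𝓡 n)) (fun p : ℝ × M => κ p.1 p.2) p =
          tangentMapCLM (𝓘(ℝ, ℝ).prod (𝓡 n)) 𝓘(ℝ, ℝ) Prod.fst p) ∧
      (∀ t x, q (κ t x) = 𝒢.unit x) ∧ (∀ x, κ 0 x = 𝒮.unit x) ∧
      (∀ a b x, κ (a + b) x = 𝒮.tmul (κ a x) (κ b x)) ∧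
      (∀ x, Function.Injective fun t => κ t x) ∧
      (∀ x s, q s = 𝒢.unit x → ∃ t, κ t x = s) ∧
      ∀ s t, 𝒮.tmul s (κ t (𝒮.src s)) = 𝒮.tmul (κ t (𝒮.tgt s)) s := by
  choose κ hR h0 hadd hinj hsurj using hP.exists_one_parameter_group
  have hqκ : ∀ t x, q (κ x t) = 𝒢.unit x := fun t x => (hR x t (mem_univ t)).2.1
  refine ⟨fun t x => κ x t, fun p₀ => ?_, hqκ, h0, fun a b x => hadd x a b, hinj, hsurj,
    fun s t => ?_⟩
  · obtain ⟨ε, V, k, hε, hV, hxV, hk, hk0, -⟩ := hP.exists_local_reeb p₀.2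
    have hopen : ∀ r : ℝ, IsOpen {p : ℝ × M | |p.1| < r ∧ p.2 ∈ V} := fun r =>
      (isOpen_lt continuous_fst.abs continuous_const).inter (hV.preimage continuous_snd)
    let B : Set ℝ := Metric.ball 0 ε
    have hkκ : ∀ p : ℝ × M, |p.1| < ε → p.2 ∈ V → k p = κ p.2 p.1 := by
      rintro ⟨t, x⟩ ht hx
      have h1 : IsReebCurve θ q B (fun t => k (t, x)) (𝒢.unit x) := by
        intro t ht
        obtain ⟨h1, h2, h3⟩ := hk (t, x) (by simpa [B] using ht) hx
        have h4 : ContMDiffAt 𝓘(ℝ, ℝ) (𝓘(ℝ, ℝ).prod (𝓡 n)) ∞ (fun t : ℝ => (t, x)) t :=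
          contMDiffAt_id.prodMk contMDiffAt_const
        refine ⟨h1.comp t h4, h3, ?_⟩
        have h5 := θ.along_comp (f := fun t : ℝ => (t, x)) (x := t)
          (h1.mdifferentiableAt (by simp)) (h4.mdifferentiableAt (by simp))
        change θ.along 𝓘(ℝ, ℝ) (k ∘ fun t => (t, x)) t 1 = 1
        rw [h5, h2, ← tangentMapCLM_comp mdifferentiableAt_fst (h4.mdifferentiableAt (by simp))]
        exact tangentMapCLM_real (hasDerivAt_id t)
      exact h1.eqOn hP ((hR x).mono (subset_univ B)) Metric.isOpen_ball
        (convex_ball 0 ε).isPreconnected (Metric.mem_ball_self hε)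
        ((hk0 x hx).trans (h0 x).symm) (by simpa [B] using ht)
    -- Doubling: `κ_t = κ_{t/2} κ_{t/2}` carries smoothness and the formula for `θ` from times below
    -- `2 ^ m * ε` to times below `2 ^ (m + 1) * ε`, over the same neighbourhood `V`.
    have key : ∀ m : ℕ, ∀ p : ℝ × M, |p.1| < 2 ^ m * ε → p.2 ∈ V →
        ContMDiffAt (𝓘(ℝ, ℝ).prod (𝓡 n)) (𝓡 (2 * n + 1)) ∞ (fun p : ℝ × M => κ p.2 p.1) p ∧
        θ.along (𝓘(ℝ, ℝ).prod (𝓡 n)) (fun p : ℝ × M => κ p.2 p.1) p =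
          tangentMapCLM (𝓘(ℝ, ℝ).prod (𝓡 n)) 𝓘(ℝ, ℝ) Prod.fst p := by
      intro m
      induction m with
      | zero =>
        intro p h1 h2
        rw [pow_zero, one_mul] at h1
        have he : (fun p : ℝ × M => κ p.2 p.1) =ᶠ[𝓝 p] k := by
          filter_upwards [(hopen ε).mem_nhds ⟨h1, h2⟩] with p' hp'
          exact (hkκ p' hp'.1 hp'.2).symm
        obtain ⟨h3, h4, -⟩ := hk p h1 h2
        exact ⟨h3.congr_of_eventuallyEq he, by rw [θ.along_congr he, h4]⟩
      | succ m ih =>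
        intro p h1 h2
        let f : ℝ × M → ℝ × M := fun p => ((1 / 2 : ℝ) * p.1, p.2)
        have hhalf : ContMDiff (𝓘(ℝ, ℝ).prod (𝓡 n)) 𝓘(ℝ, ℝ) ∞
            (fun p : ℝ × M => (1 / 2 : ℝ) * p.1) :=
          (contDiff_const.mul contDiff_id).contMDiff.comp contMDiff_fst
        have hf : ContMDiff (𝓘(ℝ, ℝ).prod (𝓡 n)) (𝓘(ℝ, ℝ).prod (𝓡 n)) ∞ f :=
          hhalf.prodMk contMDiff_snd
        obtain ⟨h3, h4⟩ := ih (f p) (by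
          change |1 / 2 * p.1| < _
          rw [abs_mul, abs_of_pos (by norm_num : (0 : ℝ) < 1 / 2)]
          rw [pow_succ] at h1
          linarith) h2
        have h5 : ContMDiffAt (𝓘(ℝ, ℝ).prod (𝓡 n)) (𝓡 (2 * n + 1)) ∞
            (fun p => κ (f p).2 (f p).1) p := h3.comp p hf.contMDiffAt
        have h6 : ∀ p : ℝ × M, κ p.2 p.1 = 𝒮.tmul (κ (f p).2 (f p).1) (κ (f p).2 (f p).1) := by
          intro p
          rw [← hadd]
          congr 1
          change p.1 = 1 / 2 * p.1 + 1 / 2 * p.1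
          ring
        have h6' : (fun p : ℝ × M => κ p.2 p.1) =
            fun p => 𝒮.tmul (κ (f p).2 (f p).1) (κ (f p).2 (f p).1) := funext h6
        have h7 : ∀ᶠ p in 𝓝 p, 𝒮.src (κ (f p).2 (f p).1) = 𝒮.tgt (κ (f p).2 (f p).1) :=
          Eventually.of_forall fun p => hP.comp_of_unit (hqκ _ _) (hqκ _ _)
        rw [h6']
        refine ⟨hP.contact.lie.contMDiffAt_tmul h5 h5 h7, ?_⟩
        rw [hP.contact.lie.along_tmul hP.contact.multiplicative h5 h5 h7]
        have h8 := θ.along_comp (h3.mdifferentiableAt (by simp))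
          (hf.mdifferentiableAt (x := p) (by simp))
        change θ.along (𝓘(ℝ, ℝ).prod (𝓡 n)) (fun p => κ (f p).2 (f p).1) p = _ at h8
        rw [h4, ← tangentMapCLM_comp mdifferentiableAt_fst (hf.mdifferentiableAt (by simp))] at h8
        have hd : MDifferentiableAt (𝓘(ℝ, ℝ).prod (𝓡 n)) 𝓘(ℝ, ℝ)
          (fun p : ℝ × M => (1 / 2 : ℝ) * p.1) p := hhalf.mdifferentiableAt (by simp)
        have h9 := tangentMapCLM_add hd hd
        rw [h8]
        refine h9.symm.trans (tangentMapCLM_congr (Eventually.of_forall fun p => ?_))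
        change 1 / 2 * p.1 + 1 / 2 * p.1 = p.1
        ring
    obtain ⟨m, hm⟩ := pow_unbounded_of_one_lt (|p₀.1| / ε) (by norm_num : (1 : ℝ) < 2)
    exact key m p₀ ((div_lt_iff₀ hε).1 hm) hxV
  -- Centrality: the left and the right translates are Reeb curves over `q s`, both starting at `s`.
  · have h1 : IsReebCurve θ q univ (fun t => 𝒮.tmul s (κ (𝒮.src s) t)) (q s) := by
      have := (hR (𝒮.src s)).tmul_left hP isOpen_univ (s := s) (𝒢.tgt_unit _).symm
      rwa [ArrowGroupoid.tmul_unit (hP.hom.map_src s)] at this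
    have h2 : IsReebCurve θ q univ (fun t => 𝒮.tmul (κ (𝒮.tgt s) t) s) (q s) := by
      have := (hR (𝒮.tgt s)).tmul_right hP isOpen_univ (s := s) (𝒢.src_unit _)
      rwa [ArrowGroupoid.unit_tmul (hP.hom.map_tgt s)] at this
    refine h1.eqOn hP h2 isOpen_univ isPreconnected_univ (mem_univ 0) ?_ (mem_univ t)
    rw [h0, h0, ArrowGroupoid.tmul_unit rfl, ArrowGroupoid.unit_tmul rfl]

end IsPrequantization

/-! ### Differentials on products, and the action of `ℝ` by the Reeb flow. -/

section Product

variable {E : Type*} [NormedAddCommGroup E] [NormedSpace ℝ E] {H : Type*} [TopologicalSpace H]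
  {I : ModelWithCorners ℝ E H} {X : Type*} [TopologicalSpace X] [ChartedSpace H X]
  {E' : Type*} [NormedAddCommGroup E'] [NormedSpace ℝ E'] {H' : Type*} [TopologicalSpace H']
  {I' : ModelWithCorners ℝ E' H'} {Y : Type*} [TopologicalSpace Y] [ChartedSpace H' Y]
  {E'' : Type*} [NormedAddCommGroup E''] [NormedSpace ℝ E''] {H'' : Type*} [TopologicalSpace H'']
  {I'' : ModelWithCorners ℝ E'' H''} {Z : Type*} [TopologicalSpace Z] [ChartedSpace H'' Z]

theorem tangentMapCLM_prodMk {f : X → Y} {g : X → Z} {x : X} (hf : MDifferentiableAt I I' f x)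
    (hg : MDifferentiableAt I I'' g x) :
    tangentMapCLM I (I'.prod I'') (fun x => (f x, g x)) x =
      (tangentMapCLM I I' f x).prod (tangentMapCLM I I'' g x) :=
  hf.mfderiv_prod hg

theorem tangentMapCLM_fst (p : X × Y) :
    tangentMapCLM (I.prod I') I Prod.fst p = ContinuousLinearMap.fst ℝ E E' :=
  mfderiv_fst

theorem tangentMapCLM_snd (p : X × Y) :
    tangentMapCLM (I.prod I') I' Prod.snd p = ContinuousLinearMap.snd ℝ E E' :=
  mfderiv_snd

end Product

/-- An action of the real numbers by the flow of the Reeb field of `θ`, whose orbits are the fibres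
of `q`, compatible with the multiplication. -/
structure IsReebAction {n : ℕ} {M Sig S : Type*} [TopologicalSpace S]
    [ChartedSpace (EuclideanSpace ℝ (Fin (2 * n + 1))) S] (𝒮 : ArrowGroupoid S M)
    (θ : FormField (𝓡 (2 * n + 1)) 1 S) (q : S → Sig) (A : ℝ → S → S) : Prop where
  smooth : ContMDiff (𝓘(ℝ, ℝ).prod (𝓡 (2 * n + 1))) (𝓡 (2 * n + 1)) ∞
    fun p : ℝ × S => A p.1 p.2
  along : ∀ p : ℝ × S, θ.along (𝓘(ℝ, ℝ).prod (𝓡 (2 * n + 1))) (fun p : ℝ × S => A p.1 p.2) p =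
    tangentMapCLM (𝓘(ℝ, ℝ).prod (𝓡 (2 * n + 1))) 𝓘(ℝ, ℝ) Prod.fst p +
      θ.along (𝓘(ℝ, ℝ).prod (𝓡 (2 * n + 1))) Prod.snd p
  proj : ∀ t s, q (A t s) = q s
  zero : ∀ s, A 0 s = s
  add : ∀ a b s, A (a + b) s = A a (A b s)
  injective : ∀ s, Function.Injective fun t => A t s
  transitive : ∀ s s', q s = q s' → ∃ t, A t s = s'
  tgt : ∀ t s, 𝒮.tgt (A t s) = 𝒮.tgt s
  tmul : ∀ a b s s', 𝒮.src s = 𝒮.tgt s' →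
    𝒮.tmul (A a s) (A b s') = A (a + b) (𝒮.tmul s s')

namespace IsReebAction

variable {n : ℕ} {M Sig S : Type*} [TopologicalSpace S]
  [ChartedSpace (EuclideanSpace ℝ (Fin (2 * n + 1))) S] {𝒮 : ArrowGroupoid S M}
  {θ : FormField (𝓡 (2 * n + 1)) 1 S} {q : S → Sig} {A : ℝ → S → S}
  (hA : IsReebAction 𝒮 θ q A)
  {E : Type*} [NormedAddCommGroup E] [NormedSpace ℝ E] {H : Type*} [TopologicalSpace H]
  {I : ModelWithCorners ℝ E H} {X : Type*} [TopologicalSpace X] [ChartedSpace H X]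

include hA

theorem contMDiffAt_comp {f : X → ℝ} {g : X → S} {x : X} (hf : ContMDiffAt I 𝓘(ℝ, ℝ) ∞ f x)
    (hg : ContMDiffAt I (𝓡 (2 * n + 1)) ∞ g x) :
    ContMDiffAt I (𝓡 (2 * n + 1)) ∞ (fun y => A (f y) (g y)) x :=
  hA.smooth.contMDiffAt.comp x (hf.prodMk hg)

/-- Moving a map along the flow by a variable time `f` adds exactly `df` to the pullback of `θ`.
This is the source of both `dc` and `dz`. -/
theorem along_comp {f : X → ℝ} {g : X → S} {x : X} (hf : MDifferentiableAt I 𝓘(ℝ, ℝ) f x)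
    (hg : MDifferentiableAt I (𝓡 (2 * n + 1)) g x) :
    θ.along I (fun y => A (f y) (g y)) x = tangentMapCLM I 𝓘(ℝ, ℝ) f x + θ.along I g x := by
  have hfg := hf.prodMk hg
  have h1 := θ.along_comp (f := fun x => (f x, g x))
    (hA.smooth.mdifferentiableAt (x := (f x, g x)) (by simp)) hfg
  have h2 := θ.along_comp (f := fun x => (f x, g x)) (g := Prod.snd) mdifferentiableAt_snd hfg
  have h3 := tangentMapCLM_comp (f := fun x => (f x, g x)) (g := Prod.fst)
    mdifferentiableAt_fst hfg
  rw [hA.along, ContinuousLinearMap.add_comp, ← h2, ← h3] at h1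
  exact h1

end IsReebAction

namespace IsPrequantization

variable {n : ℕ} {M Sig S : Type*}
    [TopologicalSpace M] [ChartedSpace (EuclideanSpace ℝ (Fin n)) M]
    [TopologicalSpace Sig] [ChartedSpace (EuclideanSpace ℝ (Fin (2 * n))) Sig]
    [TopologicalSpace S] [ChartedSpace (EuclideanSpace ℝ (Fin (2 * n + 1))) S]
    {𝒢 : ArrowGroupoid Sig M} [ChartedSpace (EuclideanSpace ℝ (Fin (3 * n))) 𝒢.Pairs]
    {Ω : FormField (𝓡 (2 * n)) 2 Sig}
    {𝒮 : ArrowGroupoid S M} [ChartedSpace (EuclideanSpace ℝ (Fin (3 * n + 2))) 𝒮.Pairs]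
    {θ : FormField (𝓡 (2 * n + 1)) 1 S} {q : S → Sig}
    (hP : IsPrequantization n 𝒢 Ω 𝒮 θ q)

include hP

/-- The time `t` acts by left multiplication with the central element over the target. Freeness is
right cancellation, transitivity holds because `s' s⁻¹` lies over a unit when `q s = q s'`, and
centrality moves the second factor across `s` in a product of translates. -/
theorem exists_reebAction : ∃ A : ℝ → S → S, IsReebAction 𝒮 θ q A := by
  obtain ⟨κ, hκ, hqκ, hκ0, hκadd, hκinj, hκsurj, hκcomm⟩ := hP.exists_central_family
  have hsκ : ∀ t x, 𝒮.src (κ t x) = x := fun t x => hP.src_of_unit (hqκ t x)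
  have htκ : ∀ t x, 𝒮.tgt (κ t x) = x := fun t x => hP.tgt_of_unit (hqκ t x)
  have hq : ∀ t s, q (𝒮.tmul (κ t (𝒮.tgt s)) s) = q s := fun t s => by
    rw [hP.hom.map_tmul (hsκ _ _), hqκ, ArrowGroupoid.unit_tmul (hP.hom.map_tgt s)]
  have htgt : ∀ t s, 𝒮.tgt (𝒮.tmul (κ t (𝒮.tgt s)) s) = 𝒮.tgt s := fun t s => by
    rw [ArrowGroupoid.tgt_tmul (hsκ _ _), htκ]
  have hadd : ∀ a b s, 𝒮.tmul (κ (a + b) (𝒮.tgt s)) s =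
      𝒮.tmul (κ a (𝒮.tgt s)) (𝒮.tmul (κ b (𝒮.tgt s)) s) := fun a b s => by
    rw [hκadd, ArrowGroupoid.tmul_assoc ((hsκ _ _).trans (htκ _ _).symm) (hsκ _ _)]
  have hp1 : ∀ p : ℝ × S, ContMDiffAt (𝓘(ℝ, ℝ).prod (𝓡 (2 * n + 1))) (𝓘(ℝ, ℝ).prod (𝓡 n)) ∞
      (fun p : ℝ × S => (p.1, 𝒮.tgt p.2)) p := fun p =>
    contMDiffAt_fst.prodMk (hP.contact.lie.smooth_tgt.contMDiffAt.comp p contMDiffAt_snd)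
  have hk : ∀ p : ℝ × S, ContMDiffAt (𝓘(ℝ, ℝ).prod (𝓡 (2 * n + 1))) (𝓡 (2 * n + 1)) ∞
      (fun p : ℝ × S => κ p.1 (𝒮.tgt p.2)) p := fun p =>
    (hκ (p.1, 𝒮.tgt p.2)).1.comp p (hp1 p)
  have hcomp : ∀ p : ℝ × S, ∀ᶠ p' in 𝓝 p, 𝒮.src (κ p'.1 (𝒮.tgt p'.2)) = 𝒮.tgt p'.2 := fun p =>
    Eventually.of_forall fun p' => hsκ _ _
  refine ⟨fun t s => 𝒮.tmul (κ t (𝒮.tgt s)) s, ⟨fun p => ?_, fun p => ?_, hq, fun s => ?_,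
    fun a b s => ?_, fun s a b h => ?_, fun s s' h => ?_, htgt, fun a b s s' h => ?_⟩⟩
  · exact hP.contact.lie.contMDiffAt_tmul (hk p) contMDiffAt_snd (hcomp p)
  · rw [hP.contact.lie.along_tmul hP.contact.multiplicative (hk p) contMDiffAt_snd (hcomp p)]
    congr 1
    have h1 := θ.along_comp (f := fun p : ℝ × S => (p.1, 𝒮.tgt p.2))
      ((hκ (p.1, 𝒮.tgt p.2)).1.mdifferentiableAt (by simp)) ((hp1 p).mdifferentiableAt (by simp))
    rw [(hκ _).2, ← tangentMapCLM_comp (f := fun p : ℝ × S => (p.1, 𝒮.tgt p.2))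
      mdifferentiableAt_fst ((hp1 p).mdifferentiableAt (by simp))] at h1
    exact h1
  · rw [hκ0, ArrowGroupoid.unit_tmul rfl]
  · rw [htgt, hadd]
  · exact hκinj _ (ArrowGroupoid.tmul_right_cancel (hsκ _ _) (hsκ _ _) h)
  · have hss : 𝒮.src s' = 𝒮.src s := by rw [← hP.hom.map_src, ← h, hP.hom.map_src]
    have e : 𝒮.src s' = 𝒮.tgt (𝒮.inv s) := by rw [𝒮.tgt_inv, hss]
    obtain ⟨t, ht⟩ := hκsurj (𝒮.tgt s) (𝒮.tmul s' (𝒮.inv s)) (by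
      rw [hP.hom.map_tmul e, ← h, hP.hom.tmul_map_inv])
    refine ⟨t, ?_⟩
    rw [ht, ArrowGroupoid.tmul_assoc e (𝒮.src_inv _), ArrowGroupoid.inv_tmul,
      ArrowGroupoid.tmul_unit hss]
  · have h1 : 𝒮.src s = 𝒮.tgt (𝒮.tmul (κ b (𝒮.tgt s')) s') := by rw [htgt, h]
    rw [ArrowGroupoid.tmul_assoc (hsκ _ _) h1,
      ← ArrowGroupoid.tmul_assoc (h.trans (htκ _ _).symm) (hsκ _ _), ← h, hκcomm,
      ArrowGroupoid.tmul_assoc (hsκ _ _) h, ArrowGroupoid.tgt_tmul h, hκadd,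
      ArrowGroupoid.tmul_assoc ((hsκ _ _).trans (htκ _ _).symm)
        ((hsκ _ _).trans (ArrowGroupoid.tgt_tmul h).symm)]

end IsPrequantization

/-! ### Smooth partitions of unity. -/

section PartitionOfUnity

variable {E : Type*} [NormedAddCommGroup E] [NormedSpace ℝ E] [FiniteDimensional ℝ E]
  {X : Type*} [TopologicalSpace X] [ChartedSpace E X] [IsManifold 𝓘(ℝ, E) ∞ X]

/-- A smooth function which is positive on a given open set with closure in a chart domain and
which vanishes elsewhere. -/
theorem exists_contMDiff_support_eq_of_closure_subset {x : X} {W : Set X} (hW : IsOpen W)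
    (hWx : closure W ⊆ (chartAt E x).source) :
    ∃ f : X → ℝ, ContMDiff 𝓘(ℝ, E) 𝓘(ℝ, ℝ) ∞ f ∧ Function.support f = W ∧ ∀ y, 0 ≤ f y := by
  classical
  have hWs : W ⊆ (chartAt E x).source := subset_closure.trans hWx
  obtain ⟨g, hg, hgs, hg0⟩ :=
    ((chartAt E x).isOpen_image_of_subset_source hW hWs).exists_contDiff_support_eq
  let f : X → ℝ := (chartAt E x).source.indicator (g ∘ chartAt E x)
  have hsupp : Function.support f = W := by
    ext y
    by_cases hy : y ∈ (chartAt E x).source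
    · have h1 : f y = g (chartAt E x y) := Set.indicator_of_mem hy _
      have h2 : chartAt E x y ∈ Function.support g ↔ y ∈ W := by
        rw [hg]
        exact (chartAt E x).injOn.mem_image_iff hWs hy
      rw [Function.mem_support, h1, ← Function.mem_support, h2]
    · have h1 : f y = 0 := Set.indicator_of_notMem hy _
      exact iff_of_false (by simp [h1]) fun h => hy (hWs h)
  refine ⟨f, contMDiff_of_tsupport fun y hy => ?_, hsupp, fun y => ?_⟩
  -- Extension by zero is smooth because the closed support stays inside the chart domain.
  · have hyx : y ∈ (chartAt E x).source := hWx (by rwa [tsupport, hsupp] at hy)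
    refine ContMDiffAt.congr_of_eventuallyEq (f := g ∘ chartAt E x)
      (hgs.contMDiff.contMDiffAt.comp y (contMDiffAt_chartAt' hyx)) ?_
    filter_upwards [(chartAt E x).open_source.mem_nhds hyx] with y' hy'
    exact Set.indicator_of_mem hy' _
  · exact Set.indicator_nonneg (fun y _ => hg0 ⟨_, rfl⟩ |>.1) y

/-- Smooth partitions of unity on paracompact manifolds. -/
theorem exists_smooth_partition [T2Space X] [ParacompactSpace X] (U : X → Set X)
    (hU : ∀ x, IsOpen (U x)) (hxU : ∀ x, x ∈ U x) :
    ∃ ρ : X → X → ℝ, (∀ x, ContMDiff 𝓘(ℝ, E) 𝓘(ℝ, ℝ) ∞ (ρ x)) ∧ (∀ x, tsupport (ρ x) ⊆ U x) ∧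
      LocallyFinite (fun x => Function.support (ρ x)) ∧ ∀ y, ∑ᶠ x, ρ x y = 1 := by
  -- The cover is refined to a locally finite one inside chart domains and then shrunk, so that
  -- closures stay inside. Shrinking uses normality, which holds for paracompact Hausdorff spaces.
  obtain ⟨v, hv, hvU, hvf, hvs⟩ := precise_refinement (fun x => U x ∩ (chartAt E x).source)
    (fun x => (hU x).inter (chartAt E x).open_source)
    (iUnion_eq_univ_iff.2 fun x => ⟨x, hxU x, mem_chart_source E x⟩)
  obtain ⟨w, hwU, hw, hwv⟩ := exists_iUnion_eq_closure_subset hv hvf.point_finite hvU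
  choose f hf hfs hf0 using fun x => exists_contMDiff_support_eq_of_closure_subset (E := E) (hw x)
    ((hwv x).trans ((hvs x).trans inter_subset_right))
  have hlf : LocallyFinite fun x => Function.support (f x) :=
    hvf.subset fun x => (hfs x).subset.trans (subset_closure.trans (hwv x))
  have hpos : ∀ y, ∑ᶠ x, f x y ≠ 0 := fun y => by
    obtain ⟨x, hx⟩ := iUnion_eq_univ_iff.1 hwU y
    have h1 : 0 < f x y := lt_of_le_of_ne (hf0 x y)
      (Ne.symm (by rw [← Function.mem_support, hfs x]; exact hx))
    exact (finsum_pos (fun x => hf0 x y) ⟨x, h1⟩ (hlf.point_finite y)).ne'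
  have hg : ContMDiff 𝓘(ℝ, E) 𝓘(ℝ, ℝ) ∞ fun y => ∑ᶠ x, f x y := contMDiff_finsum hf hlf
  have hsub : ∀ x, Function.support (fun y => f x y / ∑ᶠ x, f x y) ⊆ Function.support (f x) :=
    fun x y hy h => hy (by simp only [h, zero_div])
  refine ⟨fun x y => f x y / ∑ᶠ x, f x y, fun x => (hf x).div₀ hg hpos, fun x => ?_,
    hlf.subset hsub, fun y => ?_⟩
  · refine (closure_mono ((hsub x).trans (hfs x).subset)).trans ?_
    exact (hwv x).trans ((hvs x).trans inter_subset_left)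
  · simp only [div_eq_mul_inv]
    rw [← finsum_mul, mul_inv_cancel₀ (hpos y)]

end PartitionOfUnity

/-- A normalized trivialization of the quotient map: a smooth section `σ` and the time `z` needed to
reach a point from the section. -/
structure IsTrivialization (n : ℕ) {M Sig S : Type*} [TopologicalSpace S]
    [ChartedSpace (EuclideanSpace ℝ (Fin (2 * n + 1))) S] [TopologicalSpace Sig]
    [ChartedSpace (EuclideanSpace ℝ (Fin (2 * n))) Sig] (𝒢 : ArrowGroupoid Sig M)
    (𝒮 : ArrowGroupoid S M) (q : S → Sig) (A : ℝ → S → S) (z : S → ℝ) (σ : Sig → S) : Prop where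
  smooth_height : ContMDiff (𝓡 (2 * n + 1)) 𝓘(ℝ, ℝ) ∞ z
  smooth_section : ContMDiff (𝓡 (2 * n)) (𝓡 (2 * n + 1)) ∞ σ
  height_action : ∀ t s, z (A t s) = z s + t
  proj_section : ∀ γ, q (σ γ) = γ
  height_section : ∀ γ, z (σ γ) = 0
  action_section : ∀ s, A (z s) (σ (q s)) = s
  section_unit : ∀ x, σ (𝒢.unit x) = 𝒮.unit x

/-! ### Global height and section of the quotient map. -/

namespace IsPrequantization

variable {n : ℕ} {M Sig S : Type*}
    [TopologicalSpace M] [ChartedSpace (EuclideanSpace ℝ (Fin n)) M]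
    [TopologicalSpace Sig] [ChartedSpace (EuclideanSpace ℝ (Fin (2 * n))) Sig]
    [TopologicalSpace S] [ChartedSpace (EuclideanSpace ℝ (Fin (2 * n + 1))) S]
    {𝒢 : ArrowGroupoid Sig M} [ChartedSpace (EuclideanSpace ℝ (Fin (3 * n))) 𝒢.Pairs]
    {Ω : FormField (𝓡 (2 * n)) 2 Sig}
    {𝒮 : ArrowGroupoid S M} [ChartedSpace (EuclideanSpace ℝ (Fin (3 * n + 2))) 𝒮.Pairs]
    {θ : FormField (𝓡 (2 * n + 1)) 1 S} {q : S → Sig}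
    (hP : IsPrequantization n 𝒢 Ω 𝒮 θ q) {A : ℝ → S → S} (hA : IsReebAction 𝒮 θ q A)

include hP hA

/-- The time needed to reach a point from a local section of `q` is a smooth function. -/
theorem exists_local_height {U : Set Sig} (hU : IsOpen U) {σ : Sig → S}
    (hσ : ContMDiffOn (𝓡 (2 * n)) (𝓡 (2 * n + 1)) ∞ σ U) (hqσ : ∀ y ∈ U, q (σ y) = y) :
    ∃ z : S → ℝ, ContMDiffOn (𝓡 (2 * n + 1)) 𝓘(ℝ, ℝ) ∞ z (q ⁻¹' U) ∧
      ∀ s ∈ q ⁻¹' U, A (z s) (σ (q s)) = s := by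
  have := hP.isManifold_source
  have := hP.isManifold_target
  have hex : ∀ s, ∃ t, q s ∈ U → A t (σ (q s)) = s := fun s => by
    by_cases hs : q s ∈ U
    · obtain ⟨t, ht⟩ := hA.transitive (σ (q s)) s (hqσ _ hs)
      exact ⟨t, fun _ => ht⟩
    · exact ⟨0, fun h => absurd h hs⟩
  choose z hz using hex
  refine ⟨z, fun s hs => ContMDiffAt.contMDiffWithinAt ?_, hz⟩
  -- The height is the second component of the inverse of this map. It is inverted locally around
  -- the point over `s`, so `s` need not be close to the section.
  let F : Sig × ℝ → S := fun p => A p.2 (σ p.1)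
  let p₀ : Sig × ℝ := (q s, z s)
  have hFp₀ : F p₀ = s := hz s hs
  have hσ' : ∀ p : Sig × ℝ, p.1 ∈ U →
      ContMDiffAt ((𝓡 (2 * n)).prod 𝓘(ℝ, ℝ)) (𝓡 (2 * n + 1)) ∞ (fun p : Sig × ℝ => σ p.1) p :=
    fun p hp => (hσ.contMDiffAt (hU.mem_nhds hp)).comp p contMDiffAt_fst
  have hF : ContMDiffOn ((𝓡 (2 * n)).prod 𝓘(ℝ, ℝ)) (𝓡 (2 * n + 1)) ∞ F (U ×ˢ univ) :=
    fun p hp => (hA.contMDiffAt_comp contMDiffAt_snd (hσ' p hp.1)).contMDiffWithinAt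
  have hopen : IsOpen (U ×ˢ (univ : Set ℝ)) := hU.prod isOpen_univ
  have hp₀ : p₀ ∈ U ×ˢ (univ : Set ℝ) := ⟨hs, mem_univ _⟩
  have hbij : Function.Bijective (mfderiv ((𝓡 (2 * n)).prod 𝓘(ℝ, ℝ)) (𝓡 (2 * n + 1)) F p₀) := by
    let T : EuclideanSpace ℝ (Fin (2 * n)) × ℝ →ₗ[ℝ] EuclideanSpace ℝ (Fin (2 * n + 1)) :=
      (tangentMapCLM ((𝓡 (2 * n)).prod 𝓘(ℝ, ℝ)) (𝓡 (2 * n + 1)) F p₀).toLinearMap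
    -- From `q ∘ F = fst` a kernel vector has no base component; then `θ` evaluates on its image to
    -- the time component, which is therefore zero.
    have hT : Function.Injective T := by
      rw [injective_iff_map_eq_zero]
      intro w hw
      have hw' : tangentMapCLM ((𝓡 (2 * n)).prod 𝓘(ℝ, ℝ)) (𝓡 (2 * n + 1)) F p₀ w = 0 := hw
      have hFd := (hF.contMDiffAt (hopen.mem_nhds hp₀)).mdifferentiableAt (n := ∞) (by simp)
      have h1 := tangentMapCLM_comp (hP.smooth.mdifferentiableAt (by simp)) hFd
      have h2 : q ∘ F =ᶠ[𝓝 p₀] Prod.fst := by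
        filter_upwards [hopen.mem_nhds hp₀] with p hp
        exact (hA.proj _ _).trans (hqσ _ hp.1)
      rw [tangentMapCLM_congr h2, tangentMapCLM_fst] at h1
      have h3 : w.1 = 0 := by
        have := congrArg (fun L => L w) h1
        simpa [hw'] using this
      have h4 := hA.along_comp (I := (𝓡 (2 * n)).prod 𝓘(ℝ, ℝ)) (x := p₀) (f := Prod.snd)
        (g := fun p : Sig × ℝ => σ p.1) mdifferentiableAt_snd
        ((hσ' p₀ hs).mdifferentiableAt (by simp))
      have h5 := θ.along_comp (x := p₀) (f := Prod.fst) (g := σ)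
        ((hσ.contMDiffAt (hU.mem_nhds hs)).mdifferentiableAt (by simp))
        (mdifferentiableAt_fst (I := 𝓡 (2 * n)) (I' := 𝓘(ℝ, ℝ)))
      have h6 : θ.along ((𝓡 (2 * n)).prod 𝓘(ℝ, ℝ)) F p₀ w = 0 := by
        unfold FormField.along
        rw [ContinuousLinearMap.comp_apply, hw', map_zero]
      have h7 : θ.along ((𝓡 (2 * n)).prod 𝓘(ℝ, ℝ)) F p₀ = _ :=
        h4.trans (congrArg (_ + ·) h5)
      rw [h7, tangentMapCLM_fst, tangentMapCLM_snd] at h6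
      have h8 : w.2 = 0 := by simpa [h3] using h6
      exact Prod.ext h3 h8
    have hT' : Function.Bijective T :=
      ⟨hT, (LinearMap.injective_iff_surjective_of_finrank_eq_finrank (by simp)).1 hT⟩
    exact hT'
  obtain ⟨Φ, h1, h2, h3⟩ := isLocalDiffeomorphAt_of_mfderiv_bijective hopen hF hp₀ hbij
  have hst : s ∈ Φ.target := by
    rw [← hFp₀, h3 h1]
    exact Φ.map_source' h1
  have h4 : ContMDiffAt (𝓡 (2 * n + 1)) ((𝓡 (2 * n)).prod 𝓘(ℝ, ℝ)) ∞ Φ.invFun s :=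
    (Φ.contMDiffOn_invFun s hst).contMDiffAt (Φ.open_target.mem_nhds hst)
  refine (contMDiffAt_snd.comp s h4).congr_of_eventuallyEq ?_
  filter_upwards [Φ.open_target.mem_nhds hst] with s' hs'
  have h5 : Φ.invFun s' ∈ Φ.source := Φ.map_target' hs'
  have h6 : F (Φ.invFun s') = s' := (h3 h5).trans (Φ.right_inv' hs')
  have h7 : q s' = (Φ.invFun s').1 := by
    refine (congrArg q h6.symm).trans ?_
    exact (hA.proj _ _).trans (hqσ _ (h2 h5).1)
  have h8 : q s' ∈ U := h7 ▸ (h2 h5).1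
  -- Freeness of the action identifies the chosen time with the one given by the local inverse.
  refine hA.injective (σ (q s')) ((hz s' h8).trans ?_)
  rw [h7]
  exact h6.symm

/-- A global smooth function which increases with unit speed along the orbits. -/
theorem exists_height [T2Space Sig] [ParacompactSpace Sig] :
    ∃ z : S → ℝ, ContMDiff (𝓡 (2 * n + 1)) 𝓘(ℝ, ℝ) ∞ z ∧ (∀ t s, z (A t s) = z s + t) ∧
      ∀ x, z (𝒮.unit x) = 0 := by
  have := hP.isManifold_source
  have := hP.isManifold_target
  have hloc : ∀ γ : Sig, ∃ (U : Set Sig) (z : S → ℝ), IsOpen U ∧ γ ∈ U ∧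
      ContMDiffOn (𝓡 (2 * n + 1)) 𝓘(ℝ, ℝ) ∞ z (q ⁻¹' U) ∧
      ∀ t, ∀ s ∈ q ⁻¹' U, z (A t s) = z s + t := fun γ => by
    obtain ⟨s, rfl⟩ := hP.surjective γ
    obtain ⟨U, σ, hU, hsU, hσ, hqσ, -⟩ := hP.exists_section s
    obtain ⟨z, hz, hzA⟩ := hP.exists_local_height hA hU hσ hqσ
    refine ⟨U, z, hU, hsU, hz, fun t s' hs' => hA.injective (σ (q s')) ?_⟩
    have h1 := hzA (A t s') (by rwa [mem_preimage, hA.proj])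
    rw [hA.proj] at h1
    refine h1.trans ?_
    dsimp only
    rw [add_comm, hA.add, hzA s' hs']
  choose U z hU hxU hz hzA using hloc
  obtain ⟨ρ, hρ, hρU, hρf, hρ1⟩ := exists_smooth_partition
    (E := EuclideanSpace ℝ (Fin (2 * n))) U hU hxU
  have hsupp : ∀ γ, Function.support (fun s => ρ γ (q s) * z γ s) ⊆
      q ⁻¹' Function.support (ρ γ) := fun γ s hs h => hs (by simp only [h, zero_mul])
  have hqf : LocallyFinite fun γ => q ⁻¹' Function.support (ρ γ) :=
    hρf.preimage_continuous hP.smooth.continuous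
  have hlf := hqf.subset hsupp
  have hw : ContMDiff (𝓡 (2 * n + 1)) 𝓘(ℝ, ℝ) ∞ fun s => ∑ᶠ γ, ρ γ (q s) * z γ s := by
    refine contMDiff_finsum (fun γ => contMDiff_of_tsupport fun s hs => ?_) hlf
    have h1 : q s ∈ tsupport (ρ γ) := closure_minimal
      ((hsupp γ).trans (preimage_mono subset_closure))
      ((isClosed_tsupport _).preimage hP.smooth.continuous) hs
    exact (((hρ γ).comp hP.smooth).contMDiffAt).mul
      ((hz γ).contMDiffAt (((hU γ).preimage hP.smooth.continuous).mem_nhds (hρU γ h1)))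
  -- The weights are constant along orbits and sum to one, so the average still increases with unit
  -- speed.
  have hwA : ∀ t s, ∑ᶠ γ, ρ γ (q (A t s)) * z γ (A t s) = (∑ᶠ γ, ρ γ (q s) * z γ s) + t := by
    intro t s
    have h1 : ∀ γ, ρ γ (q (A t s)) * z γ (A t s) = ρ γ (q s) * z γ s + ρ γ (q s) * t := fun γ => by
      rw [hA.proj]
      by_cases h : ρ γ (q s) = 0
      · rw [h, zero_mul, zero_mul, zero_mul, add_zero]
      · rw [hzA γ t s (hρU γ (subset_closure h)), mul_add]
    rw [finsum_congr h1, finsum_add_distrib (hlf.point_finite s)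
      ((hρf.point_finite (q s)).subset fun γ h h0 => h (by simp only [h0, zero_mul])),
      ← finsum_mul, hρ1, one_mul]
  have hu : ContMDiff (𝓡 (2 * n + 1)) (𝓡 (2 * n + 1)) ∞ fun s => 𝒮.unit (𝒮.tgt s) :=
    hP.contact.lie.smooth_unit.comp hP.contact.lie.smooth_tgt
  -- The correction depends only on the target, which the action preserves; it makes the height
  -- vanish at units without changing its speed.
  refine ⟨fun s => (∑ᶠ γ, ρ γ (q s) * z γ s) -
    ∑ᶠ γ, ρ γ (q (𝒮.unit (𝒮.tgt s))) * z γ (𝒮.unit (𝒮.tgt s)), hw.sub (hw.comp hu),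
    fun t s => ?_, fun x => ?_⟩
  · dsimp only
    rw [hwA, hA.tgt]
    ring
  · dsimp only
    rw [𝒮.tgt_unit, sub_self]

/-- The quotient map is a trivial principal bundle. -/
theorem exists_trivialization [T2Space Sig] [ParacompactSpace Sig] :
    ∃ (z : S → ℝ) (σ : Sig → S), IsTrivialization n 𝒢 𝒮 q A z σ := by
  obtain ⟨z, hz, hzA, hzu⟩ := hP.exists_height hA
  -- Each fibre has a single point of height zero, reached from any `s` in time `-z s`; this point
  -- is the value of the section.
  have hk : ∀ s s', q s = q s' → A (-z s) s = A (-z s') s' := fun s s' h => by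
    obtain ⟨t, rfl⟩ := hA.transitive s s' h
    rw [hzA, ← hA.add]
    congr 1
    ring
  let σ : Sig → S := fun γ => A (-z (Function.surjInv hP.surjective γ))
    (Function.surjInv hP.surjective γ)
  have hσ : ∀ s, σ (q s) = A (-z s) s := fun s => hk _ _ (Function.surjInv_eq hP.surjective _)
  refine ⟨z, σ, hz, fun γ => ?_, hzA, fun γ => ?_, fun γ => ?_, fun s => ?_, fun x => ?_⟩
  · obtain ⟨s, rfl⟩ := hP.surjective γ
    obtain ⟨U, τ, hU, hsU, hτ, hqτ, -⟩ := hP.exists_section s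
    have hτs := hτ.contMDiffAt (hU.mem_nhds hsU)
    -- Near each point, `σ` is a smooth local section moved down to height zero.
    refine (hA.contMDiffAt_comp (hz.contMDiffAt.comp (q s) hτs).neg hτs).congr_of_eventuallyEq ?_
    filter_upwards [hU.mem_nhds hsU] with y hy
    have h1 := hσ (τ y)
    rwa [hqτ y hy] at h1
  · rw [hA.proj]
    exact Function.surjInv_eq hP.surjective γ
  · rw [hzA, add_neg_cancel]
  · rw [hσ, ← hA.add, add_neg_cancel, hA.zero]
  · rw [← hP.hom.map_unit, hσ, hzu, neg_zero, hA.zero]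

end IsPrequantization

/-! ### Immersions, and the differential of a normalized function at pairs of units. -/

section Immersion

variable {E : Type*} [NormedAddCommGroup E] [NormedSpace ℝ E] {H : Type*} [TopologicalSpace H]
  {I : ModelWithCorners ℝ E H} [I.Boundaryless] {X : Type*} [TopologicalSpace X] [ChartedSpace H X]
  {E' : Type*} [NormedAddCommGroup E'] [NormedSpace ℝ E'] {H' : Type*} [TopologicalSpace H']
  {I' : ModelWithCorners ℝ E' H'} {Y : Type*} [TopologicalSpace Y] [ChartedSpace H' Y]

/-- The differential of an immersion is injective. -/
theorem injective_tangentMapCLM_of_isImmersionAt {f : X → Y} {x : X}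
    (h : IsImmersionAt I I' ∞ f x) : Function.Injective (tangentMapCLM I I' f x) := by
  let φ := h.domChart.extend I
  -- In adapted charts an immersion is the inclusion of a factor, and the projection `L` to that
  -- factor gives a local smooth left inverse `r`.
  let L : E' → E := fun v => (h.equiv.symm v).1
  let r : Y → X := fun y => φ.symm (L (h.codChart.extend I' y))
  have hx : x ∈ φ.source := by
    rw [h.domChart.extend_source]
    exact h.mem_domChart_source
  have hr : ∀ x' ∈ h.domChart.source, L (h.codChart.extend I' (f x')) = φ x' := fun x' hx' => by
    have hx'' : x' ∈ φ.source := by rwa [h.domChart.extend_source]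
    have h1 := h.writtenInCharts (φ.map_source hx'')
    simp only [Function.comp_apply] at h1
    have h2 : (h.domChart.extend I).symm (φ x') = x' := φ.left_inv hx''
    rw [h2] at h1
    simp only [L, h1, ContinuousLinearEquiv.symm_apply_apply]
  have hrf : r ∘ f =ᶠ[𝓝 x] id := by
    filter_upwards [h.domChart.open_source.mem_nhds h.mem_domChart_source] with x' hx'
    have hx'' : x' ∈ φ.source := by rwa [h.domChart.extend_source]
    exact (congrArg φ.symm (hr x' hx')).trans (φ.left_inv hx'')
  have hL : ContMDiff 𝓘(ℝ, E') 𝓘(ℝ, E) ∞ L :=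
    (contDiff_fst.comp h.equiv.symm.contDiff).contMDiff
  have hcod : ContMDiffAt I' 𝓘(ℝ, E') ∞ (h.codChart.extend I') (f x) :=
    h.codChart.contMDiffAt_extend h.codChart_mem_maximalAtlas h.mem_codChart_source
  have hdom : ContMDiffAt 𝓘(ℝ, E) I ∞ φ.symm (φ x) :=
    (contMDiffOn_extend_symm h.domChart_mem_maximalAtlas).contMDiffAt
      ((I.toHomeomorph.isOpenMap _ h.domChart.open_target).mem_nhds
        ⟨h.domChart x, h.domChart.map_source h.mem_domChart_source, rfl⟩)
  have hrd : ContMDiffAt I' I ∞ r (f x) := by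
    refine ContMDiffAt.comp_of_eq hdom (hL.contMDiffAt.comp (f x) hcod) ?_
    exact hr x h.mem_domChart_source
  have h1 := tangentMapCLM_comp (hrd.mdifferentiableAt (by simp))
    (h.contMDiffAt.mdifferentiableAt (by simp))
  rw [tangentMapCLM_congr hrf, tangentMapCLM_id] at h1
  refine Function.LeftInverse.injective (g := tangentMapCLM I' I r (f x)) fun v => ?_
  exact (congrArg (fun T => T v) h1).symm

end Immersion

namespace ArrowGroupoid

variable {G M : Type*} {a b e : ℕ} [TopologicalSpace G] [ChartedSpace (EuclideanSpace ℝ (Fin a)) G]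
  [TopologicalSpace M] [ChartedSpace (EuclideanSpace ℝ (Fin b)) M] {𝒢 : ArrowGroupoid G M}
  [ChartedSpace (EuclideanSpace ℝ (Fin e)) 𝒢.Pairs]

/-- A function on composable pairs which vanishes when one of the arrows is a unit has zero
differential at pairs of units. -/
theorem IsLie.tangentMapCLM_unitPair_eq_zero (h𝒢 : 𝒢.IsLie a b e) {c : 𝒢.Pairs → ℝ}
    (hc : ContMDiff (𝓡 e) 𝓘(ℝ, ℝ) ∞ c) (hl : ∀ p : 𝒢.Pairs, p.1.1 ∈ range 𝒢.unit → c p = 0)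
    (hr : ∀ p : 𝒢.Pairs, p.1.2 ∈ range 𝒢.unit → c p = 0) (x : M) :
    tangentMapCLM (𝓡 e) 𝓘(ℝ, ℝ) c (𝒢.unitPair x) = 0 := by
  have := h𝒢.pairs_manifold
  have := h𝒢.arrows_manifold
  have hsrc := h𝒢.smooth_src
  have htgt := h𝒢.smooth_tgt
  have hu := h𝒢.smooth_unit
  have hd : (∞ : WithTop ℕ∞) ≠ 0 := by simp
  -- The maps `p₁`, `p₂`, `p₀` are `g ↦ (g, 1)`, `g ↦ (1, g)` and `x ↦ (1, 1)`. The function `c`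
  -- vanishes along each of them.
  obtain ⟨p₁, hp₁, he₁⟩ := h𝒢.exists_lift (x := 𝒢.unit x) contMDiffAt_id (hu.comp hsrc).contMDiffAt
    (Eventually.of_forall fun y => (𝒢.tgt_unit _).symm)
  obtain ⟨p₂, hp₂, he₂⟩ := h𝒢.exists_lift (x := 𝒢.unit x) (hu.comp htgt).contMDiffAt contMDiffAt_id
    (Eventually.of_forall fun y => 𝒢.src_unit _)
  obtain ⟨p₀, hp₀, he₀⟩ := h𝒢.exists_lift (x := x) hu.contMDiffAt hu.contMDiffAt
    (Eventually.of_forall fun y => (𝒢.src_unit y).trans (𝒢.tgt_unit y).symm)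
  have hx₁ : p₁ (𝒢.unit x) = 𝒢.unitPair x := Subtype.ext (he₁.self_of_nhds.1.trans (by
    simp only [id_eq, Function.comp_apply, 𝒢.src_unit]; rfl))
  have hx₂ : p₂ (𝒢.unit x) = 𝒢.unitPair x := Subtype.ext (he₂.self_of_nhds.1.trans (by
    simp only [id_eq, Function.comp_apply, 𝒢.tgt_unit]; rfl))
  have hx₀ : p₀ x = 𝒢.unitPair x := Subtype.ext he₀.self_of_nhds.1
  let V : 𝒢.Pairs → G × G := Subtype.val
  have hV : ∀ p, MDifferentiableAt (𝓡 e) ((𝓡 a).prod (𝓡 a)) V p := fun p =>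
    h𝒢.pairs_embedding.contMDiff.mdifferentiableAt hd
  let S₀ := tangentMapCLM (𝓡 a) (𝓡 b) 𝒢.src (𝒢.unit x)
  let T₀ := tangentMapCLM (𝓡 a) (𝓡 b) 𝒢.tgt (𝒢.unit x)
  let U₀ := tangentMapCLM (𝓡 b) (𝓡 a) 𝒢.unit x
  have hUS : tangentMapCLM (𝓡 a) (𝓡 a) (𝒢.unit ∘ 𝒢.src) (𝒢.unit x) = U₀.comp S₀ := by
    rw [tangentMapCLM_comp (hu.mdifferentiableAt hd) (hsrc.mdifferentiableAt hd), 𝒢.src_unit]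
  have hUT : tangentMapCLM (𝓡 a) (𝓡 a) (𝒢.unit ∘ 𝒢.tgt) (𝒢.unit x) = U₀.comp T₀ := by
    rw [tangentMapCLM_comp (hu.mdifferentiableAt hd) (htgt.mdifferentiableAt hd), 𝒢.tgt_unit]
  have hV₁ : (tangentMapCLM (𝓡 e) ((𝓡 a).prod (𝓡 a)) V (𝒢.unitPair x)).comp
      (tangentMapCLM (𝓡 a) (𝓡 e) p₁ (𝒢.unit x)) =
      (ContinuousLinearMap.id ℝ _).prod (U₀.comp S₀) := by
    rw [← hx₁, ← tangentMapCLM_comp (hV _) (hp₁.mdifferentiableAt hd), ← hUS,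
      ← tangentMapCLM_id (I := 𝓡 a) (𝒢.unit x),
      ← tangentMapCLM_prodMk mdifferentiableAt_id ((hu.comp hsrc).mdifferentiableAt hd)]
    exact tangentMapCLM_congr (he₁.mono fun y hy => hy.1)
  have hV₂ : (tangentMapCLM (𝓡 e) ((𝓡 a).prod (𝓡 a)) V (𝒢.unitPair x)).comp
      (tangentMapCLM (𝓡 a) (𝓡 e) p₂ (𝒢.unit x)) =
      (U₀.comp T₀).prod (ContinuousLinearMap.id ℝ _) := by
    rw [← hx₂, ← tangentMapCLM_comp (hV _) (hp₂.mdifferentiableAt hd), ← hUT,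
      ← tangentMapCLM_id (I := 𝓡 a) (𝒢.unit x),
      ← tangentMapCLM_prodMk ((hu.comp htgt).mdifferentiableAt hd) mdifferentiableAt_id]
    exact tangentMapCLM_congr (he₂.mono fun y hy => hy.1)
  have hV₀ : (tangentMapCLM (𝓡 e) ((𝓡 a).prod (𝓡 a)) V (𝒢.unitPair x)).comp
      (tangentMapCLM (𝓡 b) (𝓡 e) p₀ x) = U₀.prod U₀ := by
    rw [← hx₀, ← tangentMapCLM_comp (hV _) (hp₀.mdifferentiableAt hd),
      ← tangentMapCLM_prodMk (hu.mdifferentiableAt hd) (hu.mdifferentiableAt hd)]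
    exact tangentMapCLM_congr (he₀.mono fun y hy => hy.1)
  have hc₁ : (tangentMapCLM (𝓡 e) 𝓘(ℝ, ℝ) c (𝒢.unitPair x)).comp
      (tangentMapCLM (𝓡 a) (𝓡 e) p₁ (𝒢.unit x)) = 0 := by
    rw [← hx₁, ← tangentMapCLM_comp (hc.mdifferentiableAt hd) (hp₁.mdifferentiableAt hd),
      ← tangentMapCLM_const (I := 𝓡 a) (I' := 𝓘(ℝ, ℝ)) (0 : ℝ) (𝒢.unit x)]
    exact tangentMapCLM_congr (he₁.mono fun y hy => hr _ (by rw [hy.1]; exact mem_range_self _))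
  have hc₂ : (tangentMapCLM (𝓡 e) 𝓘(ℝ, ℝ) c (𝒢.unitPair x)).comp
      (tangentMapCLM (𝓡 a) (𝓡 e) p₂ (𝒢.unit x)) = 0 := by
    rw [← hx₂, ← tangentMapCLM_comp (hc.mdifferentiableAt hd) (hp₂.mdifferentiableAt hd),
      ← tangentMapCLM_const (I := 𝓡 a) (I' := 𝓘(ℝ, ℝ)) (0 : ℝ) (𝒢.unit x)]
    exact tangentMapCLM_congr (he₂.mono fun y hy => hl _ (by rw [hy.1]; exact mem_range_self _))
  have hc₀ : (tangentMapCLM (𝓡 e) 𝓘(ℝ, ℝ) c (𝒢.unitPair x)).comp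
      (tangentMapCLM (𝓡 b) (𝓡 e) p₀ x) = 0 := by
    rw [← hx₀, ← tangentMapCLM_comp (hc.mdifferentiableAt hd) (hp₀.mdifferentiableAt hd),
      ← tangentMapCLM_const (I := 𝓡 b) (I' := 𝓘(ℝ, ℝ)) (0 : ℝ) x]
    exact tangentMapCLM_congr (he₀.mono fun y hy => hl _ (by rw [hy.1]; exact mem_range_self _))
  let D₁ := tangentMapCLM (𝓡 e) (𝓡 a) 𝒢.pr₁ (𝒢.unitPair x)
  let D₂ := tangentMapCLM (𝓡 e) (𝓡 a) 𝒢.pr₂ (𝒢.unitPair x)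
  have hVD : tangentMapCLM (𝓡 e) ((𝓡 a).prod (𝓡 a)) V (𝒢.unitPair x) = D₁.prod D₂ :=
    tangentMapCLM_prodMk (h𝒢.contMDiff_pr₁.mdifferentiableAt hd)
      (h𝒢.contMDiff_pr₂.mdifferentiableAt hd)
  have hST : S₀.comp D₁ = T₀.comp D₂ := by
    have h1 := tangentMapCLM_comp (x := 𝒢.unitPair x) (hsrc.mdifferentiableAt hd)
      (h𝒢.contMDiff_pr₁.mdifferentiableAt hd)
    have h2 := tangentMapCLM_comp (x := 𝒢.unitPair x) (htgt.mdifferentiableAt hd)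
      (h𝒢.contMDiff_pr₂.mdifferentiableAt hd)
    have h3 : 𝒢.src ∘ 𝒢.pr₁ = 𝒢.tgt ∘ 𝒢.pr₂ := funext fun p => p.2
    rw [h3] at h1
    exact h1.symm.trans h2
  ext v
  -- The first two terms have components `D₁ v + U₀ T₀ D₂ v` and `U₀ S₀ D₁ v + D₂ v`. Composability
  -- gives `S₀ D₁ = T₀ D₂`, so both excesses equal `U₀ S₀ D₁ v`, which the diagonal term removes.
  have hv : v = tangentMapCLM (𝓡 a) (𝓡 e) p₁ (𝒢.unit x) (D₁ v) +
      tangentMapCLM (𝓡 a) (𝓡 e) p₂ (𝒢.unit x) (D₂ v) -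
      tangentMapCLM (𝓡 b) (𝓡 e) p₀ x (S₀ (D₁ v)) := by
    refine injective_tangentMapCLM_of_isImmersionAt
      (h𝒢.pairs_embedding.isImmersion.isImmersionAt (𝒢.unitPair x)) ?_
    have e₀ := congrArg (fun T => T (S₀ (D₁ v))) hV₀
    have e₁ := congrArg (fun T => T (D₁ v)) hV₁
    have e₂ := congrArg (fun T => T (D₂ v)) hV₂
    have e₃ := congrArg (fun T => T v) hST
    have e₄ := congrArg (fun T => T v) hVD
    simp only [ContinuousLinearMap.comp_apply, ContinuousLinearMap.prod_apply,
      ContinuousLinearMap.id_apply] at e₀ e₁ e₂ e₃ e₄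
    rw [map_sub, map_add, e₀, e₁, e₂, e₄, ← e₃]
    simp
  rw [hv, map_sub, map_add]
  have e₀ := congrArg (fun T => T (S₀ (D₁ v))) hc₀
  have e₁ := congrArg (fun T => T (D₁ v)) hc₁
  have e₂ := congrArg (fun T => T (D₂ v)) hc₂
  simp only [ContinuousLinearMap.comp_apply, zero_apply] at e₀ e₁ e₂
  rw [e₀, e₁, e₂]
  simp

end ArrowGroupoid

theorem FormField.along_pullback {E E' E'' : Type*} [NormedAddCommGroup E] [NormedSpace ℝ E]
    [NormedAddCommGroup E'] [NormedSpace ℝ E'] [NormedAddCommGroup E''] [NormedSpace ℝ E'']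
    {H H' H'' : Type*} [TopologicalSpace H] [TopologicalSpace H'] [TopologicalSpace H'']
    {I : ModelWithCorners ℝ E H} {I' : ModelWithCorners ℝ E' H'} {I'' : ModelWithCorners ℝ E'' H''}
    {X Y Z : Type*} [TopologicalSpace X] [ChartedSpace H X] [TopologicalSpace Y]
    [ChartedSpace H' Y] [TopologicalSpace Z] [ChartedSpace H'' Z]
    (α : FormField I'' 1 Z) {f : X → Y} {g : Y → Z} {x : X}
    (hg : MDifferentiableAt I' I'' g (f x)) (hf : MDifferentiableAt I I' f x) :
    (FormField.pullback I' I'' g α).along I f x = α.along I (g ∘ f) x :=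
  (α.along_comp hg hf).symm

/-! ### The cocycle, the form on the base and the isomorphism. -/

namespace IsPrequantization

variable {n : ℕ} {M Sig S : Type*}
    [TopologicalSpace M] [ChartedSpace (EuclideanSpace ℝ (Fin n)) M]
    [TopologicalSpace Sig] [ChartedSpace (EuclideanSpace ℝ (Fin (2 * n))) Sig]
    [TopologicalSpace S] [ChartedSpace (EuclideanSpace ℝ (Fin (2 * n + 1))) S]
    {𝒢 : ArrowGroupoid Sig M} [ChartedSpace (EuclideanSpace ℝ (Fin (3 * n))) 𝒢.Pairs]
    {Ω : FormField (𝓡 (2 * n)) 2 Sig}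
    {𝒮 : ArrowGroupoid S M} [ChartedSpace (EuclideanSpace ℝ (Fin (3 * n + 2))) 𝒮.Pairs]
    {θ : FormField (𝓡 (2 * n + 1)) 1 S} {q : S → Sig}
    (hP : IsPrequantization n 𝒢 Ω 𝒮 θ q) {A : ℝ → S → S} (hA : IsReebAction 𝒮 θ q A)
    {z : S → ℝ} {σ : Sig → S} (hT : IsTrivialization n 𝒢 𝒮 q A z σ)

section Section

include hP hT

theorem src_section (γ : Sig) : 𝒮.src (σ γ) = 𝒢.src γ := by
  rw [← hP.hom.map_src, hT.proj_section]

theorem tgt_section (γ : Sig) : 𝒮.tgt (σ γ) = 𝒢.tgt γ := by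
  rw [← hP.hom.map_tgt, hT.proj_section]

theorem comp_section {g h : Sig} (e : 𝒢.src g = 𝒢.tgt h) : 𝒮.src (σ g) = 𝒮.tgt (σ h) := by
  rw [hP.src_section hT, hP.tgt_section hT, e]

/-- The section is multiplicative up to the action. -/
theorem tmul_section {g h : Sig} (e : 𝒢.src g = 𝒢.tgt h) :
    𝒮.tmul (σ g) (σ h) = A (z (𝒮.tmul (σ g) (σ h))) (σ (𝒢.tmul g h)) := by
  have h1 := hT.action_section (𝒮.tmul (σ g) (σ h))
  rw [hP.hom.map_tmul (hP.comp_section hT e), hT.proj_section, hT.proj_section] at h1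
  exact h1.symm

/-- The section preserves units, so the product is `σ h`, of height zero. This normalization is what
makes the cocycle and its differential vanish at pairs of units. -/
theorem height_tmul_unit_left {g h : Sig} (e : 𝒢.src g = 𝒢.tgt h) (hg : g ∈ range 𝒢.unit) :
    z (𝒮.tmul (σ g) (σ h)) = 0 := by
  obtain ⟨x, rfl⟩ := hg
  rw [𝒢.src_unit] at e
  rw [hT.section_unit, ArrowGroupoid.unit_tmul ((hP.tgt_section hT h).trans e.symm),
    hT.height_section]

theorem height_tmul_unit_right {g h : Sig} (e : 𝒢.src g = 𝒢.tgt h) (hh : h ∈ range 𝒢.unit) :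
    z (𝒮.tmul (σ g) (σ h)) = 0 := by
  obtain ⟨x, rfl⟩ := hh
  rw [𝒢.tgt_unit] at e
  rw [hT.section_unit, ArrowGroupoid.tmul_unit ((hP.src_section hT g).trans e),
    hT.height_section]

theorem contMDiff_cocycle : ContMDiff (𝓡 (3 * n)) 𝓘(ℝ, ℝ) ∞
    fun p : 𝒢.Pairs => z (𝒮.tmul (σ (𝒢.pr₁ p)) (σ (𝒢.pr₂ p))) := fun p =>
  hT.smooth_height.contMDiffAt.comp p (hP.contact.lie.contMDiffAt_tmul
    (hT.smooth_section.comp hP.symplectic.lie.contMDiff_pr₁).contMDiffAt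
    (hT.smooth_section.comp hP.symplectic.lie.contMDiff_pr₂).contMDiffAt
    (Eventually.of_forall fun p => hP.comp_section hT p.2))

/-- Since `q ∘ σ` is the identity, `Ω = σ^* q^* Ω = -σ^* dθ`, and pullback commutes with the
exterior derivative. -/
theorem eq_neg_d_pullback_section :
    Ω = -(FormField.pullback (𝓡 (2 * n)) (𝓡 (2 * n + 1)) σ θ).d := by
  have := hP.isManifold_source
  have := hP.isManifold_target
  funext γ
  have h1 : (FormField.pullback (𝓡 (2 * n)) (𝓡 (2 * n + 1)) σ θ).d γ =
      FormField.pullback (𝓡 (2 * n)) (𝓡 (2 * n + 1)) σ θ.d γ :=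
    FormField.d_pullback hP.contact.contact.smooth hT.smooth_section.contMDiffAt
  have h2 : Ω γ = FormField.pullback (𝓡 (2 * n)) (𝓡 (2 * n + 1)) σ
      (FormField.pullback (𝓡 (2 * n + 1)) (𝓡 (2 * n)) q Ω) γ := by
    rw [← FormField.pullback_comp Ω (hP.smooth.mdifferentiableAt (by simp))
      (hT.smooth_section.mdifferentiableAt (by simp)), show q ∘ σ = id from funext hT.proj_section,
      FormField.pullback_id]
  rw [hP.form] at h2
  rw [h2, Pi.neg_apply, h1]
  rfl

end Section

include hP hA hT

/-- The height of products. -/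
theorem height_tmul {s s' : S} (e : 𝒮.src s = 𝒮.tgt s') :
    z (𝒮.tmul s s') = z s + z s' + z (𝒮.tmul (σ (q s)) (σ (q s'))) := by
  have e' : 𝒢.src (q s) = 𝒢.tgt (q s') := by rw [hP.hom.map_src, hP.hom.map_tgt, e]
  -- Both factors are written as translates of the section, and the times of the translations add.
  have h1 := hA.tmul (z s) (z s') _ _ (hP.comp_section hT e')
  rw [hT.action_section, hT.action_section] at h1
  rw [h1, hT.height_action, add_comm]

/-- The height of a triple product of values of the section is computed with either bracketing. -/
theorem isCocycle : 𝒢.IsCocycle fun p => z (𝒮.tmul (σ (𝒢.pr₁ p)) (σ (𝒢.pr₂ p))) := by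
  intro g h k gh hk
  have e₁ := hP.comp_section hT gh
  have e₂ := hP.comp_section hT hk
  have h1 := hP.height_tmul hA hT (s := 𝒮.tmul (σ g) (σ h)) (s' := σ k)
    ((ArrowGroupoid.src_tmul e₁).trans e₂)
  have h2 := hP.height_tmul hA hT (s := σ g) (s' := 𝒮.tmul (σ h) (σ k))
    (e₁.trans (ArrowGroupoid.tgt_tmul e₂).symm)
  rw [ArrowGroupoid.tmul_assoc e₁ e₂, h2, hT.height_section, hT.height_section,
    hP.hom.map_tmul e₁, hP.hom.map_tmul e₂, hT.proj_section, hT.proj_section, hT.proj_section,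
    ArrowGroupoid.tmul_eq gh, ArrowGroupoid.tmul_eq hk, zero_add, add_zero] at h1
  exact h1.symm

/-- The form `θ` is pulled back along both sides of `σ(g) σ(h) = A_{c(g,h)} σ(gh)`: multiplicativity
expands the left side, and the Reeb action contributes `dc` on the right. -/
theorem coboundary_pullback_section :
    𝒢.coboundary (3 * n) (FormField.pullback (𝓡 (2 * n)) (𝓡 (2 * n + 1)) σ θ) =
      FormField.differential (𝓡 (3 * n))
        fun p => z (𝒮.tmul (σ (𝒢.pr₁ p)) (σ (𝒢.pr₂ p))) := by
  have hd : (∞ : WithTop ℕ∞) ≠ 0 := by simp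
  have h₁ := hP.symplectic.lie.contMDiff_pr₁
  have h₂ := hP.symplectic.lie.contMDiff_pr₂
  have hm := hP.symplectic.lie.smooth_mul
  have hσ := hT.smooth_section
  funext p
  refine FormField.ext_toCLM ?_
  rw [ArrowGroupoid.toCLM_coboundary, FormField.toCLM_differential,
    FormField.along_pullback θ (hσ.mdifferentiableAt hd) (h₁.mdifferentiableAt hd),
    FormField.along_pullback θ (hσ.mdifferentiableAt hd) (h₂.mdifferentiableAt hd),
    FormField.along_pullback θ (hσ.mdifferentiableAt hd) (hm.mdifferentiableAt hd)]
  have e₁ := hP.contact.lie.along_tmul hP.contact.multiplicative (hσ.comp h₁).contMDiffAt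
    (hσ.comp h₂).contMDiffAt (x := p) (Eventually.of_forall fun p => hP.comp_section hT p.2)
  have e₂ := hA.along_comp ((hP.contMDiff_cocycle hT).mdifferentiableAt hd (x := p))
    ((hσ.comp hm).mdifferentiableAt hd)
  have e₃ : (fun p : 𝒢.Pairs => 𝒮.tmul ((σ ∘ 𝒢.pr₁) p) ((σ ∘ 𝒢.pr₂) p)) =
      fun p => A (z (𝒮.tmul (σ (𝒢.pr₁ p)) (σ (𝒢.pr₂ p)))) ((σ ∘ 𝒢.mul) p) := by
    funext p
    exact (hP.tmul_section hT p.2).trans (by rw [ArrowGroupoid.tmul_eq p.2]; rfl)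
  rw [e₃, e₂] at e₁
  rw [sub_add_eq_add_sub, ← e₁, add_sub_cancel_right]

/-- The trivialization as a diffeomorphism. -/
noncomputable def trivializationDiffeomorph :
    S ≃ₘ^∞⟮𝓡 (2 * n + 1), (𝓡 (2 * n)).prod 𝓘(ℝ, ℝ)⟯ (Sig × ℝ) where
  toFun s := (q s, z s)
  invFun p := A p.2 (σ p.1)
  left_inv s := hT.action_section s
  right_inv p := Prod.ext ((hA.proj _ _).trans (hT.proj_section _))
    ((hT.height_action _ _).trans (by rw [hT.height_section, zero_add]))
  contMDiff_toFun := hP.smooth.prodMk hT.smooth_height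
  contMDiff_invFun p := hA.contMDiffAt_comp contMDiffAt_snd
    (hT.smooth_section.contMDiffAt.comp p contMDiffAt_fst)

theorem isHom_trivializationDiffeomorph :
    𝒮.IsHom (𝒢.centralExtension _ (hP.isCocycle hA hT))
      (hP.trivializationDiffeomorph hA hT) where
  map_src := hP.hom.map_src
  map_tgt := hP.hom.map_tgt
  map_mul p := by
    refine Prod.ext (hP.hom.map_mul p) ?_
    have h1 := hP.height_tmul hA hT p.2
    rw [ArrowGroupoid.tmul_eq p.2] at h1
    exact h1

/-- The form `θ` is pulled back along the identity written as `s = A_{z(s)} σ(q(s))`; the variable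
time contributes `dz` and the section contributes `q^*σ^*θ`. -/
theorem form_eq_pullback_trivializationDiffeomorph :
    θ = FormField.pullback (𝓡 (2 * n + 1)) ((𝓡 (2 * n)).prod 𝓘(ℝ, ℝ))
      (hP.trivializationDiffeomorph hA hT)
      (FormField.differential ((𝓡 (2 * n)).prod 𝓘(ℝ, ℝ)) Prod.snd +
        FormField.pullback ((𝓡 (2 * n)).prod 𝓘(ℝ, ℝ)) (𝓡 (2 * n)) Prod.fst
          (FormField.pullback (𝓡 (2 * n)) (𝓡 (2 * n + 1)) σ θ)) := by
  have hd : (∞ : WithTop ℕ∞) ≠ 0 := by simp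
  have hz := hT.smooth_height
  have hσ := hT.smooth_section
  have hq := hP.smooth
  funext s
  refine FormField.ext_toCLM ?_
  have hΦ : tangentMapCLM (𝓡 (2 * n + 1)) ((𝓡 (2 * n)).prod 𝓘(ℝ, ℝ))
      (hP.trivializationDiffeomorph hA hT) s =
      (tangentMapCLM (𝓡 (2 * n + 1)) (𝓡 (2 * n)) q s).prod
        (tangentMapCLM (𝓡 (2 * n + 1)) 𝓘(ℝ, ℝ) z s) :=
    tangentMapCLM_prodMk (hq.mdifferentiableAt hd) (hz.mdifferentiableAt hd)
  rw [FormField.toCLM_pullback, FormField.toCLM_add, FormField.toCLM_differential,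
    FormField.toCLM_pullback, hΦ, tangentMapCLM_fst, tangentMapCLM_snd]
  have h1 := hA.along_comp (hz.mdifferentiableAt hd (x := s))
    ((hσ.comp hq).mdifferentiableAt hd)
  have h2 : (fun s => A (z s) ((σ ∘ q) s)) = id := funext hT.action_section
  have h3 : θ.along (𝓡 (2 * n + 1)) id s = θ.toCLM s := by
    unfold FormField.along
    rw [tangentMapCLM_id]
    rfl
  rw [h2, h3, ← FormField.along_pullback θ (hσ.mdifferentiableAt hd)
    (hq.mdifferentiableAt hd)] at h1
  rw [h1]
  rfl

end IsPrequantization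

theorem mainTheorem7 (n : ℕ)
    {M Sig S : Type*}
    [TopologicalSpace M] [ChartedSpace (EuclideanSpace ℝ (Fin n)) M]
    [TopologicalSpace Sig] [ChartedSpace (EuclideanSpace ℝ (Fin (2 * n))) Sig]
    [TopologicalSpace S] [ChartedSpace (EuclideanSpace ℝ (Fin (2 * n + 1))) S]
    -- the symplectic groupoid
    (𝒢 : ArrowGroupoid Sig M) [ChartedSpace (EuclideanSpace ℝ (Fin (3 * n))) 𝒢.Pairs]
    (Ω : FormField (𝓡 (2 * n)) 2 Sig) (hΩ : IsSymplecticGroupoid (2 * n) n (3 * n) 𝒢 Ω)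
    -- the contact groupoid
    (𝒮 : ArrowGroupoid S M) [ChartedSpace (EuclideanSpace ℝ (Fin (3 * n + 2))) 𝒮.Pairs]
    (θ : FormField (𝓡 (2 * n + 1)) 1 S) (hθ : IsStrictContactGroupoid n n (3 * n + 2) 𝒮 θ)
    -- the fibration of the contact groupoid over the symplectic groupoid
    (q : S → Sig) (hq_smooth : ContMDiff (𝓡 (2 * n + 1)) (𝓡 (2 * n)) ∞ q)
    (hq_hom : 𝒮.IsHom 𝒢 q) (hq_surj : Function.Surjective q)
    (hq_form : FormField.pullback (𝓡 (2 * n + 1)) (𝓡 (2 * n)) q Ω = -θ.d)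
    -- the fibers are lines
    (hq_line : ∀ γ : Sig, Nonempty ((q ⁻¹' {γ} : Set S) ≃ₜ ℝ))
    [T2Space Sig] [ParacompactSpace Sig] :
    ∃ (θ₀ : FormField (𝓡 (2 * n)) 1 Sig) (c : 𝒢.Pairs → ℝ) (hc : 𝒢.IsCocycle c),
      θ₀.IsSmooth ∧ ContMDiff (𝓡 (3 * n)) 𝓘(ℝ, ℝ) ∞ c ∧
      Ω = -θ₀.d ∧
      𝒢.coboundary (3 * n) θ₀ = FormField.differential (𝓡 (3 * n)) c ∧
      (∀ x : M, c (𝒢.unitPair x) = 0 ∧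
        FormField.differential (𝓡 (3 * n)) c (𝒢.unitPair x) = 0) ∧
      ∃ Φ : S ≃ₘ^∞⟮𝓡 (2 * n + 1), (𝓡 (2 * n)).prod 𝓘(ℝ, ℝ)⟯ (Sig × ℝ),
        𝒮.IsHom (𝒢.centralExtension c hc) Φ ∧
        (∀ g : S, (Φ g).1 = q g) ∧
        θ = FormField.pullback (𝓡 (2 * n + 1)) ((𝓡 (2 * n)).prod 𝓘(ℝ, ℝ)) Φ
          (FormField.differential ((𝓡 (2 * n)).prod 𝓘(ℝ, ℝ)) Prod.snd +
            FormField.pullback ((𝓡 (2 * n)).prod 𝓘(ℝ, ℝ)) (𝓡 (2 * n)) Prod.fst θ₀) := by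
  have hP : IsPrequantization n 𝒢 Ω 𝒮 θ q :=
    ⟨hΩ, hθ, hq_smooth, hq_hom, hq_surj, hq_form, hq_line⟩
  have := hP.isManifold_source
  have := hP.isManifold_target
  obtain ⟨A, hA⟩ := hP.exists_reebAction
  obtain ⟨z, σ, hT⟩ := hP.exists_trivialization hA
  have hl := fun (p : 𝒢.Pairs) => hP.height_tmul_unit_left hT p.2
  have hr := fun (p : 𝒢.Pairs) => hP.height_tmul_unit_right hT p.2
  refine ⟨FormField.pullback (𝓡 (2 * n)) (𝓡 (2 * n + 1)) σ θ,
    fun p => z (𝒮.tmul (σ (𝒢.pr₁ p)) (σ (𝒢.pr₂ p))), hP.isCocycle hA hT,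
    hθ.contact.smooth.pullback hT.smooth_section, hP.contMDiff_cocycle hT,
    hP.eq_neg_d_pullback_section hT,
    hP.coboundary_pullback_section hA hT, fun x => ⟨hl _ (mem_range_self x), ?_⟩,
    hP.trivializationDiffeomorph hA hT, hP.isHom_trivializationDiffeomorph hA hT,
    fun g => rfl, hP.form_eq_pullback_trivializationDiffeomorph hA hT⟩
  refine FormField.ext_toCLM (I := 𝓡 (3 * n)) (x := 𝒢.unitPair x)
    (β := (0 : FormField (𝓡 (3 * n)) 1 𝒢.Pairs)) ?_
  rw [FormField.toCLM_differential]
  exact hΩ.lie.tangentMapCLM_unitPair_eq_zero (hP.contMDiff_cocycle hT) hl hr x
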